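/- **Proposition 2.2 (the solution to (D) can be computed in polynomial time).** Let $n\ge 1$, let $x_1,\dots,x_n\ge 0$ be observed demands, $c_1,c_2>0$ the unit underage and overage costs, $\delta\ge 0$ the Wasserstein radius, and $\mu,\sigma\ge 0$ the prescribed mean and standard deviation. For $\lambda=(\lambda_1,\lambda_2,\lambda_3)$ with $\lambda_1\ge 0$ and $Q\ge 0$ put $a=\lambda_1+\lambda_3$, $b_i=\lambda_1x_i-\lambda_2/2$, $$\Psi_i(\lambda,Q)=-\lambda_1x_i^2+\sup_{x\ge 0}\bigl\{c_1(x-Q)^++c_2(Q-x)^+-ax^2+2b_ix\bigr\}\in(-\infty,\infty],$$ $$F(\lambda,Q)=\lambda_1\delta+\lambda_2\mu+\lambda_3(\sigma^2+\mu^2)+\frac1n\sum_{i=1}^n\Psi_i(\lambda,Q),$$ and consider the dual of the moment-constrained Wasserstein distributionally robust newsvendor problem $$v^\ast=\inf_{Q\ge 0}\ \inf_{\lambda_1\ge 0,\ \lambda_2,\lambda_3\in\mathbb R}F(\lambda,Q),\tag{D}$$ assumed to be bounded below ($v^\ast>-\infty$; this holds in particular whenever the primal problem is feasible). For $\xi>0$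 and $Q\ge0$ let $$f(\xi,Q)=\inf_{\lambda_1\ge 0,\ \lambda_2}F(\lambda_1,\lambda_2,\xi-\lambda_1,Q),\qquad h(Q)=\inf_{\xi>0}f(\xi,Q).$$ Then: 1. $h$ is finite, convex and Lipschitz with constant $\max(c_1,c_2)$ on $[0,\infty)$, it attains its minimum there, and $\min_{Q\ge 0}h(Q)=v^\ast$. 2. There is an algorithm that computes, for given $\xi>0$ and $Q\ge 0$, the exact value $f(\xi,Q)$ and a minimizer $(\lambda_1,\lambda_2)$ in a number of operations bounded by a polynomial in $n$. 3. There is an algorithm that computes, for given $Q\ge0$ and $\varepsilon>0$, some $\hat\xi>0$ and the value $f(\hat\xi,Q)\le h(Q)+\varepsilon$ in polynomial time. 4. There is an algorithm that computes, for given $\varepsilon>0$, a feasible point $(\hat\lambda,\hat Q)$ of (D), with $\hat Q\ge 0$, $\hat\lambda_1\ge 0$, $\hat\lambda_1+\hat\lambda_3>0$, and its value $F(\hat\lambda,\hat Q)\le v^\ast+\varepsilon$ in polynomial time. Here an algorithm is a single program, independent of $n$ and of the data, for a real-number random access machine whose operations are $+,-,\times,\div,\sqrt{\cdot}$ and comparisons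 of real numbers, together with counting, indexing and branching, each at unit cost. In 3 and 4, polynomial time means that the number of operations is bounded by a polynomial in $n$, $\log_2\bigl(2+c_1+c_2+\delta+\mu+\sigma+\sum_i x_i\bigr)$ (with $Q$ added inside the logarithm in 3) and $\log_2(2+1/\varepsilon)$, up to rounding of the logarithms. -/

import Mathlib

noncomputable section

namespace RealRAM

/-- Memory of a real RAM: natural-number registers (used for counting and indexing) and
arrays of real numbers; `real k j` is entry `j` of array `k`. -/
structure State where
  nat : ℕ → ℕ
  real : ℕ → ℕ → ℝ

/-- Index expressions. There is no way to turn a real number into an index. -/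
inductive NExpr where
  | const (m : ℕ)
  | reg (r : ℕ)
  | add (a b : NExpr)
  | sub (a b : NExpr)

namespace NExpr

def eval (s : State) : NExpr → ℕ
  | const m => m
  | reg r => s.nat r
  | add a b => a.eval s + b.eval s
  | sub a b => a.eval s - b.eval s

/-- Number of elementary operations. -/
def cost : NExpr → ℕ
  | const _ => 1
  | reg _ => 1
  | add a b => a.cost + b.cost + 1
  | sub a b => a.cost + b.cost + 1

end NExpr

/-- Real expressions: rational constants, array entries, `+`, `-`, `*`, `/` and square roots
(division by zero and the square root of a negative number return `0`). -/
inductive RExpr where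
  | const (q : ℚ)
  | read (k : ℕ) (j : NExpr)
  | add (a b : RExpr)
  | sub (a b : RExpr)
  | mul (a b : RExpr)
  | div (a b : RExpr)
  | sqrt (a : RExpr)

namespace RExpr

def eval (s : State) : RExpr → ℝ
  | const q => (q : ℝ)
  | read k j => s.real k (j.eval s)
  | add a b => a.eval s + b.eval s
  | sub a b => a.eval s - b.eval s
  | mul a b => a.eval s * b.eval s
  | div a b => a.eval s / b.eval s
  | sqrt a => Real.sqrt (a.eval s)

/-- Number of elementary operations. -/
def cost : RExpr → ℕ
  | const _ => 1
  | read _ j => j.cost + 1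
  | add a b => a.cost + b.cost + 1
  | sub a b => a.cost + b.cost + 1
  | mul a b => a.cost + b.cost + 1
  | div a b => a.cost + b.cost + 1
  | sqrt a => a.cost + 1

end RExpr

/-- Tests: comparisons of indices, comparisons of reals, and Boolean combinations. -/
inductive Test where
  | natLE (a b : NExpr)
  | realLE (a b : RExpr)
  | neg (p : Test)
  | conj (p q : Test)

namespace Test

def Holds (s : State) : Test → Prop
  | natLE a b => a.eval s ≤ b.eval s
  | realLE a b => a.eval s ≤ b.eval s
  | neg p => ¬ p.Holds s
  | conj p q => p.Holds s ∧ q.Holds s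

/-- Number of elementary operations. -/
def cost : Test → ℕ
  | natLE a b => a.cost + b.cost + 1
  | realLE a b => a.cost + b.cost + 1
  | neg p => p.cost + 1
  | conj p q => p.cost + q.cost + 1

end Test

/-- Programs of the real RAM. A program is a finite object. -/
inductive Program where
  | skip
  | setNat (r : ℕ) (e : NExpr)
  | setReal (k : ℕ) (j : NExpr) (e : RExpr)
  | seq (P P' : Program)
  | branch (b : Test) (P P' : Program)
  | loop (b : Test) (P : Program)

/-- `Runs P s s' t`: started in state `s`, the program `P` halts in state `s'` after
exactly `t` elementary operations. -/
inductive Runs : Program → State → State → ℕ → Prop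
  | skip (s : State) : Runs Program.skip s s 1
  | setNat (s : State) (r : ℕ) (e : NExpr) :
      Runs (Program.setNat r e) s
        ⟨Function.update s.nat r (e.eval s), s.real⟩ (e.cost + 1)
  | setReal (s : State) (k : ℕ) (j : NExpr) (e : RExpr) :
      Runs (Program.setReal k j e) s
        ⟨s.nat, Function.update s.real k (Function.update (s.real k) (j.eval s) (e.eval s))⟩
        (j.cost + e.cost + 1)
  | seq {P P' : Program} {s s' s'' : State} {t t' : ℕ} :
      Runs P s s' t → Runs P' s' s'' t' → Runs (Program.seq P P') s s'' (t + t')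
  | branchTrue {b : Test} {P P' : Program} {s s' : State} {t : ℕ} :
      b.Holds s → Runs P s s' t → Runs (Program.branch b P P') s s' (b.cost + t)
  | branchFalse {b : Test} {P P' : Program} {s s' : State} {t : ℕ} :
      ¬ b.Holds s → Runs P' s s' t → Runs (Program.branch b P P') s s' (b.cost + t)
  | loopDone {b : Test} {P : Program} {s : State} :
      ¬ b.Holds s → Runs (Program.loop b P) s s b.cost
  | loopStep {b : Test} {P : Program} {s s' s'' : State} {t t' : ℕ} :
      b.Holds s → Runs P s s' t → Runs (Program.loop b P) s' s'' t' →
        Runs (Program.loop b P) s s'' (b.cost + t + t')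

/-- Initial state: register `0` holds `n`, array `0` holds `x`, array `1` holds the remaining
parameters, and everything else is `0`. -/
def input {n : ℕ} (x : Fin n → ℝ) (params : List ℝ) : State where
  nat r := if r = 0 then n else 0
  real k j :=
    if k = 0 then (if hj : j < n then x ⟨j, hj⟩ else 0)
    else if k = 1 then params.getD j 0
    else 0

/-- Started in `s`, the program halts after at most `T` elementary operations, and the contents
of the output array `2` then satisfy `post`. -/
def HaltsWith (P : Program) (s : State) (T : ℕ) (post : (ℕ → ℝ) → Prop) : Prop :=
  ∃ (s' : State) (t : ℕ), Runs P s s' t ∧ t ≤ T ∧ post (s'.real 2)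

end RealRAM

/-- Data of the distributionally robust newsvendor problem: the demand sample `x`, the underage
cost `c₁`, the overage cost `c₂`, the Wasserstein radius `δ`, the mean `μ` and the standard
deviation `σ`. -/
structure Newsvendor (n : ℕ) where
  x : Fin n → ℝ
  c₁ : ℝ
  c₂ : ℝ
  δ : ℝ
  μ : ℝ
  σ : ℝ

namespace Newsvendor

variable {n : ℕ} (D : Newsvendor n)

/-- `g_i(y, λ, Q) = c₁ (y - Q)⁺ + c₂ (Q - y)⁺ - a y² + 2 b_i y` with `a = λ₁ + λ₃` and
`b_i = λ₁ x_i - λ₂ / 2`. -/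
def g (i : Fin n) (y l₁ l₂ l₃ Q : ℝ) : ℝ :=
  D.c₁ * max (y - Q) 0 + D.c₂ * max (Q - y) 0 - (l₁ + l₃) * y ^ 2
    + 2 * (l₁ * D.x i - l₂ / 2) * y

/-- `Ψ_i(λ, Q) = - λ₁ x_i² + sup_{y ≥ 0} g_i(y, λ, Q)`, with values in the extended reals. -/
def Psi (i : Fin n) (l₁ l₂ l₃ Q : ℝ) : EReal :=
  ((-(l₁ * D.x i ^ 2) : ℝ) : EReal) + ⨆ (y : ℝ) (_ : 0 ≤ y), ((D.g i y l₁ l₂ l₃ Q : ℝ) : EReal)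

/-- The dual objective
`F(λ, Q) = λ₁ δ + λ₂ μ + λ₃ (σ² + μ²) + (1/n) ∑ i, Ψ_i(λ, Q)`. -/
def F (l₁ l₂ l₃ Q : ℝ) : EReal :=
  ((l₁ * D.δ + l₂ * D.μ + l₃ * (D.σ ^ 2 + D.μ ^ 2) : ℝ) : EReal)
    + (((n : ℝ)⁻¹ : ℝ) : EReal) * ∑ i, D.Psi i l₁ l₂ l₃ Q

/-- The optimal value of the dual problem (D): the infimum of `F` over `Q ≥ 0`, `λ₁ ≥ 0` and
free `λ₂`, `λ₃`. -/
def dualValue : EReal :=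
  ⨅ (Q : ℝ) (_ : 0 ≤ Q) (l₁ : ℝ) (_ : 0 ≤ l₁) (l₂ : ℝ) (l₃ : ℝ), D.F l₁ l₂ l₃ Q

/-- `f(ξ, Q)`: the infimum of `F` over `λ₁ ≥ 0` and `λ₂`, where `λ₁ + λ₃ = ξ` is fixed. -/
def f (ξ Q : ℝ) : EReal :=
  ⨅ (l₁ : ℝ) (_ : 0 ≤ l₁) (l₂ : ℝ), D.F l₁ l₂ (ξ - l₁) Q

/-- `h(Q)`: the infimum of `f(ξ, Q)` over `ξ > 0`. -/
def h (Q : ℝ) : EReal :=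
  ⨅ (ξ : ℝ) (_ : 0 < ξ), D.f ξ Q

/-- Standing assumptions: there is at least one observation, observed demand is nonnegative, the
unit costs are positive, `δ`, `μ`, `σ` are nonnegative, and (D) is bounded below. -/
structure Admissible : Prop where
  n_pos : 0 < n
  x_nonneg : ∀ i, 0 ≤ D.x i
  c₁_pos : 0 < D.c₁
  c₂_pos : 0 < D.c₂
  δ_nonneg : 0 ≤ D.δ
  μ_nonneg : 0 ≤ D.μ
  σ_nonneg : 0 ≤ D.σ
  bounded : D.dualValue ≠ ⊥

/-- The parameters other than the sample, in the order in which a program receives them. -/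
def params : List ℝ := [D.c₁, D.c₂, D.δ, D.μ, D.σ]

/-- Size of the task of solving to accuracy `ε`: the number `n` of observations plus the numbers
of binary digits of the magnitude of the data (including `Q`) and of `1 / ε`. -/
def size (Q ε : ℝ) : ℕ :=
  n + ⌈Real.logb 2 (2 + D.c₁ + D.c₂ + |D.δ| + |D.μ| + |D.σ| + (∑ i, |D.x i|) + |Q|)⌉₊
    + ⌈Real.logb 2 (2 + 1 / ε)⌉₊

end Newsvendor

end

/-! For `ξ = λ₁ + λ₃ > 0` the inner supremum is elementary: the loss is the maximum of two affine
functions of `y`, so the supremum is the larger of two maxima of concave quadratics, which is the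
closed form `phi`. For each fixed `y` the expression under the supremum is convex in `(Q, ξ, b)`.
Hence the real objective `obj` is jointly convex, and `f` and `h` inherit convexity by partial
minimization.

Boundedness of (D) enters through `obj_free_nonneg`. With zero costs the objective is positively
homogeneous, so a negative value could be scaled to `-∞`. It follows that `obj` is nonnegative and,
after a shift of `λ₂` by `c₂`, that it is at least `c₂ (Q - μ)`. This makes `h` coercive and gives
the minimum. Multipliers with `λ₁ + λ₃ ≤ 0` contribute nothing new (`h_le_F`): a negative sum gives
the value `∞`, and a zero sum is a limit of positive ones.

For fixed `ξ` and `Q` the objective is piecewise quadratic on the half-plane `λ₁ ≥ 0`, with pieces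
separated by `2 n` lines. From any point one can move without increasing the objective to a point
where two affine functions from an explicit list vanish: separating lines, components of the
gradient of a piece, derivatives of a piece along a line (`exists_isVertex`). Because `λ₁ ≥ 0`, each
`bᵢ` is monotone in `xᵢ`, so two thresholds determine the piece and there are at most `(n + 1)²`
quadratics. Polynomially many candidates therefore contain a minimizer; this gives both existence
and the exact algorithm.

In `ξ` and `Q` one searches by trisection, which needs bounded ranges. Raising a small `ξ` costs at
most `σ² + μ²` per unit. For large `ξ`, the optimality conditions of the zero-cost problem produce
points `Yᵢ` obeying the moment and transport constraints (`exists_moment`). Their multiplier, scaled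
by `B`, penalizes the distance of `y` from `Yᵢ` by `B (y - Yᵢ)²`, so stopping at `ξ = B` loses at
most `max(c₁, c₂)² / (4 B)` (`exists_obj_le_add`). For large `Q`, `h` equals `c₂ (Q - μ)` up to
`O(1/Q)`. All ratios of range to tolerance are at most a fixed power of `2 ^ size`, so linearly many
passes in the size suffice.

The running time of a program is a polynomial in the largest number of passes of any of its loops,
and here that number is linear in `n` or in the size. -/

theorem EReal.coe_finset_sum' {ι : Type*} (s : Finset ι) (u : ι → ℝ) :
    ((∑ i ∈ s, u i : ℝ) : EReal) = ∑ i ∈ s, (u i : EReal) := by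
  classical
  induction s using Finset.induction_on with
  | empty => simp
  | insert a s ha ih => rw [Finset.sum_insert ha, Finset.sum_insert ha, EReal.coe_add, ih]

/-! ### The inner supremum in closed form -/

noncomputable section

namespace Newsvendor

/-- The newsvendor loss `c₁ (y - Q)⁺ + c₂ (Q - y)⁺`. -/
def loss (c₁ c₂ Q y : ℝ) : ℝ := c₁ * max (y - Q) 0 + c₂ * max (Q - y) 0

/-- The closed form of `sup_{y ≥ 0} {loss y - ξ y² + 2 b y}` for `ξ > 0`. -/
def phi (c₁ c₂ Q ξ b : ℝ) : ℝ :=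
  max (-(c₁ * Q) + max (b + c₁ / 2) 0 ^ 2 / ξ) (c₂ * Q + max (b - c₂ / 2) 0 ^ 2 / ξ)

theorem two_mul_sub_le_posPart_sq_div {ξ t y : ℝ} (hξ : 0 < ξ) (hy : 0 ≤ y) :
    2 * t * y - ξ * y ^ 2 ≤ max t 0 ^ 2 / ξ := by
  rw [le_div_iff₀ hξ]
  rcases le_total t 0 with ht | ht
  · rw [max_eq_right ht]
    have h1 : 2 * t * y ≤ 0 := by nlinarith
    have h2 : 0 ≤ ξ * y ^ 2 := by positivity
    nlinarith
  · rw [max_eq_left ht]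
    nlinarith [sq_nonneg (t - ξ * y)]

theorem two_mul_sub_eq_posPart_sq_div {ξ t : ℝ} (hξ : 0 < ξ) :
    2 * t * (max t 0 / ξ) - ξ * (max t 0 / ξ) ^ 2 = max t 0 ^ 2 / ξ := by
  rcases le_total t 0 with ht | ht
  · rw [max_eq_right ht]; simp
  · rw [max_eq_left ht]; field_simp; ring

theorem loss_eq {c₁ c₂ Q y : ℝ} (h₁ : 0 ≤ c₁) (h₂ : 0 ≤ c₂) :
    loss c₁ c₂ Q y = max (c₁ * (y - Q)) (c₂ * (Q - y)) := by
  unfold loss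
  rcases le_total y Q with h | h
  · rw [max_eq_right (by linarith : y - Q ≤ 0), max_eq_left (by linarith : 0 ≤ Q - y),
      max_eq_right]
    · ring
    · nlinarith
  · rw [max_eq_left (by linarith : 0 ≤ y - Q), max_eq_right (by linarith : Q - y ≤ 0),
      max_eq_left]
    · ring
    · nlinarith

theorem loss_nonneg {c₁ c₂ Q y : ℝ} (h₁ : 0 ≤ c₁) (h₂ : 0 ≤ c₂) : 0 ≤ loss c₁ c₂ Q y := by
  unfold loss; positivity

theorem le_phi {c₁ c₂ Q ξ b y : ℝ} (h₁ : 0 ≤ c₁) (h₂ : 0 ≤ c₂) (hξ : 0 < ξ) (hy : 0 ≤ y) :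
    loss c₁ c₂ Q y - ξ * y ^ 2 + 2 * b * y ≤ phi c₁ c₂ Q ξ b := by
  have e1 := two_mul_sub_le_posPart_sq_div (t := b + c₁ / 2) hξ hy
  have e2 := two_mul_sub_le_posPart_sq_div (t := b - c₂ / 2) hξ hy
  rw [loss_eq h₁ h₂, phi]
  rcases le_total (c₁ * (y - Q)) (c₂ * (Q - y)) with h | h
  · rw [max_eq_right h]; exact le_max_of_le_right (by linarith)
  · rw [max_eq_left h]; exact le_max_of_le_left (by linarith)

/-- Each of the two quadratics has its maximum over `y ≥ 0` at `t⁺ / ξ`, and the loss dominates both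
affine functions; so the maximizer of the larger quadratic serves. -/
theorem exists_phi_le {c₁ c₂ Q ξ : ℝ} (b : ℝ) (h₁ : 0 ≤ c₁) (h₂ : 0 ≤ c₂) (hξ : 0 < ξ) :
    ∃ y, 0 ≤ y ∧ phi c₁ c₂ Q ξ b ≤ loss c₁ c₂ Q y - ξ * y ^ 2 + 2 * b * y := by
  have e1 := two_mul_sub_eq_posPart_sq_div (t := b + c₁ / 2) hξ
  have e2 := two_mul_sub_eq_posPart_sq_div (t := b - c₂ / 2) hξ
  rw [phi]
  rcases le_total (-(c₁ * Q) + max (b + c₁ / 2) 0 ^ 2 / ξ)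
    (c₂ * Q + max (b - c₂ / 2) 0 ^ 2 / ξ) with h | h
  · refine ⟨max (b - c₂ / 2) 0 / ξ, by positivity, ?_⟩
    rw [max_eq_right h, loss_eq h₁ h₂]
    have := le_max_right (c₁ * (max (b - c₂ / 2) 0 / ξ - Q)) (c₂ * (Q - max (b - c₂ / 2) 0 / ξ))
    linarith
  · refine ⟨max (b + c₁ / 2) 0 / ξ, by positivity, ?_⟩
    rw [max_eq_left h, loss_eq h₁ h₂]
    have := le_max_left (c₁ * (max (b + c₁ / 2) 0 / ξ - Q)) (c₂ * (Q - max (b + c₁ / 2) 0 / ξ))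
    linarith

/-- Lets `phi` be handled as a supremum: convexity, Lipschitz continuity and monotonicity are
checked below for a fixed `y` only. -/
theorem phi_le {c₁ c₂ Q ξ b v : ℝ} (h₁ : 0 ≤ c₁) (h₂ : 0 ≤ c₂) (hξ : 0 < ξ)
    (h : ∀ y, 0 ≤ y → loss c₁ c₂ Q y - ξ * y ^ 2 + 2 * b * y ≤ v) : phi c₁ c₂ Q ξ b ≤ v := by
  obtain ⟨y, hy, hle⟩ := exists_phi_le (Q := Q) b h₁ h₂ hξ
  exact hle.trans (h y hy)

theorem phi_zero {Q ξ b : ℝ} : phi 0 0 Q ξ b = max b 0 ^ 2 / ξ := by simp [phi]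

theorem posPart_sq_div_le_phi {c₁ c₂ Q ξ b : ℝ} (h₁ : 0 ≤ c₁) (h₂ : 0 ≤ c₂) (hξ : 0 < ξ) :
    max b 0 ^ 2 / ξ ≤ phi c₁ c₂ Q ξ b := by
  rw [← phi_zero (Q := Q)]
  refine phi_le le_rfl le_rfl hξ fun y hy => ?_
  have := le_phi (Q := Q) (b := b) h₁ h₂ hξ hy
  have h3 := loss_nonneg (Q := Q) (y := y) h₁ h₂
  have h4 : loss 0 0 Q y = 0 := by simp [loss]
  linarith

theorem loss_convex {c₁ c₂ Q Q' y a b : ℝ} (h₁ : 0 ≤ c₁) (h₂ : 0 ≤ c₂) (ha : 0 ≤ a) (hb : 0 ≤ b)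
    (hab : a + b = 1) :
    loss c₁ c₂ (a * Q + b * Q') y ≤ a * loss c₁ c₂ Q y + b * loss c₁ c₂ Q' y := by
  rw [loss_eq h₁ h₂, loss_eq h₁ h₂, loss_eq h₁ h₂]
  have hb' : b = 1 - a := by linarith
  subst hb'
  have p1 := mul_le_mul_of_nonneg_left (le_max_left (c₁ * (y - Q)) (c₂ * (Q - y))) ha
  have p2 := mul_le_mul_of_nonneg_left (le_max_right (c₁ * (y - Q)) (c₂ * (Q - y))) ha
  have p3 := mul_le_mul_of_nonneg_left (le_max_left (c₁ * (y - Q')) (c₂ * (Q' - y))) hb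
  have p4 := mul_le_mul_of_nonneg_left (le_max_right (c₁ * (y - Q')) (c₂ * (Q' - y))) hb
  apply max_le <;> linarith

/-- For fixed `y`, the loss is convex in `Q` and the remaining terms are linear in `(ξ, b)`; a
supremum of convex functions is convex. -/
theorem phi_convex {c₁ c₂ Q Q' ξ ξ' t t' a b : ℝ} (h₁ : 0 ≤ c₁) (h₂ : 0 ≤ c₂) (hξ : 0 < ξ)
    (hξ' : 0 < ξ') (ha : 0 ≤ a) (hb : 0 ≤ b) (hab : a + b = 1) :
    phi c₁ c₂ (a * Q + b * Q') (a * ξ + b * ξ') (a * t + b * t')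
      ≤ a * phi c₁ c₂ Q ξ t + b * phi c₁ c₂ Q' ξ' t' := by
  have hpos : 0 < a * ξ + b * ξ' := by
    rcases eq_or_lt_of_le ha with h | h
    · have : b = 1 := by linarith
      subst this; subst h; linarith
    · have := mul_pos h hξ
      have := mul_nonneg hb hξ'.le
      linarith
  refine phi_le h₁ h₂ hpos fun y hy => ?_
  have e0 := loss_convex (Q := Q) (Q' := Q') (y := y) h₁ h₂ ha hb hab
  have e1 := mul_le_mul_of_nonneg_left (le_phi (Q := Q) (b := t) h₁ h₂ hξ hy) ha
  have e2 := mul_le_mul_of_nonneg_left (le_phi (Q := Q') (b := t') h₁ h₂ hξ' hy) hb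
  linarith

theorem loss_lipschitz {c₁ c₂ Q Q' y y' : ℝ} (h₁ : 0 ≤ c₁) (h₂ : 0 ≤ c₂) :
    loss c₁ c₂ Q y ≤ loss c₁ c₂ Q' y' + max c₁ c₂ * |(y - Q) - (y' - Q')| := by
  rw [loss_eq h₁ h₂, loss_eq h₁ h₂]
  have m1 := le_max_left c₁ c₂
  have m2 := le_max_right c₁ c₂
  have a1 := le_abs_self ((y - Q) - (y' - Q'))
  have a2 := neg_abs_le ((y - Q) - (y' - Q'))
  have a0 := abs_nonneg ((y - Q) - (y' - Q'))
  have p1 := le_max_left (c₁ * (y' - Q')) (c₂ * (Q' - y'))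
  have p2 := le_max_right (c₁ * (y' - Q')) (c₂ * (Q' - y'))
  apply max_le
  · have := mul_le_mul_of_nonneg_left a1 h₁
    have := mul_le_mul_of_nonneg_right m1 a0
    linarith
  · have := mul_le_mul_of_nonneg_left a2 h₂
    have := mul_le_mul_of_nonneg_right m2 a0
    linarith

theorem phi_lipschitz {c₁ c₂ Q Q' ξ b : ℝ} (h₁ : 0 ≤ c₁) (h₂ : 0 ≤ c₂) (hξ : 0 < ξ) :
    phi c₁ c₂ Q ξ b ≤ phi c₁ c₂ Q' ξ b + max c₁ c₂ * |Q - Q'| := by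
  refine phi_le h₁ h₂ hξ fun y hy => ?_
  have e0 := loss_lipschitz (Q := Q) (Q' := Q') (y := y) (y' := y) h₁ h₂
  have e1 := le_phi (Q := Q') (b := b) h₁ h₂ hξ hy
  rw [show y - Q - (y - Q') = -(Q - Q') by ring, abs_neg] at e0
  linarith

theorem phi_anti {c₁ c₂ Q ξ ξ' b : ℝ} (h₁ : 0 ≤ c₁) (h₂ : 0 ≤ c₂) (hξ : 0 < ξ) (h : ξ ≤ ξ') :
    phi c₁ c₂ Q ξ' b ≤ phi c₁ c₂ Q ξ b := by
  refine phi_le h₁ h₂ (hξ.trans_le h) fun y hy => ?_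
  have e1 := le_phi (Q := Q) (b := b) h₁ h₂ hξ hy
  have := mul_le_mul_of_nonneg_right h (sq_nonneg y)
  linarith

/-! ### The dual objective as a real function and its bounds -/

variable {n : ℕ} (D : Newsvendor n)

/-- The prescribed second moment `σ² + μ²`. -/
def sm : ℝ := D.σ ^ 2 + D.μ ^ 2

theorem sm_nonneg : 0 ≤ D.sm := by unfold sm; positivity

/-- The real value of `F(λ₁, λ₂, ξ - λ₁, Q)` for `ξ > 0`. -/
def obj (ξ Q l₁ l₂ : ℝ) : ℝ :=
  l₁ * D.δ + l₂ * D.μ + (ξ - l₁) * D.sm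
    + (n : ℝ)⁻¹ * ∑ i, (-(l₁ * D.x i ^ 2) + phi D.c₁ D.c₂ Q ξ (l₁ * D.x i - l₂ / 2))

theorem g_eq (i : Fin n) (y l₁ l₂ l₃ Q : ℝ) :
    D.g i y l₁ l₂ l₃ Q = loss D.c₁ D.c₂ Q y - (l₁ + l₃) * y ^ 2
      + 2 * (l₁ * D.x i - l₂ / 2) * y := rfl

/-- Nonnegativity of the sample and of the costs, and nonemptiness of the sample. -/
structure Regular : Prop where
  n_pos : 0 < n
  x_nonneg : ∀ i, 0 ≤ D.x i
  c₁_nonneg : 0 ≤ D.c₁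
  c₂_nonneg : 0 ≤ D.c₂

variable {D}

theorem Admissible.regular (hD : D.Admissible) : D.Regular :=
  ⟨hD.n_pos, hD.x_nonneg, hD.c₁_pos.le, hD.c₂_pos.le⟩

theorem Psi_eq (hD : D.Regular) (i : Fin n) {l₁ l₂ l₃ Q : ℝ} (h : 0 < l₁ + l₃) :
    D.Psi i l₁ l₂ l₃ Q = ((-(l₁ * D.x i ^ 2)
      + phi D.c₁ D.c₂ Q (l₁ + l₃) (l₁ * D.x i - l₂ / 2) : ℝ) : EReal) := by
  rw [Psi, EReal.coe_add]
  congr 1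
  apply le_antisymm
  · refine iSup₂_le fun y hy => ?_
    rw [EReal.coe_le_coe_iff, g_eq]
    exact le_phi hD.c₁_nonneg hD.c₂_nonneg h hy
  · obtain ⟨y, hy, hle⟩ := exists_phi_le (Q := Q) (l₁ * D.x i - l₂ / 2) hD.c₁_nonneg
      hD.c₂_nonneg h
    exact (EReal.coe_le_coe_iff.2 hle).trans
      (le_iSup₂ (f := fun (y : ℝ) (_ : 0 ≤ y) => ((D.g i y l₁ l₂ l₃ Q : ℝ) : EReal)) y hy)

theorem F_eq (hD : D.Regular) {ξ l₁ l₂ Q : ℝ} (h : 0 < ξ) :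
    D.F l₁ l₂ (ξ - l₁) Q = ((D.obj ξ Q l₁ l₂ : ℝ) : EReal) := by
  have h' : l₁ + (ξ - l₁) = ξ := by ring
  rw [F, obj, EReal.coe_add _ ((n : ℝ)⁻¹ * _), EReal.coe_mul (n : ℝ)⁻¹, EReal.coe_finset_sum']
  congr 2
  refine Finset.sum_congr rfl fun i _ => ?_
  rw [Psi_eq hD i (by rw [h']; exact h), h']

theorem card_inv_mul_sum_const (hn : 0 < n) (c : ℝ) : (n : ℝ)⁻¹ * ∑ _i : Fin n, c = c := by
  have : (n : ℝ) ≠ 0 := by positivity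
  simp [this]

theorem card_inv_mul_sum_mono {u v : Fin n → ℝ} (h : ∀ i, u i ≤ v i) :
    (n : ℝ)⁻¹ * ∑ i, u i ≤ (n : ℝ)⁻¹ * ∑ i, v i :=
  mul_le_mul_of_nonneg_left (Finset.sum_le_sum fun i _ => h i) (by positivity)

theorem card_inv_mul_sum_add (u v : Fin n → ℝ) :
    (n : ℝ)⁻¹ * ∑ i, (u i + v i) = (n : ℝ)⁻¹ * ∑ i, u i + (n : ℝ)⁻¹ * ∑ i, v i := by
  rw [Finset.sum_add_distrib, mul_add]

theorem card_inv_mul_sum_mul (a : ℝ) (u : Fin n → ℝ) :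
    (n : ℝ)⁻¹ * ∑ i, a * u i = a * ((n : ℝ)⁻¹ * ∑ i, u i) := by
  rw [← Finset.mul_sum]; ring

/-- The problem with zero costs, whose dual objective is positively homogeneous. -/
def free (D : Newsvendor n) : Newsvendor n := { D with c₁ := 0, c₂ := 0 }

theorem Regular.free (hD : D.Regular) : D.free.Regular :=
  ⟨hD.n_pos, hD.x_nonneg, le_rfl, le_rfl⟩

theorem obj_free (ξ Q l₁ l₂ : ℝ) :
    D.free.obj ξ Q l₁ l₂ = l₁ * D.δ + l₂ * D.μ + (ξ - l₁) * D.sm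
      + (n : ℝ)⁻¹ * ∑ i, (-(l₁ * D.x i ^ 2) + max (l₁ * D.x i - l₂ / 2) 0 ^ 2 / ξ) := by
  unfold obj
  have : D.free.c₁ = 0 := rfl
  have : D.free.c₂ = 0 := rfl
  simp only [*, phi_zero]
  rfl

theorem obj_free_smul {ξ t : ℝ} (ht : 0 < t) (Q l₁ l₂ : ℝ) :
    D.free.obj (t * ξ) Q (t * l₁) (t * l₂) = t * D.free.obj ξ Q l₁ l₂ := by
  rw [obj_free, obj_free]
  have : ∀ i, -(t * l₁ * D.x i ^ 2) + max (t * l₁ * D.x i - t * l₂ / 2) 0 ^ 2 / (t * ξ)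
      = t * (-(l₁ * D.x i ^ 2) + max (l₁ * D.x i - l₂ / 2) 0 ^ 2 / ξ) := by
    intro i
    have h1 : max (t * l₁ * D.x i - t * l₂ / 2) 0 = t * max (l₁ * D.x i - l₂ / 2) 0 := by
      rw [mul_max_of_nonneg _ _ ht.le]; congr 1 <;> ring
    rw [h1, mul_pow, show t ^ 2 * max (l₁ * D.x i - l₂ / 2) 0 ^ 2
      = t * (t * max (l₁ * D.x i - l₂ / 2) 0 ^ 2) by ring, mul_div_assoc,
      mul_div_mul_left _ _ ht.ne']
    ring
  simp only [this, card_inv_mul_sum_mul]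
  ring

/-- Adding `1` to `λ₃` absorbs the linear growth of the loss. -/
theorem obj_add_one_le (hD : D.Regular) {ξ : ℝ} (hξ : 0 < ξ) (l₁ l₂ : ℝ) :
    D.obj (ξ + 1) 0 l₁ l₂ ≤ D.free.obj ξ 0 l₁ l₂ + (D.sm + D.c₁ ^ 2 / 4) := by
  have key : ∀ i, -(l₁ * D.x i ^ 2) + phi D.c₁ D.c₂ 0 (ξ + 1) (l₁ * D.x i - l₂ / 2)
      ≤ (-(l₁ * D.x i ^ 2) + max (l₁ * D.x i - l₂ / 2) 0 ^ 2 / ξ) + D.c₁ ^ 2 / 4 := by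
    intro i
    have : phi D.c₁ D.c₂ 0 (ξ + 1) (l₁ * D.x i - l₂ / 2)
        ≤ max (l₁ * D.x i - l₂ / 2) 0 ^ 2 / ξ + D.c₁ ^ 2 / 4 := by
      refine phi_le hD.c₁_nonneg hD.c₂_nonneg (by linarith) fun y hy => ?_
      have e1 := two_mul_sub_le_posPart_sq_div (t := l₁ * D.x i - l₂ / 2) hξ hy
      have e2 : loss D.c₁ D.c₂ 0 y = D.c₁ * y := by
        simp [loss, hy]
      rw [e2]
      nlinarith [sq_nonneg (y - D.c₁ / 2)]
    linarith
  have := (card_inv_mul_sum_mono key).trans_eq (card_inv_mul_sum_add _ _)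
  rw [card_inv_mul_sum_const hD.n_pos] at this
  rw [obj_free, obj]
  linarith

theorem dualValue_le (hD : D.Regular) {ξ Q l₁ l₂ : ℝ} (hξ : 0 < ξ) (hQ : 0 ≤ Q) (hl : 0 ≤ l₁) :
    D.dualValue ≤ ((D.obj ξ Q l₁ l₂ : ℝ) : EReal) := by
  rw [← F_eq hD hξ]
  exact (iInf₂_le Q hQ).trans ((iInf₂_le l₁ hl).trans ((iInf_le _ l₂).trans (iInf_le _ _)))

/-- A recession argument. Scaling a point with negative zero-cost value by `t` makes that value
arbitrarily negative, and passing to the true costs at `ξ + 1` adds only a constant independent of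
`t`; so (D) would be unbounded below. -/
theorem obj_free_nonneg (hD : D.Admissible) {ξ l₁ : ℝ} (hξ : 0 < ξ) (hl : 0 ≤ l₁) (Q l₂ : ℝ) :
    0 ≤ D.free.obj ξ Q l₁ l₂ := by
  have hQ : D.free.obj ξ Q l₁ l₂ = D.free.obj ξ 0 l₁ l₂ := by rw [obj_free, obj_free]
  rw [hQ]
  by_contra hneg
  push Not at hneg
  refine hD.bounded ((EReal.eq_bot_iff_forall_lt _).2 fun y => ?_)
  set κ := -D.free.obj ξ 0 l₁ l₂ with hκ
  have hκ0 : 0 < κ := by linarith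
  set C := D.sm + D.c₁ ^ 2 / 4 with hC
  have hC0 : 0 ≤ C := by have := D.sm_nonneg; positivity
  -- This scale brings the true objective to at most `-|y| - 1 < y`.
  set t := (C + |y| + 1) / κ with ht
  have ht0 : 0 < t := by positivity
  have e1 := obj_add_one_le hD.regular (mul_pos ht0 hξ) (t * l₁) (t * l₂)
  rw [obj_free_smul ht0] at e1
  have e2 := dualValue_le (l₂ := t * l₂) hD.regular (by positivity : 0 < t * ξ + 1) le_rfl
    (mul_nonneg ht0.le hl)
  refine e2.trans_lt (EReal.coe_lt_coe_iff.2 ?_)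
  have e3 : t * D.free.obj ξ 0 l₁ l₂ = -(C + |y| + 1) := by
    rw [show D.free.obj ξ 0 l₁ l₂ = -κ by rw [hκ]; ring, ht]; field_simp
  have := neg_abs_le y
  linarith

theorem obj_nonneg (hD : D.Admissible) {ξ l₁ : ℝ} (hξ : 0 < ξ) (hl : 0 ≤ l₁) (Q l₂ : ℝ) :
    0 ≤ D.obj ξ Q l₁ l₂ := by
  refine (obj_free_nonneg hD hξ hl Q l₂).trans ?_
  rw [obj_free, obj]
  have := card_inv_mul_sum_mono (u := fun i => -(l₁ * D.x i ^ 2)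
      + max (l₁ * D.x i - l₂ / 2) 0 ^ 2 / ξ) (v := fun i => -(l₁ * D.x i ^ 2)
      + phi D.c₁ D.c₂ Q ξ (l₁ * D.x i - l₂ / 2)) fun i => by
    have := posPart_sq_div_le_phi (Q := Q) (b := l₁ * D.x i - l₂ / 2) hD.regular.c₁_nonneg
      hD.regular.c₂_nonneg hξ
    linarith
  linarith

/-- The overage branch of `phi` at `λ₂` is `c₂ Q` plus the zero-cost term at `λ₂ + c₂`. The
zero-cost objective there is nonnegative, and undoing the shift in `λ₂ μ` costs `c₂ μ`. -/
theorem le_obj (hD : D.Admissible) {ξ l₁ : ℝ} (hξ : 0 < ξ) (hl : 0 ≤ l₁) (Q l₂ : ℝ) :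
    D.c₂ * (Q - D.μ) ≤ D.obj ξ Q l₁ l₂ := by
  have e0 := obj_free_nonneg hD hξ hl Q (l₂ + D.c₂)
  rw [obj_free] at e0
  have := card_inv_mul_sum_mono (u := fun i => (-(l₁ * D.x i ^ 2)
      + max (l₁ * D.x i - (l₂ + D.c₂) / 2) 0 ^ 2 / ξ) + D.c₂ * Q)
      (v := fun i => -(l₁ * D.x i ^ 2) + phi D.c₁ D.c₂ Q ξ (l₁ * D.x i - l₂ / 2)) fun i => by
    have := le_max_right (-(D.c₁ * Q) + max (l₁ * D.x i - l₂ / 2 + D.c₁ / 2) 0 ^ 2 / ξ)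
      (D.c₂ * Q + max (l₁ * D.x i - l₂ / 2 - D.c₂ / 2) 0 ^ 2 / ξ)
    change _ ≤ phi D.c₁ D.c₂ Q ξ (l₁ * D.x i - l₂ / 2) at this
    rw [show l₁ * D.x i - l₂ / 2 - D.c₂ / 2 = l₁ * D.x i - (l₂ + D.c₂) / 2 by ring] at this
    linarith
  rw [card_inv_mul_sum_add, card_inv_mul_sum_const hD.n_pos] at this
  rw [obj]
  linarith

theorem obj_convex (hD : D.Regular) {ξ ξ' Q Q' l₁ l₁' l₂ l₂' a b : ℝ} (hξ : 0 < ξ) (hξ' : 0 < ξ')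
    (ha : 0 ≤ a) (hb : 0 ≤ b) (hab : a + b = 1) :
    D.obj (a * ξ + b * ξ') (a * Q + b * Q') (a * l₁ + b * l₁') (a * l₂ + b * l₂')
      ≤ a * D.obj ξ Q l₁ l₂ + b * D.obj ξ' Q' l₁' l₂' := by
  have := card_inv_mul_sum_mono (u := fun i => -((a * l₁ + b * l₁') * D.x i ^ 2)
      + phi D.c₁ D.c₂ (a * Q + b * Q') (a * ξ + b * ξ')
        ((a * l₁ + b * l₁') * D.x i - (a * l₂ + b * l₂') / 2))
      (v := fun i => a * (-(l₁ * D.x i ^ 2) + phi D.c₁ D.c₂ Q ξ (l₁ * D.x i - l₂ / 2))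
        + b * (-(l₁' * D.x i ^ 2) + phi D.c₁ D.c₂ Q' ξ' (l₁' * D.x i - l₂' / 2))) fun i => by
    have := phi_convex (Q := Q) (Q' := Q') (t := l₁ * D.x i - l₂ / 2)
      (t' := l₁' * D.x i - l₂' / 2) hD.c₁_nonneg hD.c₂_nonneg hξ hξ' ha hb hab
    rw [show a * (l₁ * D.x i - l₂ / 2) + b * (l₁' * D.x i - l₂' / 2)
      = (a * l₁ + b * l₁') * D.x i - (a * l₂ + b * l₂') / 2 by ring] at this
    linarith
  replace this := this.trans_eq (card_inv_mul_sum_add _ _)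
  rw [card_inv_mul_sum_mul, card_inv_mul_sum_mul] at this
  simp only [obj]
  linarith

theorem obj_lipschitz (hD : D.Regular) {ξ : ℝ} (hξ : 0 < ξ) (Q Q' l₁ l₂ : ℝ) :
    D.obj ξ Q l₁ l₂ ≤ D.obj ξ Q' l₁ l₂ + max D.c₁ D.c₂ * |Q - Q'| := by
  have := card_inv_mul_sum_mono (u := fun i => -(l₁ * D.x i ^ 2)
      + phi D.c₁ D.c₂ Q ξ (l₁ * D.x i - l₂ / 2)) (v := fun i => (-(l₁ * D.x i ^ 2)
      + phi D.c₁ D.c₂ Q' ξ (l₁ * D.x i - l₂ / 2)) + max D.c₁ D.c₂ * |Q - Q'|) fun i => by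
    have := phi_lipschitz (Q := Q) (Q' := Q') (b := l₁ * D.x i - l₂ / 2) hD.c₁_nonneg
      hD.c₂_nonneg hξ
    linarith
  replace this := this.trans_eq (card_inv_mul_sum_add _ _)
  rw [card_inv_mul_sum_const hD.n_pos] at this
  rw [obj, obj]
  linarith

theorem obj_le_add (hD : D.Regular) {ξ ξ' : ℝ} (hξ : 0 < ξ) (h : ξ ≤ ξ') (Q l₁ l₂ : ℝ) :
    D.obj ξ' Q l₁ l₂ ≤ D.obj ξ Q l₁ l₂ + (ξ' - ξ) * D.sm := by
  have := card_inv_mul_sum_mono (u := fun i => -(l₁ * D.x i ^ 2)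
      + phi D.c₁ D.c₂ Q ξ' (l₁ * D.x i - l₂ / 2)) (v := fun i => (-(l₁ * D.x i ^ 2)
      + phi D.c₁ D.c₂ Q ξ (l₁ * D.x i - l₂ / 2))) fun i => by
    have := phi_anti (Q := Q) (b := l₁ * D.x i - l₂ / 2) hD.c₁_nonneg hD.c₂_nonneg hξ h
    linarith
  rw [obj, obj]
  linarith

theorem obj_zero_le (hD : D.Regular) {ξ Q : ℝ} (hξ : 0 < ξ) (hQ : 0 ≤ Q) :
    D.obj ξ Q 0 0 ≤ ξ * D.sm + D.c₂ * Q + D.c₁ ^ 2 / (4 * ξ) := by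
  have := card_inv_mul_sum_mono (u := fun i => -(0 * D.x i ^ 2)
      + phi D.c₁ D.c₂ Q ξ (0 * D.x i - 0 / 2)) (v := fun _ => D.c₂ * Q + D.c₁ ^ 2 / (4 * ξ))
      fun i => by
    have h1 := hD.c₁_nonneg
    have h2 := hD.c₂_nonneg
    have h3 : max (D.c₁ / 2) 0 = D.c₁ / 2 := max_eq_left (by linarith)
    have h4 : max (-D.c₂ / 2) 0 = 0 := max_eq_right (by linarith)
    have h5 : (D.c₁ / 2) ^ 2 / ξ = D.c₁ ^ 2 / (4 * ξ) := by field_simp; norm_num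
    have h6 : 0 ≤ D.c₁ ^ 2 / (4 * ξ) := by positivity
    have h7 := mul_nonneg h1 hQ
    have h8 := mul_nonneg h2 hQ
    have : phi D.c₁ D.c₂ Q ξ 0 ≤ D.c₂ * Q + D.c₁ ^ 2 / (4 * ξ) := by
      rw [phi, zero_add, zero_sub, ← neg_div, h3, h4, h5]
      apply max_le <;> simp <;> linarith
    simpa using this
  rw [card_inv_mul_sum_const hD.n_pos] at this
  rw [obj]
  linarith

/-- The parabola `y² / (4 Q)` touches the line `y - Q` at `y = 2 Q`. Hence the loss is at most `c₂
(Q - y) + (c₁ + c₂) y² / (4 Q)`, which dictates the multipliers. Together with `le_obj` this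
determines `h` for large `Q` up to `O(1/Q)`. -/
theorem exists_obj_le (hD : D.Regular) {Q : ℝ} (hQ : 0 < Q) (hc : 0 < D.c₁ + D.c₂) :
    ∃ ξ l₂, 0 < ξ ∧ D.obj ξ Q 0 l₂ ≤ D.c₂ * (Q - D.μ) + (D.c₁ + D.c₂) * D.sm / (4 * Q) := by
  have hξ : 0 < (D.c₁ + D.c₂) / (4 * Q) := by positivity
  refine ⟨(D.c₁ + D.c₂) / (4 * Q), -D.c₂, hξ, ?_⟩
  have := card_inv_mul_sum_mono (u := fun i => -(0 * D.x i ^ 2)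
      + phi D.c₁ D.c₂ Q ((D.c₁ + D.c₂) / (4 * Q)) (0 * D.x i - -D.c₂ / 2))
      (v := fun _ => D.c₂ * Q) fun i => by
    have : phi D.c₁ D.c₂ Q ((D.c₁ + D.c₂) / (4 * Q)) (D.c₂ / 2) ≤ D.c₂ * Q := by
      refine phi_le hD.c₁_nonneg hD.c₂_nonneg hξ fun y hy => ?_
      have e : y ^ 2 / (4 * Q) - (y - Q) = (y - 2 * Q) ^ 2 / (4 * Q) := by field_simp; ring
      have e' : 0 ≤ y ^ 2 / (4 * Q) - (y - Q) := by rw [e]; positivity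
      have e1 : (D.c₁ + D.c₂) / (4 * Q) * y ^ 2 = (D.c₁ + D.c₂) * (y ^ 2 / (4 * Q)) := by ring
      rw [e1, loss_eq hD.c₁_nonneg hD.c₂_nonneg]
      have e2 := mul_nonneg hc.le e'
      have e3 : 0 ≤ (D.c₁ + D.c₂) * (y ^ 2 / (4 * Q)) := by positivity
      rcases le_total (D.c₁ * (y - Q)) (D.c₂ * (Q - y)) with h | h
      · rw [max_eq_right h]; linarith
      · rw [max_eq_left h]; linarith
    rw [show 0 * D.x i - -D.c₂ / 2 = D.c₂ / 2 by ring]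
    linarith
  rw [card_inv_mul_sum_const hD.n_pos] at this
  rw [obj]
  have e : (D.c₁ + D.c₂) * D.sm / (4 * Q) = (D.c₁ + D.c₂) / (4 * Q) * D.sm := by ring
  rw [e]
  linarith

theorem le_F (l₁ l₂ l₃ Q y : ℝ) (hy : 0 ≤ y) :
    ((l₁ * D.δ + l₂ * D.μ + l₃ * (D.σ ^ 2 + D.μ ^ 2) + (n : ℝ)⁻¹ *
      ∑ i, (-(l₁ * D.x i ^ 2) + D.g i y l₁ l₂ l₃ Q) : ℝ) : EReal) ≤ D.F l₁ l₂ l₃ Q := by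
  rw [F, EReal.coe_add, EReal.coe_mul, EReal.coe_finset_sum']
  refine add_le_add le_rfl (mul_le_mul_of_nonneg_left (Finset.sum_le_sum fun i _ => ?_)
    (EReal.coe_nonneg.2 (by positivity)))
  rw [Psi, EReal.coe_add]
  exact add_le_add le_rfl
    (le_iSup₂ (f := fun (y : ℝ) (_ : 0 ≤ y) => ((D.g i y l₁ l₂ l₃ Q : ℝ) : EReal)) y hy)

/-- With a convex leading term in `y`, testing all the suprema at one large common `y` already makes
their average as large as desired. -/
theorem F_eq_top (hD : D.Regular) {l₁ l₂ l₃ Q : ℝ} (h : l₁ + l₃ < 0) : D.F l₁ l₂ l₃ Q = ⊤ := by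
  refine (EReal.eq_top_iff_forall_lt _).2 fun v => ?_
  set α := -(l₁ + l₃) with hα
  have hα0 : 0 < α := by linarith
  set p := (n : ℝ)⁻¹ * ∑ i, (2 * (l₁ * D.x i - l₂ / 2)) with hp
  set q := l₁ * D.δ + l₂ * D.μ + l₃ * (D.σ ^ 2 + D.μ ^ 2)
    + (n : ℝ)⁻¹ * ∑ i, (-(l₁ * D.x i ^ 2)) with hq
  set y := (|p| + |v - q| + 1) / α + 1 with hy
  have hy1 : 1 ≤ y := by
    have : 0 ≤ (|p| + |v - q| + 1) / α := by positivity
    linarith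
  refine lt_of_lt_of_le ?_ (le_F l₁ l₂ l₃ Q y (by linarith))
  rw [EReal.coe_lt_coe_iff]
  have := card_inv_mul_sum_mono (u := fun i => -(l₁ * D.x i ^ 2)
      + (y * (2 * (l₁ * D.x i - l₂ / 2)) + α * y ^ 2))
      (v := fun i => -(l₁ * D.x i ^ 2) + D.g i y l₁ l₂ l₃ Q) fun i => by
    rw [g_eq]
    have := loss_nonneg (Q := Q) (y := y) hD.c₁_nonneg hD.c₂_nonneg
    rw [hα]
    linarith
  rw [card_inv_mul_sum_add, card_inv_mul_sum_add, card_inv_mul_sum_mul,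
    card_inv_mul_sum_const hD.n_pos, ← hp] at this
  have e1 : α * y = |p| + |v - q| + 1 + α := by rw [hy]; field_simp
  have e2 : y * p + α * y ^ 2 = y * (p + |p| + |v - q| + 1 + α) := by
    rw [show y * p + α * y ^ 2 = y * (p + α * y) by ring, e1]; ring
  have e3 : |v - q| + 1 ≤ p + |p| + |v - q| + 1 + α := by
    have := neg_abs_le p; linarith
  have e4 : |v - q| + 1 ≤ y * (p + |p| + |v - q| + 1 + α) := by
    have h0 : 0 ≤ |v - q| + 1 := by positivity
    nlinarith
  have := le_abs_self (v - q)
  linarith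

/-- Used to approach the boundary case `λ₁ + λ₃ = 0` from positive values: the suprema can only
decrease, and the linear term grows by `ξ` times the second moment. -/
theorem F_add_le (l₁ l₂ l₃ Q : ℝ) {ξ : ℝ} (hξ : 0 ≤ ξ) :
    D.F l₁ l₂ (l₃ + ξ) Q ≤ D.F l₁ l₂ l₃ Q + ((ξ * D.sm : ℝ) : EReal) := by
  rw [F, F, show l₁ * D.δ + l₂ * D.μ + (l₃ + ξ) * (D.σ ^ 2 + D.μ ^ 2)
    = (l₁ * D.δ + l₂ * D.μ + l₃ * (D.σ ^ 2 + D.μ ^ 2)) + ξ * D.sm by rw [sm]; ring,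
    EReal.coe_add, add_right_comm]
  refine add_le_add (add_le_add le_rfl (mul_le_mul_of_nonneg_left
    (Finset.sum_le_sum fun i _ => ?_) (EReal.coe_nonneg.2 (by positivity)))) le_rfl
  refine add_le_add le_rfl (iSup₂_mono fun y _ => ?_)
  rw [EReal.coe_le_coe_iff, g_eq, g_eq]
  have := mul_nonneg hξ (sq_nonneg y)
  linarith

end Newsvendor

end

/-! ### Descent to vertices in a line arrangement -/

noncomputable section

/-- The affine function `(u, v) ↦ a u + b v + c`. -/
structure Aff where
  a : ℝ
  b : ℝ
  c : ℝ

namespace Aff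

def eval (A : Aff) (u v : ℝ) : ℝ := A.a * u + A.b * v + A.c

def lin (A : Aff) (p q : ℝ) : ℝ := A.a * p + A.b * q

theorem eval_add (A : Aff) (u v s p q : ℝ) :
    A.eval (u + s * p) (v + s * q) = A.eval u v + s * A.lin p q := by
  simp only [eval, lin]; ring

theorem eval_cramer {A B : Aff} (h : A.a * B.b - B.a * A.b ≠ 0) :
    A.eval ((A.b * B.c - B.b * A.c) / (A.a * B.b - B.a * A.b))
        ((A.c * B.a - B.c * A.a) / (A.a * B.b - B.a * A.b)) = 0 ∧
      B.eval ((A.b * B.c - B.b * A.c) / (A.a * B.b - B.a * A.b))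
        ((A.c * B.a - B.c * A.a) / (A.a * B.b - B.a * A.b)) = 0 := by
  simp only [eval]
  generalize hd : A.a * B.b - B.a * A.b = d at h
  constructor <;> field_simp <;> rw [← hd] <;> ring

theorem eq_cramer {A B : Aff} (h : A.a * B.b - B.a * A.b ≠ 0) {u v : ℝ} (hA : A.eval u v = 0)
    (hB : B.eval u v = 0) :
    u = (A.b * B.c - B.b * A.c) / (A.a * B.b - B.a * A.b) ∧
      v = (A.c * B.a - B.c * A.a) / (A.a * B.b - B.a * A.b) := by
  simp only [eval] at hA hB
  constructor <;> rw [eq_div_iff h]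
  · linear_combination B.b * hA - A.b * hB
  · linear_combination A.a * hB - B.a * hA

end Aff

/-- The second order data of a quadratic function of two variables: Hessian and linear part. -/
structure Quad where
  p₁₁ : ℝ
  p₁₂ : ℝ
  p₂₂ : ℝ
  r₁ : ℝ
  r₂ : ℝ

namespace Quad

def grad₁ (q : Quad) : Aff := ⟨q.p₁₁, q.p₁₂, q.r₁⟩

def grad₂ (q : Quad) : Aff := ⟨q.p₁₂, q.p₂₂, q.r₂⟩

def form (q : Quad) (p p' : ℝ) : ℝ := q.p₁₁ * p ^ 2 + 2 * q.p₁₂ * p * p' + q.p₂₂ * p' ^ 2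

/-- The derivative of the quadratic along the level lines of `A`. -/
def along (q : Quad) (A : Aff) : Aff :=
  ⟨A.b * q.p₁₁ - A.a * q.p₁₂, A.b * q.p₁₂ - A.a * q.p₂₂, A.b * q.r₁ - A.a * q.r₂⟩

/-- The increment of the quadratic between two points. -/
def incr (q : Quad) (u v u' v' : ℝ) : ℝ :=
  q.grad₁.eval u v * (u' - u) + q.grad₂.eval u v * (v' - v) + q.form (u' - u) (v' - v) / 2

theorem incr_line (q : Quad) (u v s p p' : ℝ) :
    q.incr u v (u + s * p) (v + s * p')
      = s * (q.grad₁.eval u v * p + q.grad₂.eval u v * p') + s ^ 2 * q.form p p' / 2 := by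
  simp only [incr, form]; ring

theorem grad_line (q : Quad) (u v s p p' : ℝ) :
    q.grad₁.eval (u + s * p) (v + s * p') * p + q.grad₂.eval (u + s * p) (v + s * p') * p'
      = (q.grad₁.eval u v * p + q.grad₂.eval u v * p') + s * q.form p p' := by
  simp only [form, grad₁, grad₂, Aff.eval]; ring

end Quad

section Arrangement

variable {ι : Type*} (L : ι → Aff)

/-- `(u', v')` lies in the closure of the cell of `(u, v)` in the arrangement `L`. -/
def InCell (u v u' v' : ℝ) : Prop :=
  ∀ k, (0 ≤ (L k).eval u v → 0 ≤ (L k).eval u' v') ∧ ((L k).eval u v ≤ 0 → (L k).eval u' v' ≤ 0)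

variable {L}

/-- If no affine function moves towards zero along the direction, and those that vanish remain zero,
then no sign can change. -/
theorem inCell_ray {u v p q : ℝ} (h : ∀ k, 0 ≤ (L k).lin p q * (L k).eval u v)
    (hact : ∀ k, (L k).eval u v = 0 → (L k).lin p q = 0) {s : ℝ} (hs : 0 ≤ s) :
    InCell L u v (u + s * p) (v + s * q) := by
  intro k
  rw [Aff.eval_add]
  rcases lt_trichotomy ((L k).eval u v) 0 with h0 | h0 | h0
  · have : (L k).lin p q ≤ 0 := by
      by_contra hc; push Not at hc; nlinarith [h k, mul_pos_of_neg_of_neg h0 (neg_neg_of_pos hc)]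
    exact ⟨fun h' => absurd h' (by linarith), fun _ => by nlinarith⟩
  · rw [hact k h0, h0]; simp
  · have : 0 ≤ (L k).lin p q := by
      by_contra hc; push Not at hc; nlinarith [h k, mul_pos h0 (neg_pos.2 hc)]
    exact ⟨fun _ => by positivity, fun h' => absurd h' (by linarith)⟩

/-- The ratio test of the simplex method: among the lines being approached, the one reached first
ends the motion inside the closed cell. -/
theorem exists_hit [Finite ι] {u v p q : ℝ} {k₀ : ι}
    (hk₀ : (L k₀).lin p q * (L k₀).eval u v < 0)
    (hact : ∀ k, (L k).eval u v = 0 → (L k).lin p q = 0) :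
    ∃ s₀, 0 < s₀ ∧ (∃ k, (L k).eval (u + s₀ * p) (v + s₀ * q) = 0 ∧ (L k).lin p q ≠ 0) ∧
      ∀ s, 0 ≤ s → s ≤ s₀ → InCell L u v (u + s * p) (v + s * q) := by
  obtain ⟨k, hk, hmin⟩ := Set.exists_min_image {k | (L k).lin p q * (L k).eval u v < 0}
    (fun k => -(L k).eval u v / (L k).lin p q) (Set.toFinite _) ⟨k₀, hk₀⟩
  have hk' : (L k).lin p q * (L k).eval u v < 0 := hk
  have hlin : (L k).lin p q ≠ 0 := by
    intro h; rw [h] at hk'; simp at hk'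
  refine ⟨-(L k).eval u v / (L k).lin p q, ?_, ⟨k, ?_, hlin⟩, ?_⟩
  · rcases lt_or_gt_of_ne hlin with h | h
    · exact div_pos_of_neg_of_neg (by nlinarith) h
    · exact div_pos (by nlinarith) h
  · rw [Aff.eval_add]; field_simp; ring
  · intro s hs hs0 j
    by_cases hj : (L j).lin p q * (L j).eval u v < 0
    · have h1 := hs0.trans (hmin j hj)
      rw [Aff.eval_add]
      rcases lt_trichotomy ((L j).lin p q) 0 with h | h | h
      · rw [le_div_iff_of_neg h] at h1
        exact ⟨fun _ => by linarith, fun h' => absurd hj (by nlinarith)⟩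
      · rw [h] at hj; simp at hj
      · rw [le_div_iff₀ h] at h1
        exact ⟨fun h' => absurd hj (by nlinarith), fun _ => by linarith⟩
    · push Not at hj
      exact inCell_ray (L := fun _ : Unit => L j) (fun _ => hj) (fun _ => hact j) hs ()

/-- Moving along a line, a convex quadratic that is bounded below reaches, without increasing,
either a point where its derivative along the line vanishes or another line of the arrangement. -/
theorem exists_descent_of_neg [Finite ι] {H : ℝ → ℝ → ℝ} {κ u v p p' : ℝ} {q : Quad} (hκ : 0 < κ)
    (hH : ∀ u' v', InCell L u v u' v' → 0 ≤ H u' v')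
    (hq : ∀ u' v', InCell L u v u' v' → H u' v' = H u v + κ * q.incr u v u' v')
    (hform : 0 ≤ q.form p p')
    (hact : ∀ k, (L k).eval u v = 0 → (L k).lin p p' = 0)
    (hneg : q.grad₁.eval u v * p + q.grad₂.eval u v * p' < 0) :
    (∃ s, InCell L u v (u + s * p) (v + s * p') ∧ H (u + s * p) (v + s * p') ≤ H u v ∧
      q.grad₁.eval (u + s * p) (v + s * p') * p + q.grad₂.eval (u + s * p) (v + s * p') * p' = 0 ∧
      q.form p p' ≠ 0) ∨
    (∃ s, InCell L u v (u + s * p) (v + s * p') ∧ H (u + s * p) (v + s * p') ≤ H u v ∧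
      ∃ k, (L k).eval (u + s * p) (v + s * p') = 0 ∧ (L k).lin p p' ≠ 0) := by
  set B := q.grad₁.eval u v * p + q.grad₂.eval u v * p' with hB
  set A := q.form p p' with hA
  have hval : ∀ s, InCell L u v (u + s * p) (v + s * p') →
      H (u + s * p) (v + s * p') = H u v + κ * (s * (B + s * A / 2)) := by
    intro s hs
    rw [hq _ _ hs, Quad.incr_line, ← hB, ← hA]; ring
  have hle : ∀ s, 0 ≤ s → B + s * A / 2 ≤ 0 → InCell L u v (u + s * p) (v + s * p') →
      H (u + s * p) (v + s * p') ≤ H u v := by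
    intro s hs h hc
    rw [hval s hc]
    have := mul_nonneg hκ.le (mul_nonneg hs (neg_nonneg.2 h))
    linarith
  have stat : 0 < A → InCell L u v (u + -B / A * p) (v + -B / A * p') →
      ∃ s, InCell L u v (u + s * p) (v + s * p') ∧ H (u + s * p) (v + s * p') ≤ H u v ∧
      q.grad₁.eval (u + s * p) (v + s * p') * p + q.grad₂.eval (u + s * p) (v + s * p') * p' = 0 ∧
      A ≠ 0 := by
    intro hA0 hc
    refine ⟨-B / A, hc, hle _ (div_nonneg (by linarith) hA0.le) ?_ hc, ?_, hA0.ne'⟩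
    · rw [div_mul_cancel₀ _ hA0.ne']; linarith
    · rw [Quad.grad_line, ← hB, ← hA]; field_simp; ring
  by_cases hhit : ∃ k, (L k).lin p p' * (L k).eval u v < 0
  · obtain ⟨k₀, hk₀⟩ := hhit
    obtain ⟨s₀, hs₀, ⟨k, hk, hlin⟩, hcell⟩ := exists_hit hk₀ hact
    by_cases hst : 0 < A ∧ -B / A ≤ s₀
    · exact Or.inl (stat hst.1 (hcell _ (div_nonneg (by linarith) hst.1.le) hst.2))
    · refine Or.inr ⟨s₀, hcell s₀ hs₀.le le_rfl, hle s₀ hs₀.le ?_ (hcell s₀ hs₀.le le_rfl),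
        k, hk, hlin⟩
      rcases eq_or_lt_of_le hform with h | h
      · rw [← h]; linarith
      · have h2 : s₀ < -B / A := by
          by_contra hc; exact hst ⟨h, not_lt.1 hc⟩
        rw [lt_div_iff₀ h] at h2
        linarith
  · push Not at hhit
    have hcell : ∀ s, 0 ≤ s → InCell L u v (u + s * p) (v + s * p') :=
      fun s hs => inCell_ray hhit hact hs
    rcases eq_or_lt_of_le hform with h | h
    -- With no line ahead and no curvature, `H` would decrease linearly on a ray inside the cell.
    -- The step length is the one at which `H` would equal `-1`.
    · exfalso
      have h0 : 0 ≤ H u v := hH u v fun k => ⟨id, id⟩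
      have hs : 0 ≤ (H u v + 1) / (κ * -B) :=
        div_nonneg (by linarith) (mul_nonneg hκ.le (by linarith))
      have h1 := hval _ (hcell _ hs)
      have h2 := hH _ _ (hcell _ hs)
      rw [h1, ← h] at h2
      have hB0 : B ≠ 0 := hneg.ne
      have h3 : κ * ((H u v + 1) / (κ * -B) * (B + (H u v + 1) / (κ * -B) * 0 / 2))
          = -(H u v + 1) := by field_simp; ring
      linarith
    · exact Or.inl (stat h (hcell _ (div_nonneg (by linarith) h.le)))

/-- A nonzero derivative is made negative by reversing the direction if necessary, so only a
vanishing derivative needs a new argument. -/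
theorem exists_descent [Finite ι] {H : ℝ → ℝ → ℝ} {κ u v p p' : ℝ} {q : Quad} (hκ : 0 < κ)
    (hH : ∀ u' v', InCell L u v u' v' → 0 ≤ H u' v')
    (hq : ∀ u' v', InCell L u v u' v' → H u' v' = H u v + κ * q.incr u v u' v')
    (hform : 0 ≤ q.form p p')
    (hact : ∀ k, (L k).eval u v = 0 → (L k).lin p p' = 0)
    (hspan : ∃ k, (L k).lin p p' ≠ 0) :
    (∃ s, InCell L u v (u + s * p) (v + s * p') ∧ H (u + s * p) (v + s * p') ≤ H u v ∧
      q.grad₁.eval (u + s * p) (v + s * p') * p + q.grad₂.eval (u + s * p) (v + s * p') * p' = 0 ∧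
      q.form p p' ≠ 0) ∨
    (∃ s, InCell L u v (u + s * p) (v + s * p') ∧ H (u + s * p) (v + s * p') ≤ H u v ∧
      ∃ k, (L k).eval (u + s * p) (v + s * p') = 0 ∧ (L k).lin p p' ≠ 0) := by
  have hlin : ∀ k, (L k).lin (-p) (-p') = -(L k).lin p p' := fun k => by
    simp only [Aff.lin]; ring
  have hform' : q.form (-p) (-p') = q.form p p' := by simp only [Quad.form]; ring
  have hact' : ∀ k, (L k).eval u v = 0 → (L k).lin (-p) (-p') = 0 := fun k hk => by
    rw [hlin, hact k hk, neg_zero]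
  have hsw : ∀ s w r : ℝ, w + s * -r = w + -s * r := fun s w r => by ring
  rcases lt_trichotomy (q.grad₁.eval u v * p + q.grad₂.eval u v * p') 0 with h | h | h
  · exact exists_descent_of_neg hκ hH hq hform hact h
  · have hcell0 : InCell L u v (u + 0 * p) (v + 0 * p') := by
      intro k; simp
    -- Without curvature `H` is constant along the line within the cell, so one may walk either way;
    -- `hspan` supplies a line to run into. With curvature the current point is already stationary.
    by_cases hA : q.form p p' = 0
    · right
      have hconst : ∀ s, InCell L u v (u + s * p) (v + s * p') →
          H (u + s * p) (v + s * p') ≤ H u v := by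
        intro s hs
        rw [hq _ _ hs, Quad.incr_line, h, hA]; simp
      obtain ⟨k₀, hk₀⟩ := hspan
      have he : (L k₀).eval u v ≠ 0 := fun h0 => hk₀ (hact k₀ h0)
      rcases lt_or_gt_of_ne (mul_ne_zero hk₀ he) with hn | hp
      · obtain ⟨s₀, hs₀, ⟨k, hk, hl⟩, hcell⟩ := exists_hit hn hact
        have := hcell s₀ hs₀.le le_rfl
        exact ⟨s₀, this, hconst _ this, k, hk, hl⟩
      · obtain ⟨s₀, hs₀, ⟨k, hk, hl⟩, hcell⟩ := exists_hit (L := L) (u := u) (v := v) (p := -p)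
          (q := -p') (k₀ := k₀) (by rw [hlin]; linarith) hact'
        have := hcell s₀ hs₀.le le_rfl
        rw [hsw, hsw] at this hk
        rw [hlin] at hl
        exact ⟨-s₀, this, hconst _ this, k, hk, neg_ne_zero.1 hl⟩
    · left
      refine ⟨0, hcell0, by simp, ?_, hA⟩
      simpa using h
  · rcases exists_descent_of_neg (p := -p) (p' := -p') hκ hH hq (by rw [hform']; exact hform) hact'
      (by linarith) with ⟨s, h1, h2, h3, h4⟩ | ⟨s, h1, h2, k, h3, h4⟩
    · rw [hsw s u p, hsw s v p'] at h1 h2 h3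
      rw [hform'] at h4
      exact Or.inl ⟨-s, h1, h2, by linarith, h4⟩
    · rw [hsw s u p, hsw s v p'] at h1 h2 h3
      rw [hlin] at h4
      exact Or.inr ⟨-s, h1, h2, k, h3, neg_ne_zero.1 h4⟩

/-- The affine functions whose pairwise intersections contain a minimizer. -/
inductive Row (L : ι → Aff) (q : Quad) : Aff → Prop
  | grad₁ : Row L q q.grad₁
  | grad₂ : Row L q q.grad₂
  | line (k : ι) : Row L q (L k)
  | along (k : ι) : Row L q (q.along (L k))

def IsVertex (L : ι → Aff) (q : Quad) (u v : ℝ) : Prop :=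
  ∃ A B, Row L q A ∧ Row L q B ∧ A.a * B.b - B.a * A.b ≠ 0 ∧ A.eval u v = 0 ∧ B.eval u v = 0

/-- Each descent reaches a further line or a stationary point. From the interior of a cell one
reaches a line or the stationary point of the piece. From a line, moving along it, one reaches a
transversal line or a zero of the derivative along it. Either way two affine functions with
independent linear parts vanish. The quadratic is chosen anew after a line is reached, since the
cell has changed. -/
theorem exists_isVertex [Finite ι] {H : ℝ → ℝ → ℝ} {κ : ℝ} (hκ : 0 < κ)
    (hL : ∀ k, (L k).a ≠ 0 ∨ (L k).b ≠ 0)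
    (hspan : ∀ p p', (p ≠ 0 ∨ p' ≠ 0) → ∃ k, (L k).lin p p' ≠ 0)
    {feas : ℝ → ℝ → Prop} (hfeas : ∀ u v u' v', feas u v → InCell L u v u' v' → feas u' v')
    (hH : ∀ u v, feas u v → 0 ≤ H u v) {S : Set Quad} (hS : ∀ q ∈ S, ∀ p p', 0 ≤ q.form p p')
    (hq : ∀ u v, feas u v → ∃ q ∈ S, ∀ u' v', InCell L u v u' v' →
      H u' v' = H u v + κ * q.incr u v u' v')
    {u v : ℝ} (huv : feas u v) :
    ∃ u' v', feas u' v' ∧ H u' v' ≤ H u v ∧ ∃ q ∈ S, IsVertex L q u' v' := by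
  have onLine : ∀ u v, feas u v → (∃ j, (L j).eval u v = 0) →
      ∃ u' v', feas u' v' ∧ H u' v' ≤ H u v ∧ ∃ q ∈ S, IsVertex L q u' v' := by
    rintro u v huv ⟨j, hj⟩
    obtain ⟨q, hqS, hq⟩ := hq u v huv
    -- If another active line crosses this one, the point is already a vertex. Otherwise all active
    -- lines are parallel to `L j`, so motion along `L j` preserves them all.
    by_cases hpar : ∃ k, (L k).eval u v = 0 ∧ (L j).a * (L k).b - (L k).a * (L j).b ≠ 0
    · obtain ⟨k, hk, hdet⟩ := hpar
      exact ⟨u, v, huv, le_rfl, q, hqS, L j, L k, .line j, .line k, hdet, hj, hk⟩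
    · push Not at hpar
      have hjact : (L j).lin (L j).b (-(L j).a) = 0 := by simp only [Aff.lin]; ring
      have hd : (L j).b ≠ 0 ∨ -(L j).a ≠ 0 := by
        rcases hL j with h | h
        · exact Or.inr (neg_ne_zero.2 h)
        · exact Or.inl h
      rcases exists_descent (p := (L j).b) (p' := -(L j).a) hκ
        (fun u' v' h => hH _ _ (hfeas _ _ _ _ huv h)) hq (hS q hqS _ _)
        (fun k hk => by have := hpar k hk; simp only [Aff.lin]; linarith)
        (hspan _ _ hd) with ⟨s, h1, h2, h3, h4⟩ | ⟨s, h1, h2, k, h3, h4⟩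
      · refine ⟨_, _, hfeas _ _ _ _ huv h1, h2, q, hqS, L j, q.along (L j), .line j, .along j,
          ?_, ?_, ?_⟩
        · intro h0
          apply h4
          simp only [Quad.along] at h0
          simp only [Quad.form]
          linarith
        · rw [Aff.eval_add, hj, hjact]; ring
        · rw [← h3]; simp only [Aff.eval, Quad.along, Quad.grad₁, Quad.grad₂]; ring
      · refine ⟨_, _, hfeas _ _ _ _ huv h1, h2, q, hqS, L j, L k, .line j, .line k, ?_, ?_, h3⟩
        · intro h0
          apply h4
          simp only [Aff.lin]; linarith
        · rw [Aff.eval_add, hj, hjact]; ring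
  by_cases hact : ∃ j, (L j).eval u v = 0
  · exact onLine u v huv hact
  push Not at hact
  have hact' : ∀ p p' k, (L k).eval u v = 0 → (L k).lin p p' = 0 :=
    fun p p' k hk => absurd hk (hact k)
  obtain ⟨q, hqS, hq⟩ := hq u v huv
  have step : ∀ p p' s, InCell L u v (u + s * p) (v + s * p') →
      H (u + s * p) (v + s * p') ≤ H u v → (∃ k, (L k).eval (u + s * p) (v + s * p') = 0) →
      ∃ u' v', feas u' v' ∧ H u' v' ≤ H u v ∧ ∃ q ∈ S, IsVertex L q u' v' := by
    intro p p' s h1 h2 h3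
    obtain ⟨u', v', h4, h5, h6⟩ := onLine _ _ (hfeas _ _ _ _ huv h1) h3
    exact ⟨u', v', h4, h5.trans h2, h6⟩
  have hdesc := fun p p' (hd : p ≠ 0 ∨ p' ≠ 0) => exists_descent (p := p) (p' := p') hκ
    (fun u' v' h => hH _ _ (hfeas _ _ _ _ huv h)) hq (hS q hqS _ _) (hact' p p') (hspan _ _ hd)
  -- A singular Hessian has a direction without curvature. The stationary alternative of the descent
  -- is then impossible, so a line is reached.
  by_cases hdet : q.p₁₁ * q.p₂₂ - q.p₁₂ * q.p₁₂ = 0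
  · obtain ⟨p, p', hd, hz⟩ : ∃ p p', (p ≠ 0 ∨ p' ≠ 0) ∧ q.form p p' = 0 := by
      by_cases h : q.p₁₁ = 0
      · exact ⟨1, 0, Or.inl one_ne_zero, by simp [Quad.form, h]⟩
      · refine ⟨q.p₁₂, -q.p₁₁, Or.inr (neg_ne_zero.2 h), ?_⟩
        simp only [Quad.form]
        linear_combination q.p₁₁ * hdet
    rcases hdesc p p' hd with ⟨s, h1, h2, h3, h4⟩ | ⟨s, h1, h2, k, h3, h4⟩
    · exact absurd hz h4
    · exact step p p' s h1 h2 ⟨k, h3⟩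
  -- For a regular Hessian the descent is directed at the unique zero `(w, w')` of the gradient; a
  -- stationary point on this segment's line with nonzero curvature must be at parameter `1`.
  · obtain ⟨w, w', g1, g2⟩ : ∃ w w', q.grad₁.eval w w' = 0 ∧ q.grad₂.eval w w' = 0 :=
      ⟨_, _, Aff.eval_cramer (A := q.grad₁) (B := q.grad₂) hdet⟩
    have hv : IsVertex L q w w' := ⟨_, _, .grad₁, .grad₂, hdet, g1, g2⟩
    by_cases hd : w - u ≠ 0 ∨ w' - v ≠ 0
    · rcases hdesc _ _ hd with ⟨s, h1, h2, h3, h4⟩ | ⟨s, h1, h2, k, h3, h4⟩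
      · have hs : s = 1 := by
          have e1 := q.grad_line u v s (w - u) (w' - v)
          have e2 := q.grad_line u v 1 (w - u) (w' - v)
          rw [h3] at e1
          rw [show u + 1 * (w - u) = w by ring, show v + 1 * (w' - v) = w' by ring, g1, g2] at e2
          have e3 : (s - 1) * q.form (w - u) (w' - v) = 0 := by linarith
          rcases mul_eq_zero.1 e3 with h | h
          · linarith
          · exact absurd h h4
        rw [hs, show u + 1 * (w - u) = w by ring, show v + 1 * (w' - v) = w' by ring] at h1 h2
        exact ⟨w, w', hfeas _ _ _ _ huv h1, h2, q, hqS, hv⟩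
      · exact step _ _ s h1 h2 ⟨k, h3⟩
    · push Not at hd
      have e1 : w = u := by linarith [hd.1]
      have e2 : w' = v := by linarith [hd.2]
      rw [e1, e2] at hv
      exact ⟨u, v, huv, le_rfl, q, hqS, hv⟩

end Arrangement

end

/-! ### The quadratic pieces of the objective and the candidate points -/

noncomputable section

namespace Newsvendor

/-- The point where the two branches of `phi` meet. -/
def brk (c₁ c₂ Q ξ : ℝ) : ℝ :=
  -(c₁ / 2) + √((c₁ + c₂) * min (Q * ξ) ((c₁ + c₂) / 4)) + max (Q * ξ - (c₁ + c₂) / 4) 0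

/-- At equality of the branches, `(b + c₁/2)² = (c₁ + c₂) Q ξ + ((b - c₂/2)⁺)²`. This is solved by a
square root if `b ≤ c₂/2`, and is linear in `b` beyond. The two regimes meet at `Q ξ = (c₁ + c₂)/4`;
the `min` and `max` in `brk` merge them. -/
theorem brk_cases {c₁ c₂ Q ξ : ℝ} (h₁ : 0 ≤ c₁) (h₂ : 0 ≤ c₂) (hξ : 0 < ξ) (hQ : 0 ≤ Q) :
    (Q * ξ ≤ (c₁ + c₂) / 4 ∧ 0 ≤ brk c₁ c₂ Q ξ + c₁ / 2 ∧
      (brk c₁ c₂ Q ξ + c₁ / 2) ^ 2 = (c₁ + c₂) * (Q * ξ) ∧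
      brk c₁ c₂ Q ξ + c₁ / 2 ≤ (c₁ + c₂) / 2) ∨
    ((c₁ + c₂) / 4 ≤ Q * ξ ∧ brk c₁ c₂ Q ξ + c₁ / 2 = Q * ξ + (c₁ + c₂) / 4) := by
  have hu : 0 ≤ Q * ξ := mul_nonneg hQ hξ.le
  have hS : 0 ≤ c₁ + c₂ := add_nonneg h₁ h₂
  rcases le_total (Q * ξ) ((c₁ + c₂) / 4) with h | h
  · left
    have e : brk c₁ c₂ Q ξ + c₁ / 2 = √((c₁ + c₂) * (Q * ξ)) := by
      rw [brk, min_eq_left h, max_eq_right (by linarith)]; ring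
    rw [e]
    refine ⟨h, Real.sqrt_nonneg _, Real.sq_sqrt (mul_nonneg hS hu), ?_⟩
    rw [Real.sqrt_le_left (by linarith)]
    nlinarith
  · right
    refine ⟨h, ?_⟩
    have e : √((c₁ + c₂) * ((c₁ + c₂) / 4)) = (c₁ + c₂) / 2 := by
      rw [show (c₁ + c₂) * ((c₁ + c₂) / 4) = ((c₁ + c₂) / 2) ^ 2 by ring]
      exact Real.sqrt_sq (by linarith)
    rw [brk, min_eq_right h, max_eq_left (by linarith), e]; ring

theorem phi_of_le_brk {c₁ c₂ Q ξ b : ℝ} (h₁ : 0 ≤ c₁) (h₂ : 0 ≤ c₂) (hξ : 0 < ξ) (hQ : 0 ≤ Q)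
    (hb : b ≤ brk c₁ c₂ Q ξ) : phi c₁ c₂ Q ξ b = c₂ * Q + max (b - c₂ / 2) 0 ^ 2 / ξ := by
  rw [phi, max_eq_right]
  have key : max (b + c₁ / 2) 0 ^ 2 ≤ (c₁ + c₂) * (Q * ξ) + max (b - c₂ / 2) 0 ^ 2 := by
    have hS : 0 ≤ c₁ + c₂ := add_nonneg h₁ h₂
    have hm := sq_nonneg (max (b - c₂ / 2) 0)
    rcases brk_cases h₁ h₂ hξ hQ with ⟨h, hr0, hr2, hr⟩ | ⟨h, hr⟩
    · have : max (b + c₁ / 2) 0 ≤ brk c₁ c₂ Q ξ + c₁ / 2 := max_le (by linarith) hr0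
      have := pow_le_pow_left₀ (le_max_right _ _) this 2
      linarith
    · rcases le_total (b - c₂ / 2) 0 with h0 | h0
      · have : max (b + c₁ / 2) 0 ≤ (c₁ + c₂) / 2 := max_le (by linarith) (by linarith)
        have := pow_le_pow_left₀ (le_max_right _ _) this 2
        nlinarith
      · rw [max_eq_left h0, max_eq_left (by linarith)]
        nlinarith
  have e : -(c₁ * Q) + max (b + c₁ / 2) 0 ^ 2 / ξ ≤ c₂ * Q + max (b - c₂ / 2) 0 ^ 2 / ξ ↔
      max (b + c₁ / 2) 0 ^ 2 / ξ ≤ ((c₁ + c₂) * (Q * ξ) + max (b - c₂ / 2) 0 ^ 2) / ξ := by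
    rw [add_div, show (c₁ + c₂) * (Q * ξ) / ξ = (c₁ + c₂) * Q by field_simp]
    constructor <;> intro h <;> linarith
  rw [e]
  gcongr

theorem phi_of_brk_le {c₁ c₂ Q ξ b : ℝ} (h₁ : 0 ≤ c₁) (h₂ : 0 ≤ c₂) (hξ : 0 < ξ) (hQ : 0 ≤ Q)
    (hb : brk c₁ c₂ Q ξ ≤ b) : phi c₁ c₂ Q ξ b = -(c₁ * Q) + (b + c₁ / 2) ^ 2 / ξ := by
  have hu : 0 ≤ Q * ξ := mul_nonneg hQ hξ.le
  have hS : 0 ≤ c₁ + c₂ := add_nonneg h₁ h₂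
  have hb0 : 0 ≤ b + c₁ / 2 := by
    rcases brk_cases h₁ h₂ hξ hQ with ⟨h, hr0, hr2, hr⟩ | ⟨h, hr⟩ <;> linarith
  rw [phi, max_eq_left hb0, max_eq_left]
  have key : (c₁ + c₂) * (Q * ξ) + max (b - c₂ / 2) 0 ^ 2 ≤ (b + c₁ / 2) ^ 2 := by
    rcases brk_cases h₁ h₂ hξ hQ with ⟨h, hr0, hr2, hr⟩ | ⟨h, hr⟩
    · rcases le_total (b - c₂ / 2) 0 with h0 | h0
      · rw [max_eq_right h0]
        have := pow_le_pow_left₀ hr0 (by linarith : brk c₁ c₂ Q ξ + c₁ / 2 ≤ b + c₁ / 2) 2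
        linarith
      · rw [max_eq_left h0]; nlinarith
    · rw [max_eq_left (by linarith)]; nlinarith
  have e : c₂ * Q + max (b - c₂ / 2) 0 ^ 2 / ξ ≤ -(c₁ * Q) + (b + c₁ / 2) ^ 2 / ξ ↔
      ((c₁ + c₂) * (Q * ξ) + max (b - c₂ / 2) 0 ^ 2) / ξ ≤ (b + c₁ / 2) ^ 2 / ξ := by
    rw [add_div, show (c₁ + c₂) * (Q * ξ) / ξ = (c₁ + c₂) * Q by field_simp]
    constructor <;> intro h <;> linarith
  rw [e]
  gcongr

variable {n : ℕ} (D : Newsvendor n)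

/-- The sample, extended by `0`. -/
def xs (j : ℕ) : ℝ := if hj : j < n then D.x ⟨j, hj⟩ else 0

@[simp]
theorem xs_fin (i : Fin n) : D.xs i = D.x i := by simp [xs]

/-- Whether the quadratic piece attached to `x` is not constant, given that the first (second)
breakpoint has not been passed exactly for the observations up to `t₁` (`t₂`). -/
def wt (t₁ t₂ x : ℝ) : ℝ := if x ≤ t₁ then (if x ≤ t₂ then 0 else 1) else 1

/-- The shift in the quadratic piece attached to `x`. -/
def shift (t₁ t₂ x : ℝ) : ℝ := if x ≤ t₁ then (if x ≤ t₂ then 0 else -(D.c₂ / 2)) else D.c₁ / 2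

/-- Second order data of `n` times the objective on the cell described by `t₁` and `t₂`. -/
def quad (ξ t₁ t₂ : ℝ) : Quad where
  p₁₁ := ∑ i ∈ Finset.range n, 2 * wt t₁ t₂ (D.xs i) * D.xs i ^ 2 / ξ
  p₁₂ := ∑ i ∈ Finset.range n, -(wt t₁ t₂ (D.xs i) * D.xs i / ξ)
  p₂₂ := ∑ i ∈ Finset.range n, wt t₁ t₂ (D.xs i) / (2 * ξ)
  r₁ := ∑ i ∈ Finset.range n, (D.δ - D.sm - D.xs i ^ 2
    + 2 * wt t₁ t₂ (D.xs i) * D.shift t₁ t₂ (D.xs i) * D.xs i / ξ)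
  r₂ := ∑ i ∈ Finset.range n, (D.μ - wt t₁ t₂ (D.xs i) * D.shift t₁ t₂ (D.xs i) / ξ)

/-- The lines along which the objective changes its quadratic expression. -/
def lines (ξ Q : ℝ) : Option (Fin n × Bool) → Aff
  | none => ⟨1, 0, 0⟩
  | some (i, false) => ⟨D.x i, -1 / 2, -brk D.c₁ D.c₂ Q ξ⟩
  | some (i, true) => ⟨D.x i, -1 / 2, -(D.c₂ / 2)⟩

/-- The threshold with index `j`: an observation, or a number below all observations. -/
def thr (j : ℕ) : ℝ := if n ≤ j then -1 else D.xs j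

theorem wt_nonneg (t₁ t₂ x : ℝ) : 0 ≤ wt t₁ t₂ x := by
  unfold wt; split_ifs <;> norm_num

theorem quad_form_nonneg {ξ : ℝ} (hξ : 0 < ξ) (t₁ t₂ p p' : ℝ) :
    0 ≤ (D.quad ξ t₁ t₂).form p p' := by
  have : (D.quad ξ t₁ t₂).form p p' = ∑ i ∈ Finset.range n,
      2 * wt t₁ t₂ (D.xs i) * (D.xs i * p - p' / 2) ^ 2 / ξ := by
    simp only [Quad.form, quad, Finset.mul_sum, Finset.sum_mul, ← Finset.sum_add_distrib]
    refine Finset.sum_congr rfl fun i _ => ?_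
    field_simp; ring
  rw [this]
  refine Finset.sum_nonneg fun i _ => ?_
  have := wt_nonneg t₁ t₂ (D.xs i)
  positivity

variable {D}

/-- Between the breakpoints `brk` and `c₂/2`, `phi` is constant in `b`, or a constant plus `(b -
c₂/2)² / ξ`, or a constant plus `(b + c₁/2)² / ξ`. The expression selected at `b` stays valid on the
closed cell because the breakpoints belong to both sides. -/
theorem phi_incr (hD : D.Regular) {ξ Q : ℝ} (hξ : 0 < ξ) (hQ : 0 ≤ Q) {t₁ t₂ x b b' : ℝ}
    (ht₁ : x ≤ t₁ ↔ b ≤ brk D.c₁ D.c₂ Q ξ) (ht₂ : x ≤ t₂ ↔ b ≤ D.c₂ / 2)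
    (h1 : b ≤ brk D.c₁ D.c₂ Q ξ → b' ≤ brk D.c₁ D.c₂ Q ξ)
    (h1' : brk D.c₁ D.c₂ Q ξ ≤ b → brk D.c₁ D.c₂ Q ξ ≤ b')
    (h2 : b ≤ D.c₂ / 2 → b' ≤ D.c₂ / 2) (h2' : D.c₂ / 2 ≤ b → D.c₂ / 2 ≤ b') :
    phi D.c₁ D.c₂ Q ξ b' = phi D.c₁ D.c₂ Q ξ b + wt t₁ t₂ x *
      (2 * (b + D.shift t₁ t₂ x) * (b' - b) + (b' - b) ^ 2) / ξ := by
  have n1 := hD.c₁_nonneg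
  have n2 := hD.c₂_nonneg
  rw [wt, shift]
  by_cases hb : b ≤ brk D.c₁ D.c₂ Q ξ
  · rw [if_pos (ht₁.2 hb), if_pos (ht₁.2 hb), phi_of_le_brk n1 n2 hξ hQ hb,
      phi_of_le_brk n1 n2 hξ hQ (h1 hb)]
    by_cases hb2 : b ≤ D.c₂ / 2
    · rw [if_pos (ht₂.2 hb2), if_pos (ht₂.2 hb2), max_eq_right (by linarith [h2 hb2]),
        max_eq_right (by linarith)]
      ring
    · have hb3 := le_of_not_ge hb2
      rw [if_neg (ht₂.not.2 hb2), if_neg (ht₂.not.2 hb2), max_eq_left (by linarith [h2' hb3]),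
        max_eq_left (by linarith)]
      ring
  · have hb3 := le_of_not_ge hb
    rw [if_neg (ht₁.not.2 hb), if_neg (ht₁.not.2 hb), phi_of_brk_le n1 n2 hξ hQ hb3,
      phi_of_brk_le n1 n2 hξ hQ (h1' hb3)]
    ring

/-- Sublevel sets of a monotone function of the observations are given by thresholds. -/
theorem exists_thr (hD : D.Regular) {l₁ : ℝ} (hl : 0 ≤ l₁) (l₂ β : ℝ) :
    ∃ j, j ≤ n ∧ ∀ i, D.x i ≤ D.thr j ↔ l₁ * D.x i - l₂ / 2 ≤ β := by
  by_cases h : ∃ i, l₁ * D.x i - l₂ / 2 ≤ β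
  · obtain ⟨i, hi⟩ := h
    obtain ⟨m, hm, hmax⟩ := Set.exists_max_image {i | l₁ * D.x i - l₂ / 2 ≤ β} D.x
      (Set.toFinite _) ⟨i, hi⟩
    refine ⟨m, m.2.le, fun k => ?_⟩
    rw [thr, if_neg (by have := m.2; omega), xs_fin]
    refine ⟨fun hk => ?_, fun hk => hmax k hk⟩
    have := mul_le_mul_of_nonneg_left hk hl
    have hm' : l₁ * D.x m - l₂ / 2 ≤ β := hm
    linarith
  · push Not at h
    refine ⟨n, le_rfl, fun k => ?_⟩
    -- An empty sublevel set is encoded by the threshold `-1`, which is below every observation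
    -- because observations are nonnegative.
    rw [thr, if_pos le_rfl]
    have := hD.x_nonneg k
    exact ⟨fun hk => absurd hk (by linarith), fun hk => absurd hk (not_le.2 (h k))⟩

/-- The decisive count: since `bᵢ` is nondecreasing in `xᵢ` for `λ₁ ≥ 0`, the observations before
either breakpoint are those up to a threshold. Thus two indices in `0, …, n` describe the quadratic
piece. -/
theorem obj_incr (hD : D.Regular) {ξ Q l₁ : ℝ} (hξ : 0 < ξ) (hQ : 0 ≤ Q) (hl : 0 ≤ l₁) (l₂ : ℝ) :
    ∃ j₁ j₂, j₁ ≤ n ∧ j₂ ≤ n ∧ ∀ l₁' l₂', InCell (D.lines ξ Q) l₁ l₂ l₁' l₂' →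
      D.obj ξ Q l₁' l₂' = D.obj ξ Q l₁ l₂
        + (n : ℝ)⁻¹ * (D.quad ξ (D.thr j₁) (D.thr j₂)).incr l₁ l₂ l₁' l₂' := by
  obtain ⟨j₁, hj₁, ht₁⟩ := exists_thr hD hl l₂ (brk D.c₁ D.c₂ Q ξ)
  obtain ⟨j₂, hj₂, ht₂⟩ := exists_thr hD hl l₂ (D.c₂ / 2)
  refine ⟨j₁, j₂, hj₁, hj₂, fun l₁' l₂' hc => ?_⟩
  set t₁ := D.thr j₁
  set t₂ := D.thr j₂
  have key : ∀ i, phi D.c₁ D.c₂ Q ξ (l₁' * D.x i - l₂' / 2)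
      = phi D.c₁ D.c₂ Q ξ (l₁ * D.x i - l₂ / 2) + wt t₁ t₂ (D.x i) *
      (2 * (l₁ * D.x i - l₂ / 2 + D.shift t₁ t₂ (D.x i))
        * (l₁' * D.x i - l₂' / 2 - (l₁ * D.x i - l₂ / 2))
        + (l₁' * D.x i - l₂' / 2 - (l₁ * D.x i - l₂ / 2)) ^ 2) / ξ := by
    intro i
    have c1 := hc (some (i, false))
    have c2 := hc (some (i, true))
    simp only [lines, Aff.eval] at c1 c2
    exact phi_incr hD hξ hQ (ht₁ i) (ht₂ i) (fun h => by linarith [c1.2 (by linarith)])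
      (fun h => by linarith [c1.1 (by linarith)]) (fun h => by linarith [c2.2 (by linarith)])
      (fun h => by linarith [c2.1 (by linarith)])
  have hlin : ∀ a : ℝ, a = (n : ℝ)⁻¹ * ∑ _i : Fin n, a :=
    fun a => (card_inv_mul_sum_const hD.n_pos a).symm
  -- The terms outside the sum are written as averages too, so that the identity can be checked for
  -- each observation separately.
  rw [obj, obj, hlin (l₁' * D.δ + l₂' * D.μ + (ξ - l₁') * D.sm),
    hlin (l₁ * D.δ + l₂ * D.μ + (ξ - l₁) * D.sm), ← mul_add, ← mul_add, ← mul_add]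
  congr 1
  simp only [Quad.incr, Quad.form, Quad.grad₁, Quad.grad₂, Aff.eval, quad, Finset.sum_range,
    xs_fin, Finset.mul_sum, Finset.sum_mul, ← Finset.sum_add_distrib, Finset.sum_div]
  refine Finset.sum_congr rfl fun i _ => ?_
  rw [key i]
  field_simp
  ring

variable (D) in
/-- The affine functions whose intersections are tried, in the order of enumeration. -/
def rows (ξ Q t₁ t₂ : ℝ) : ℕ → Aff
  | 0 => (D.quad ξ t₁ t₂).grad₁
  | 1 => (D.quad ξ t₁ t₂).grad₂
  | 2 => ⟨1, 0, 0⟩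
  | 3 => (D.quad ξ t₁ t₂).along ⟨1, 0, 0⟩
  | e + 4 =>
    if e % 3 = 0 then ⟨D.xs (e / 3), -1 / 2, -brk D.c₁ D.c₂ Q ξ⟩
    else if e % 3 = 1 then ⟨D.xs (e / 3), -1 / 2, -(D.c₂ / 2)⟩
    else (D.quad ξ t₁ t₂).along ⟨D.xs (e / 3), -1 / 2, 0⟩

theorem exists_rows {ξ Q t₁ t₂ : ℝ} {A : Aff} (hA : Row (D.lines ξ Q) (D.quad ξ t₁ t₂) A) :
    ∃ e, e < 3 * n + 4 ∧ D.rows ξ Q t₁ t₂ e = A := by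
  cases hA with
  | grad₁ => exact ⟨0, by omega, rfl⟩
  | grad₂ => exact ⟨1, by omega, rfl⟩
  | line k =>
    match k with
    | none => exact ⟨2, by omega, rfl⟩
    | some (i, false) =>
      have := i.2
      refine ⟨3 * i + 4, by omega, ?_⟩
      rw [rows, if_pos (by omega), show 3 * (i : ℕ) / 3 = i by omega, xs_fin, lines]
    | some (i, true) =>
      have := i.2
      refine ⟨3 * i + 1 + 4, by omega, ?_⟩
      rw [rows, if_neg (by omega), if_pos (by omega), show (3 * (i : ℕ) + 1) / 3 = i by omega,
        xs_fin, lines]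
  | along k =>
    match k with
    | none => exact ⟨3, by omega, rfl⟩
    | some (i, b) =>
      have := i.2
      refine ⟨3 * i + 2 + 4, by omega, ?_⟩
      rw [rows, if_neg (by omega), if_neg (by omega), show (3 * (i : ℕ) + 2) / 3 = i by omega,
        xs_fin]
      -- The derivative along a line ignores its constant term, so the two parallel lines of one
      -- observation share a row.
      cases b <;> simp [lines, Quad.along]

/-- The intersection of two lines, moved to the half-plane `u ≥ 0`. -/
def meet (A B : Aff) : ℝ × ℝ :=
  (max ((A.b * B.c - B.b * A.c) / (A.a * B.b - B.a * A.b)) 0,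
    (A.c * B.a - B.c * A.a) / (A.a * B.b - B.a * A.b))

variable (D) in
/-- The candidate points for a minimizer of the objective. -/
def cand (ξ Q : ℝ) (j₁ j₂ e₁ e₂ : ℕ) : ℝ × ℝ :=
  meet (D.rows ξ Q (D.thr j₁) (D.thr j₂) e₁) (D.rows ξ Q (D.thr j₁) (D.thr j₂) e₂)

/-- The clamping makes every candidate feasible, also for parallel rows, whose intersection
evaluates to `(0, 0)` by the convention for division by zero. Superfluous candidates are therefore
harmless. -/
theorem cand_nonneg (ξ Q : ℝ) (j₁ j₂ e₁ e₂ : ℕ) : 0 ≤ (D.cand ξ Q j₁ j₂ e₁ e₂).1 :=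
  le_max_right _ _

theorem exists_cand (hD : D.Regular) {ξ Q : ℝ} (hξ : 0 < ξ) (hQ : 0 ≤ Q)
    (hbdd : ∀ l₁ l₂, 0 ≤ l₁ → 0 ≤ D.obj ξ Q l₁ l₂) {l₁ : ℝ} (hl : 0 ≤ l₁) (l₂ : ℝ) :
    ∃ j₁ j₂ e₁ e₂, j₁ ≤ n ∧ j₂ ≤ n ∧ e₁ < 3 * n + 4 ∧ e₂ < 3 * n + 4 ∧
      D.obj ξ Q (D.cand ξ Q j₁ j₂ e₁ e₂).1 (D.cand ξ Q j₁ j₂ e₁ e₂).2 ≤ D.obj ξ Q l₁ l₂ := by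
  have hn : (0 : ℝ) < (n : ℝ)⁻¹ := by have := hD.n_pos; positivity
  obtain ⟨u, v, hu, hle, q, ⟨j₁, j₂, hj₁, hj₂, rfl⟩, A, B, hA, hB, hdet, eA, eB⟩ :=
    exists_isVertex (L := D.lines ξ Q) (H := D.obj ξ Q) hn
    (by
      rintro (_ | ⟨i, _ | _⟩)
      · left; simp [lines]
      · right; norm_num [lines]
      · right; norm_num [lines])
    (by
      intro p p' hp
      by_cases hp0 : p = 0
      · refine ⟨some (⟨0, hD.n_pos⟩, true), ?_⟩
        rcases hp with h | h
        · exact absurd hp0 h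
        · simp only [lines, Aff.lin, hp0]
          intro h0
          apply h
          linarith
      · exact ⟨none, by simpa [lines, Aff.lin] using hp0⟩)
    (feas := fun u _ => 0 ≤ u)
    (by
      intro u v u' v' hu hc
      have := hc none
      simp only [lines, Aff.eval] at this
      linarith [this.1 (by linarith)])
    (fun u v hu => hbdd u v hu)
    (S := {q | ∃ j₁ j₂, j₁ ≤ n ∧ j₂ ≤ n ∧ D.quad ξ (D.thr j₁) (D.thr j₂) = q})
    (by rintro q ⟨j₁, j₂, _, _, rfl⟩ p p'; exact D.quad_form_nonneg hξ _ _ _ _)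
    (by
      intro u v hu
      obtain ⟨j₁, j₂, h1, h2, h3⟩ := obj_incr hD hξ hQ hu v
      exact ⟨_, ⟨j₁, j₂, h1, h2, rfl⟩, h3⟩)
    (u := l₁) (v := l₂) hl
  obtain ⟨e₁, he₁, hr₁⟩ := exists_rows hA
  obtain ⟨e₂, he₂, hr₂⟩ := exists_rows hB
  refine ⟨j₁, j₂, e₁, e₂, hj₁, hj₂, he₁, he₂, ?_⟩
  obtain ⟨e3, e4⟩ := Aff.eq_cramer hdet eA eB
  rw [cand, hr₁, hr₂, meet, ← e3, ← e4, max_eq_left hu]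
  exact hle

/-- A convex piecewise quadratic objective that is bounded below attains its minimum. -/
theorem exists_isMin (hD : D.Regular) {ξ Q : ℝ} (hξ : 0 < ξ) (hQ : 0 ≤ Q)
    (hbdd : ∀ l₁ l₂, 0 ≤ l₁ → 0 ≤ D.obj ξ Q l₁ l₂) :
    ∃ m₁ m₂, 0 ≤ m₁ ∧ ∀ l₁ l₂, 0 ≤ l₁ → D.obj ξ Q m₁ m₂ ≤ D.obj ξ Q l₁ l₂ := by
  obtain ⟨⟨j₁, j₂, e₁, e₂⟩, -, hmin⟩ := Finset.exists_min_image
    (Finset.range (n + 1) ×ˢ Finset.range (n + 1) ×ˢ Finset.range (3 * n + 4)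
      ×ˢ Finset.range (3 * n + 4))
    (fun k => D.obj ξ Q (D.cand ξ Q k.1 k.2.1 k.2.2.1 k.2.2.2).1
      (D.cand ξ Q k.1 k.2.1 k.2.2.1 k.2.2.2).2) ⟨(0, 0, 0, 0), by simp⟩
  refine ⟨(D.cand ξ Q j₁ j₂ e₁ e₂).1, (D.cand ξ Q j₁ j₂ e₁ e₂).2, cand_nonneg ξ Q j₁ j₂ e₁ e₂, fun l₁ l₂ hl => ?_⟩
  obtain ⟨k₁, k₂, d₁, d₂, h1, h2, h3, h4, h5⟩ := exists_cand hD hξ hQ hbdd hl l₂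
  refine (hmin (k₁, k₂, d₁, d₂) ?_).trans h5
  simp only [Finset.mem_product, Finset.mem_range]
  omega

end Newsvendor

end

/-! ### Moment conditions and the behaviour for large `ξ` -/

noncomputable section

namespace Newsvendor

variable {n : ℕ} {D : Newsvendor n}

/-- A second order upper bound for `(b⁺)²`, whose derivative is `2 b⁺`. With
`nonneg_of_quadratic_nonneg` it yields first order conditions without differentiation. -/
theorem posPart_add_sq_le (b v : ℝ) :
    max (b + v) 0 ^ 2 ≤ max b 0 ^ 2 + 2 * max b 0 * v + v ^ 2 := by
  rcases le_total b 0 with h | h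
  · rw [max_eq_right h]
    rcases le_total (b + v) 0 with h' | h'
    · rw [max_eq_right h']; nlinarith [sq_nonneg v]
    · rw [max_eq_left h']; nlinarith
  · rw [max_eq_left h]
    rcases le_total (b + v) 0 with h' | h'
    · rw [max_eq_right h']; nlinarith [sq_nonneg (b + v)]
    · rw [max_eq_left h']; nlinarith

theorem nonneg_of_quadratic_nonneg {d C r : ℝ} (hr : 0 < r)
    (h : ∀ s, 0 ≤ s → s ≤ r → 0 ≤ s * d + s ^ 2 * C) : 0 ≤ d := by
  by_contra hd
  push Not at hd
  have hC : 0 < |C| + 1 := by positivity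
  have hs : 0 < min r (-d / (2 * (|C| + 1))) := lt_min hr (div_pos (by linarith) (by linarith))
  have h1 := h _ hs.le (min_le_left _ _)
  have h2 := min_le_right r (-d / (2 * (|C| + 1)))
  set s := min r (-d / (2 * (|C| + 1)))
  rw [le_div_iff₀ (by linarith)] at h2
  have h3 : 0 ≤ d + s * C := by
    by_contra hc
    push Not at hc
    nlinarith
  have h4 := mul_le_mul_of_nonneg_left (le_abs_self C) hs.le
  nlinarith

/-- First order conditions at a minimizer `(m₁, m₂)` of the problem without costs: the numbers
`(m₁ xᵢ - m₂ / 2)⁺` satisfy the moment constraints. -/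
theorem exists_moment (hD : D.Admissible) :
    ∃ (m₁ m₂ : ℝ) (Y : Fin n → ℝ), 0 ≤ m₁ ∧ (∀ i, Y i = max (m₁ * D.x i - m₂ / 2) 0) ∧
      (n : ℝ)⁻¹ * ∑ i, Y i = D.μ ∧
      0 ≤ D.δ - D.sm + (n : ℝ)⁻¹ * ∑ i, (2 * D.x i * Y i - D.x i ^ 2) ∧
      m₁ * (D.δ - D.sm + (n : ℝ)⁻¹ * ∑ i, (2 * D.x i * Y i - D.x i ^ 2)) = 0 ∧
      (n : ℝ)⁻¹ * ∑ i, Y i ^ 2 ≤ D.sm := by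
  -- By homogeneity `ξ = 1` is only a normalization, and the zero-cost objective does not depend on
  -- `Q`.
  obtain ⟨m₁, m₂, hm, hmin⟩ := exists_isMin hD.regular.free one_pos le_rfl
    (fun l₁ l₂ hl => obj_free_nonneg hD one_pos hl 0 l₂)
  have h0 := obj_free_nonneg hD one_pos hm 0 m₂
  set Y : Fin n → ℝ := fun i => max (m₁ * D.x i - m₂ / 2) 0 with hY
  set d₁ := D.δ - D.sm + (n : ℝ)⁻¹ * ∑ i, (2 * D.x i * Y i - D.x i ^ 2) with hd₁
  set d₂ := D.μ - (n : ℝ)⁻¹ * ∑ i, Y i with hd₂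
  -- Perturbing `m₁`, and in `key₂` perturbing `m₂`, shows that the partial derivatives are `d₁` and
  -- `d₂`. Only `m₁` is sign constrained, hence complementary slackness for `d₁` and `d₂ = 0`.
  have key₁ : ∀ s, 0 ≤ m₁ + s → 0 ≤ s * d₁ + s ^ 2 * ((n : ℝ)⁻¹ * ∑ i, D.x i ^ 2) := by
    intro s hs
    have h1 := hmin (m₁ + s) m₂ hs
    rw [obj_free, obj_free] at h1
    have h2 := card_inv_mul_sum_mono (u := fun i => -((m₁ + s) * D.x i ^ 2)
        + max ((m₁ + s) * D.x i - m₂ / 2) 0 ^ 2 / 1)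
      (v := fun i => (-(m₁ * D.x i ^ 2) + max (m₁ * D.x i - m₂ / 2) 0 ^ 2 / 1)
        + (s * (2 * D.x i * Y i - D.x i ^ 2) + s ^ 2 * D.x i ^ 2)) fun i => by
      have := posPart_add_sq_le (m₁ * D.x i - m₂ / 2) (s * D.x i)
      rw [show m₁ * D.x i - m₂ / 2 + s * D.x i = (m₁ + s) * D.x i - m₂ / 2 by ring] at this
      simp only [hY]
      linarith
    have h3 := h2.trans_eq (card_inv_mul_sum_add _ _)
    rw [card_inv_mul_sum_add (fun i => s * (2 * D.x i * Y i - D.x i ^ 2)), card_inv_mul_sum_mul,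
      card_inv_mul_sum_mul] at h3
    rw [hd₁]
    linarith
  have key₂ : ∀ s, 0 ≤ s * d₂ + s ^ 2 * (1 / 4) := by
    intro s
    have h1 := hmin m₁ (m₂ + s) hm
    rw [obj_free, obj_free] at h1
    have h2 := card_inv_mul_sum_mono (u := fun i => -(m₁ * D.x i ^ 2)
        + max (m₁ * D.x i - (m₂ + s) / 2) 0 ^ 2 / 1)
      (v := fun i => (-(m₁ * D.x i ^ 2) + max (m₁ * D.x i - m₂ / 2) 0 ^ 2 / 1)
        + (-s * Y i + s ^ 2 * (1 / 4))) fun i => by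
      have := posPart_add_sq_le (m₁ * D.x i - m₂ / 2) (-s / 2)
      rw [show m₁ * D.x i - m₂ / 2 + -s / 2 = m₁ * D.x i - (m₂ + s) / 2 by ring] at this
      simp only [hY]
      linarith
    have h3 := h2.trans_eq (card_inv_mul_sum_add _ _)
    rw [card_inv_mul_sum_add (fun i => -s * Y i), card_inv_mul_sum_mul,
      card_inv_mul_sum_const hD.n_pos] at h3
    rw [hd₂]
    linarith
  have hd₁0 : 0 ≤ d₁ := nonneg_of_quadratic_nonneg one_pos fun s hs _ => key₁ s (by linarith)
  have hd₁m : m₁ * d₁ = 0 := by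
    rcases eq_or_lt_of_le hm with h | h
    · rw [← h, zero_mul]
    · have : 0 ≤ -d₁ := nonneg_of_quadratic_nonneg (C := (n : ℝ)⁻¹ * ∑ i, D.x i ^ 2) h fun s hs hs' => by
        have := key₁ (-s) (by linarith)
        rw [neg_sq] at this
        linarith
      rw [show d₁ = 0 by linarith, mul_zero]
  have hd₂0 : d₂ = 0 := by
    have a1 : 0 ≤ d₂ := nonneg_of_quadratic_nonneg one_pos fun s _ _ => key₂ s
    have a2 : 0 ≤ -d₂ := nonneg_of_quadratic_nonneg (C := 1 / 4) one_pos fun s _ _ => by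
      have := key₂ (-s)
      rw [neg_sq] at this
      linarith
    linarith
  refine ⟨m₁, m₂, Y, hm, fun i => rfl, by linarith, hd₁0, hd₁m, ?_⟩
  -- Since `(b⁺)² = 2 b b⁺ - (b⁺)²`, the first order conditions reduce the minimal value to the
  -- prescribed second moment minus the average of `Yᵢ²`; its nonnegativity is the last claim.
  have e : ∀ i, -(m₁ * D.x i ^ 2) + max (m₁ * D.x i - m₂ / 2) 0 ^ 2 / 1
      = m₁ * (2 * D.x i * Y i - D.x i ^ 2) + (-m₂ * Y i + (-1) * Y i ^ 2) := by
    intro i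
    have : max (m₁ * D.x i - m₂ / 2) 0 ^ 2 = (m₁ * D.x i - m₂ / 2) * Y i := by
      simp only [hY]
      rcases le_total (m₁ * D.x i - m₂ / 2) 0 with h | h
      · rw [max_eq_right h]; ring
      · rw [max_eq_left h]; ring
    rw [this]; ring
  rw [obj_free, Finset.sum_congr rfl fun i _ => e i, card_inv_mul_sum_add, card_inv_mul_sum_add,
    card_inv_mul_sum_mul, card_inv_mul_sum_mul, card_inv_mul_sum_mul] at h0
  have hA : m₁ * (D.δ - D.sm) + m₁ * ((n : ℝ)⁻¹ * ∑ i, (2 * D.x i * Y i - D.x i ^ 2)) = 0 := by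
    rw [← mul_add]; exact hd₁m
  have hB : m₂ * D.μ = m₂ * ((n : ℝ)⁻¹ * ∑ i, Y i) := by
    rw [show (n : ℝ)⁻¹ * ∑ i, Y i = D.μ by linarith]
  linarith

theorem exists_obj_eq_min (hD : D.Admissible) {ξ Q : ℝ} (hξ : 0 < ξ) (hQ : 0 ≤ Q) :
    ∃ m₁ m₂, 0 ≤ m₁ ∧ ∀ l₁ l₂, 0 ≤ l₁ → D.obj ξ Q m₁ m₂ ≤ D.obj ξ Q l₁ l₂ :=
  exists_isMin hD.regular hξ hQ fun _ l₂ hl => obj_nonneg hD hξ hl Q l₂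

/-- For large `ξ` there is little to gain from increasing `ξ` further. -/
theorem exists_obj_le_add (hD : D.Admissible) {B ξ Q l₁ : ℝ} (hB : 0 < B) (hξ : B ≤ ξ)
    (hl : 0 ≤ l₁) (l₂ : ℝ) :
    ∃ m₁ m₂, 0 ≤ m₁ ∧
      D.obj B Q m₁ m₂ ≤ D.obj ξ Q l₁ l₂ + max D.c₁ D.c₂ ^ 2 / (4 * B) := by
  have c1 := hD.regular.c₁_nonneg
  have c2 := hD.regular.c₂_nonneg
  obtain ⟨m₁, m₂, Y, hm, hY, hμ, hδ, hcomp, hsm⟩ := exists_moment hD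
  have hY0 : ∀ i, 0 ≤ Y i := fun i => by rw [hY]; exact le_max_right _ _
  -- The witness is the zero-cost multiplier scaled from `ξ = 1` to `ξ = B`.
  refine ⟨B * m₁, B * m₂, by positivity, ?_⟩
  set C := (n : ℝ)⁻¹ * ∑ i, loss D.c₁ D.c₂ Q (Y i) with hC
  set V := (n : ℝ)⁻¹ * ∑ i, Y i ^ 2 with hV
  set W := (n : ℝ)⁻¹ * ∑ i, (2 * D.x i * Y i - D.x i ^ 2) with hW
  -- Weak duality: each supremum is tested at `Yᵢ`, and the constraints satisfied by `Y` remove `λ₁`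
  -- and `λ₂`.
  have lower : C + ξ * (D.sm - V) ≤ D.obj ξ Q l₁ l₂ := by
    have h := card_inv_mul_sum_mono (u := fun i => l₁ * (2 * D.x i * Y i - D.x i ^ 2)
        + (-l₂ * Y i + (-ξ * Y i ^ 2 + loss D.c₁ D.c₂ Q (Y i))))
      (v := fun i => -(l₁ * D.x i ^ 2) + phi D.c₁ D.c₂ Q ξ (l₁ * D.x i - l₂ / 2)) fun i => by
      have := le_phi (Q := Q) (b := l₁ * D.x i - l₂ / 2) c1 c2 (hB.trans_le hξ) (hY0 i)
      linarith
    rw [card_inv_mul_sum_add, card_inv_mul_sum_add, card_inv_mul_sum_add, card_inv_mul_sum_mul,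
      card_inv_mul_sum_mul, card_inv_mul_sum_mul, hμ, ← hW, ← hV, ← hC] at h
    rw [obj]
    have := mul_nonneg hl hδ
    linarith
  -- For `y ≥ 0` the quadratic part is at most `B Yᵢ² - B (y - Yᵢ)²`, while the loss changes by at
  -- most `max c₁ c₂ * |y - Yᵢ|`; completing the square bounds the excess.
  have upper : D.obj B Q (B * m₁) (B * m₂)
      ≤ C + B * (D.sm - V) + max D.c₁ D.c₂ ^ 2 / (4 * B) := by
    have h := card_inv_mul_sum_mono
      (u := fun i => -(B * m₁ * D.x i ^ 2)
        + phi D.c₁ D.c₂ Q B (B * m₁ * D.x i - B * m₂ / 2))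
      (v := fun i => (B * m₁ * (2 * D.x i * Y i - D.x i ^ 2)
        + (-(B * m₂) * Y i + (-B * Y i ^ 2 + loss D.c₁ D.c₂ Q (Y i))))
          + max D.c₁ D.c₂ ^ 2 / (4 * B)) fun i => by
      have : phi D.c₁ D.c₂ Q B (B * m₁ * D.x i - B * m₂ / 2)
          ≤ loss D.c₁ D.c₂ Q (Y i) + B * Y i ^ 2 + max D.c₁ D.c₂ ^ 2 / (4 * B) := by
        refine phi_le c1 c2 hB fun y hy => ?_
        have e1 := loss_lipschitz (Q := Q) (Q' := Q) (y := y) (y' := Y i) c1 c2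
        rw [show y - Q - (Y i - Q) = y - Y i by ring] at e1
        have e2 : max D.c₁ D.c₂ * |y - Y i| - B * |y - Y i| ^ 2
            ≤ max D.c₁ D.c₂ ^ 2 / (4 * B) := by
          rw [le_div_iff₀ (by positivity)]
          nlinarith [sq_nonneg (max D.c₁ D.c₂ - 2 * B * |y - Y i|)]
        rw [sq_abs] at e2
        have e3 : (m₁ * D.x i - m₂ / 2) * y ≤ Y i * y :=
          mul_le_mul_of_nonneg_right (by rw [hY]; exact le_max_left _ _) hy
        have e4 := mul_le_mul_of_nonneg_left e3 hB.le
        nlinarith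
      have e5 : (m₁ * D.x i - m₂ / 2) * Y i = Y i ^ 2 := by
        rw [hY]
        rcases le_total (m₁ * D.x i - m₂ / 2) 0 with h | h
        · rw [max_eq_right h]; ring
        · rw [max_eq_left h]; ring
      have e6 : B * ((m₁ * D.x i - m₂ / 2) * Y i) = B * Y i ^ 2 := by rw [e5]
      linarith
    replace h := h.trans_eq (card_inv_mul_sum_add _ _)
    rw [card_inv_mul_sum_const hD.n_pos,
      card_inv_mul_sum_add (fun i => B * m₁ * (2 * D.x i * Y i - D.x i ^ 2)),
      card_inv_mul_sum_add (fun i => -(B * m₂) * Y i),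
      card_inv_mul_sum_add (fun i => -B * Y i ^ 2), card_inv_mul_sum_mul,
      card_inv_mul_sum_mul, card_inv_mul_sum_mul, hμ, ← hW, ← hV, ← hC] at h
    rw [obj]
    have e7 : B * (m₁ * (D.δ - D.sm + W)) = 0 := by rw [hcomp, mul_zero]
    linarith
  have : B * (D.sm - V) ≤ ξ * (D.sm - V) := mul_le_mul_of_nonneg_right hξ (by linarith)
  linarith

/-! ### The functions `f` and `h` -/

variable (D) in
/-- The real value of `f`. -/
def fr (ξ Q : ℝ) : ℝ := (D.f ξ Q).toReal

variable (D) in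
/-- The real value of `h`. -/
def hr (Q : ℝ) : ℝ := (D.h Q).toReal

theorem f_eq_of_isMin (hD : D.Regular) {ξ Q m₁ m₂ : ℝ} (hξ : 0 < ξ) (hm : 0 ≤ m₁)
    (hmin : ∀ l₁ l₂, 0 ≤ l₁ → D.obj ξ Q m₁ m₂ ≤ D.obj ξ Q l₁ l₂) :
    D.f ξ Q = ((D.obj ξ Q m₁ m₂ : ℝ) : EReal) := by
  apply le_antisymm
  · rw [← F_eq hD hξ]
    exact (iInf₂_le m₁ hm).trans (iInf_le _ m₂)
  · refine le_iInf₂ fun l₁ hl => le_iInf fun l₂ => ?_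
    rw [F_eq hD hξ, EReal.coe_le_coe_iff]
    exact hmin l₁ l₂ hl

theorem exists_fr_eq (hD : D.Admissible) {ξ Q : ℝ} (hξ : 0 < ξ) (hQ : 0 ≤ Q) :
    ∃ m₁ m₂, 0 ≤ m₁ ∧ D.fr ξ Q = D.obj ξ Q m₁ m₂ := by
  obtain ⟨m₁, m₂, hm, hmin⟩ := exists_obj_eq_min hD hξ hQ
  exact ⟨m₁, m₂, hm, by rw [fr, f_eq_of_isMin hD.regular hξ hm hmin, EReal.toReal_coe]⟩

theorem f_eq (hD : D.Admissible) {ξ Q : ℝ} (hξ : 0 < ξ) (hQ : 0 ≤ Q) :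
    D.f ξ Q = ((D.fr ξ Q : ℝ) : EReal) := by
  obtain ⟨m₁, m₂, hm, hmin⟩ := exists_obj_eq_min hD hξ hQ
  rw [fr, f_eq_of_isMin hD.regular hξ hm hmin, EReal.toReal_coe]

theorem fr_le (hD : D.Admissible) {ξ Q l₁ : ℝ} (hξ : 0 < ξ) (hQ : 0 ≤ Q) (hl : 0 ≤ l₁) (l₂ : ℝ) :
    D.fr ξ Q ≤ D.obj ξ Q l₁ l₂ := by
  rw [← EReal.coe_le_coe_iff, ← f_eq hD hξ hQ, ← F_eq hD.regular hξ]
  exact (iInf₂_le l₁ hl).trans (iInf_le _ l₂)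

theorem fr_nonneg (hD : D.Admissible) {ξ Q : ℝ} (hξ : 0 < ξ) (hQ : 0 ≤ Q) : 0 ≤ D.fr ξ Q := by
  obtain ⟨m₁, m₂, hm, h⟩ := exists_fr_eq hD hξ hQ
  rw [h]
  exact obj_nonneg hD hξ hm Q m₂

theorem le_fr (hD : D.Admissible) {ξ Q : ℝ} (hξ : 0 < ξ) (hQ : 0 ≤ Q) :
    D.c₂ * (Q - D.μ) ≤ D.fr ξ Q := by
  obtain ⟨m₁, m₂, hm, h⟩ := exists_fr_eq hD hξ hQ
  rw [h]
  exact le_obj hD hξ hm Q m₂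

theorem fr_convex (hD : D.Admissible) {ξ ξ' Q Q' a b : ℝ} (hξ : 0 < ξ) (hξ' : 0 < ξ')
    (hQ : 0 ≤ Q) (hQ' : 0 ≤ Q') (ha : 0 ≤ a) (hb : 0 ≤ b) (hab : a + b = 1)
    (hpos : 0 < a * ξ + b * ξ') :
    D.fr (a * ξ + b * ξ') (a * Q + b * Q') ≤ a * D.fr ξ Q + b * D.fr ξ' Q' := by
  obtain ⟨m₁, m₂, hm, h⟩ := exists_fr_eq hD hξ hQ
  obtain ⟨m₁', m₂', hm', h'⟩ := exists_fr_eq hD hξ' hQ'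
  rw [h, h']
  exact (fr_le hD hpos (by positivity) (by positivity : 0 ≤ a * m₁ + b * m₁') _).trans
    (obj_convex hD.regular hξ hξ' ha hb hab)

theorem fr_lipschitz (hD : D.Admissible) {ξ Q Q' : ℝ} (hξ : 0 < ξ) (hQ : 0 ≤ Q) (hQ' : 0 ≤ Q') :
    D.fr ξ Q ≤ D.fr ξ Q' + max D.c₁ D.c₂ * |Q - Q'| := by
  obtain ⟨m₁, m₂, hm, h⟩ := exists_fr_eq hD hξ hQ'
  rw [h]
  exact (fr_le hD hξ hQ hm m₂).trans (obj_lipschitz hD.regular hξ Q Q' m₁ m₂)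

theorem fr_le_add (hD : D.Admissible) {ξ ξ' Q : ℝ} (hξ : 0 < ξ) (h : ξ ≤ ξ') (hQ : 0 ≤ Q) :
    D.fr ξ' Q ≤ D.fr ξ Q + (ξ' - ξ) * D.sm := by
  obtain ⟨m₁, m₂, hm, he⟩ := exists_fr_eq hD hξ hQ
  rw [he]
  exact (fr_le hD (hξ.trans_le h) hQ hm m₂).trans (obj_le_add hD.regular hξ h Q m₁ m₂)

theorem fr_le_add_div (hD : D.Admissible) {B ξ Q : ℝ} (hB : 0 < B) (h : B ≤ ξ) (hQ : 0 ≤ Q) :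
    D.fr B Q ≤ D.fr ξ Q + max D.c₁ D.c₂ ^ 2 / (4 * B) := by
  obtain ⟨l₁, l₂, hl, he⟩ := exists_fr_eq hD (hB.trans_le h) hQ
  obtain ⟨m₁, m₂, hm, hle⟩ := exists_obj_le_add (Q := Q) hD hB h hl l₂
  rw [he]
  exact (fr_le hD hB hQ hm m₂).trans hle

theorem fr_upper (hD : D.Admissible) {ξ Q : ℝ} (hξ : 0 < ξ) (hQ : 0 ≤ Q) :
    D.fr ξ Q ≤ ξ * D.sm + D.c₂ * Q + D.c₁ ^ 2 / (4 * ξ) :=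
  (fr_le hD hξ hQ le_rfl 0).trans (obj_zero_le hD.regular hξ hQ)

/-- Convexity on `[A/2, ξ']`: the point `ξ` puts weight at most `2 (ξ' - ξ) / A` on the endpoint
`A/2`, where `fr_upper` bounds the value, and nonnegativity at `ξ'` allows the other weight to be
replaced by `1`. -/
theorem fr_le_of_lt (hD : D.Admissible) {A ξ ξ' Q : ℝ} (hA : 0 < A) (hξ : A ≤ ξ) (h : ξ ≤ ξ')
    (hQ : 0 ≤ Q) :
    D.fr ξ Q ≤ D.fr ξ' Q + (D.sm + 2 * D.c₂ * Q / A + D.c₁ ^ 2 / A ^ 2) * (ξ' - ξ) := by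
  have hA2 : 0 < A / 2 := by linarith
  have hU := fr_upper hD hA2 hQ
  have hden : 0 < ξ' - A / 2 := by linarith
  set a := (ξ' - ξ) / (ξ' - A / 2) with ha
  set b := (ξ - A / 2) / (ξ' - A / 2) with hb
  have ha0 : 0 ≤ a := div_nonneg (by linarith) hden.le
  have hb0 : 0 ≤ b := div_nonneg (by linarith) hden.le
  have hab : a + b = 1 := by
    rw [ha, hb, ← add_div, div_eq_one_iff_eq hden.ne']; ring
  have hcomb : a * (A / 2) + b * ξ' = ξ := by
    rw [ha, hb, div_mul_eq_mul_div, div_mul_eq_mul_div, ← add_div, div_eq_iff hden.ne']; ring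
  have hξ0 : 0 < ξ := hA.trans_le hξ
  have hc := fr_convex hD hA2 (hξ0.trans_le h) hQ hQ ha0 hb0 hab (by rw [hcomb]; exact hξ0)
  rw [hcomb, ← add_mul, hab, one_mul] at hc
  have hfp := fr_nonneg hD (hξ0.trans_le h) hQ
  have h1 : a ≤ (ξ' - ξ) * (2 / A) := by
    rw [ha, div_eq_mul_inv]
    refine mul_le_mul_of_nonneg_left ?_ (by linarith)
    rw [inv_eq_one_div, div_le_div_iff₀ hden hA]
    linarith
  have hb1 : b ≤ 1 := by linarith
  have h2 := mul_le_mul_of_nonneg_right hb1 hfp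
  have hU0 : 0 ≤ A / 2 * D.sm + D.c₂ * Q + D.c₁ ^ 2 / (4 * (A / 2)) := (fr_nonneg hD hA2 hQ).trans hU
  have h3 := mul_le_mul_of_nonneg_left hU ha0
  have h4 := mul_le_mul_of_nonneg_right h1 hU0
  have h5 : (ξ' - ξ) * (2 / A) * (A / 2 * D.sm + D.c₂ * Q + D.c₁ ^ 2 / (4 * (A / 2)))
      = (D.sm + 2 * D.c₂ * Q / A + D.c₁ ^ 2 / A ^ 2) * (ξ' - ξ) := by
    field_simp; ring
  linarith

theorem h_le (hD : D.Admissible) {ξ Q : ℝ} (hξ : 0 < ξ) (hQ : 0 ≤ Q) :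
    D.h Q ≤ ((D.fr ξ Q : ℝ) : EReal) := by
  rw [← f_eq hD hξ hQ]
  exact iInf₂_le ξ hξ

theorem le_h (hD : D.Admissible) {Q v : ℝ} (hQ : 0 ≤ Q) (hv : ∀ ξ, 0 < ξ → v ≤ D.fr ξ Q) :
    (v : EReal) ≤ D.h Q := by
  refine le_iInf₂ fun ξ hξ => ?_
  rw [f_eq hD hξ hQ, EReal.coe_le_coe_iff]
  exact hv ξ hξ

theorem h_eq (hD : D.Admissible) {Q : ℝ} (hQ : 0 ≤ Q) : D.h Q = ((D.hr Q : ℝ) : EReal) := by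
  rw [hr, EReal.coe_toReal]
  · exact ((h_le hD one_pos hQ).trans_lt (EReal.coe_lt_top _)).ne
  · exact ((EReal.bot_lt_coe 0).trans_le
      (le_h hD hQ fun ξ hξ => fr_nonneg hD hξ hQ)).ne'

theorem hr_le (hD : D.Admissible) {ξ Q : ℝ} (hξ : 0 < ξ) (hQ : 0 ≤ Q) : D.hr Q ≤ D.fr ξ Q := by
  rw [← EReal.coe_le_coe_iff, ← h_eq hD hQ]
  exact h_le hD hξ hQ

theorem le_hr (hD : D.Admissible) {Q v : ℝ} (hQ : 0 ≤ Q) (hv : ∀ ξ, 0 < ξ → v ≤ D.fr ξ Q) :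
    v ≤ D.hr Q := by
  rw [← EReal.coe_le_coe_iff, ← h_eq hD hQ]
  exact le_h hD hQ hv

theorem exists_fr_lt (hD : D.Admissible) {Q ε : ℝ} (hQ : 0 ≤ Q) (hε : 0 < ε) :
    ∃ ξ, 0 < ξ ∧ D.fr ξ Q < D.hr Q + ε := by
  by_contra hc
  push Not at hc
  have := le_hr hD hQ hc
  linarith

theorem le_hr_lower (hD : D.Admissible) {Q : ℝ} (hQ : 0 ≤ Q) : D.c₂ * (Q - D.μ) ≤ D.hr Q :=
  le_hr hD hQ fun _ hξ => le_fr hD hξ hQ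

theorem hr_upper (hD : D.Admissible) {Q : ℝ} (hQ : 0 < Q) :
    D.hr Q ≤ D.c₂ * (Q - D.μ) + (D.c₁ + D.c₂) * D.sm / (4 * Q) := by
  obtain ⟨ξ, l₂, hξ, h⟩ := exists_obj_le hD.regular hQ (add_pos hD.c₁_pos hD.c₂_pos)
  exact (hr_le hD hξ hQ.le).trans ((fr_le hD hξ hQ.le le_rfl l₂).trans h)

theorem hr_lipschitz (hD : D.Admissible) {Q Q' : ℝ} (hQ : 0 ≤ Q) (hQ' : 0 ≤ Q') :
    D.hr Q ≤ D.hr Q' + max D.c₁ D.c₂ * |Q - Q'| := by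
  have : D.hr Q - max D.c₁ D.c₂ * |Q - Q'| ≤ D.hr Q' := le_hr hD hQ' fun ξ hξ => by
    have := hr_le hD hξ hQ
    have := fr_lipschitz hD hξ hQ hQ'
    linarith
  linarith

/-- Partial minimization of a jointly convex function, with `ε`-optimal `ξ` because the infimum over
`ξ > 0` need not be attained. -/
theorem hr_convexOn (hD : D.Admissible) : ConvexOn ℝ (Set.Ici 0) D.hr := by
  refine ⟨convex_Ici 0, fun Q hQ Q' hQ' a b ha hb hab => ?_⟩
  simp only [smul_eq_mul]
  refine le_of_forall_pos_le_add fun ε hε => ?_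
  obtain ⟨ξ, hξ, h⟩ := exists_fr_lt hD hQ hε
  obtain ⟨ξ', hξ', h'⟩ := exists_fr_lt hD hQ' hε
  have hQ0 : 0 ≤ Q := hQ
  have hQ0' : 0 ≤ Q' := hQ'
  have hpos : 0 < a * ξ + b * ξ' := by
    rcases eq_or_lt_of_le ha with h0 | h0
    · rw [← h0, show b = 1 by linarith]; linarith
    · have := mul_pos h0 hξ
      have := mul_nonneg hb hξ'.le
      linarith
  have h1 := hr_le hD hpos (by positivity : 0 ≤ a * Q + b * Q')
  have h2 := fr_convex hD hξ hξ' hQ0 hQ0' ha hb hab hpos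
  have h3 := mul_le_mul_of_nonneg_left h.le ha
  have h4 := mul_le_mul_of_nonneg_left h'.le hb
  have h5 : (a + b) * ε = ε := by rw [hab, one_mul]
  linarith

theorem hr_lipschitzOn (hD : D.Admissible) :
    LipschitzOnWith (Real.toNNReal (max D.c₁ D.c₂)) D.hr (Set.Ici 0) := by
  refine LipschitzOnWith.of_le_add_mul _ fun Q hQ Q' hQ' => ?_
  rw [Real.coe_toNNReal _ (le_max_of_le_left hD.c₁_pos.le), Real.dist_eq]
  exact hr_lipschitz hD hQ hQ'

theorem exists_hr_min (hD : D.Admissible) :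
    ∃ Qs, 0 ≤ Qs ∧ ∀ Q, 0 ≤ Q → D.hr Qs ≤ D.hr Q := by
  have hc := hD.c₂_pos
  -- Beyond `R` the lower bound `c₂ (Q - μ)` is at least `h(0)`, so a minimum over `[0, R]` is
  -- global.
  set R := |D.hr 0| / D.c₂ + D.μ with hR
  have hR0 : 0 ≤ R := by have := hD.μ_nonneg; positivity
  obtain ⟨Qs, hQs, hmin⟩ := isCompact_Icc.exists_isMinOn (s := Set.Icc 0 R) (f := D.hr)
    ⟨0, le_rfl, hR0⟩ ((hr_lipschitzOn hD).continuousOn.mono Set.Icc_subset_Ici_self)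
  refine ⟨Qs, hQs.1, fun Q hQ => ?_⟩
  rcases le_total Q R with h | h
  · exact hmin ⟨hQ, h⟩
  · have h0 : D.hr Qs ≤ D.hr 0 := hmin ⟨le_rfl, hR0⟩
    have h1 := le_hr_lower hD hQ
    have h2 : D.c₂ * (R - D.μ) = |D.hr 0| := by rw [hR]; field_simp; ring
    have h3 := mul_le_mul_of_nonneg_left h hc.le
    have := le_abs_self (D.hr 0)
    linarith

/-- The dual allows any sign of `λ₁ + λ₃`, while `h` uses positive values only; this is why nothing
is lost. -/
theorem h_le_F (hD : D.Admissible) {Q l₁ : ℝ} (hQ : 0 ≤ Q) (hl : 0 ≤ l₁) (l₂ l₃ : ℝ) :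
    D.h Q ≤ D.F l₁ l₂ l₃ Q := by
  have main : ∀ l₃, 0 < l₁ + l₃ → D.h Q ≤ D.F l₁ l₂ l₃ Q := by
    intro l₃ hpos
    refine (iInf₂_le _ hpos).trans ((iInf₂_le l₁ hl).trans ((iInf_le _ l₂).trans ?_))
    rw [add_sub_cancel_left]
  rcases lt_trichotomy (l₁ + l₃) 0 with h | h | h
  · rw [F_eq_top hD.regular h]; exact le_top
  · rw [h_eq hD hQ] at main ⊢
    by_contra hc
    push Not at hc
    obtain ⟨r, hr1, hr2⟩ := EReal.lt_iff_exists_real_btwn.1 hc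
    rw [EReal.coe_lt_coe_iff] at hr2
    have hs := D.sm_nonneg
    -- Small enough that raising `λ₃` by `ξ` uses up at most half of the assumed gap.
    set ξ := (D.hr Q - r) / (2 * (D.sm + 1)) with hξ
    have hξ0 : 0 < ξ := div_pos (by linarith) (by linarith)
    have h1 := (main (l₃ + ξ) (by linarith)).trans (F_add_le l₁ l₂ l₃ Q hξ0.le)
    have h2 := h1.trans (add_le_add hr1.le le_rfl)
    rw [← EReal.coe_add, EReal.coe_le_coe_iff] at h2
    have h3 : ξ * (2 * (D.sm + 1)) = D.hr Q - r := by rw [hξ]; field_simp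
    nlinarith
  · exact main l₃ h

theorem dualValue_eq (hD : D.Admissible) {Qs : ℝ} (hQs : 0 ≤ Qs)
    (hmin : ∀ Q, 0 ≤ Q → D.hr Qs ≤ D.hr Q) : D.dualValue = ((D.hr Qs : ℝ) : EReal) := by
  apply le_antisymm
  · rw [← h_eq hD hQs]
    refine le_iInf₂ fun ξ hξ => le_iInf₂ fun l₁ hl => le_iInf fun l₂ => ?_
    exact (iInf₂_le Qs hQs).trans ((iInf₂_le l₁ hl).trans ((iInf_le _ l₂).trans (iInf_le _ _)))
  · refine le_iInf₂ fun Q hQ => le_iInf₂ fun l₁ hl => le_iInf fun l₂ => le_iInf fun l₃ => ?_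
    refine le_trans ?_ (h_le_F hD hQ hl l₂ l₃)
    rw [h_eq hD hQ, EReal.coe_le_coe_iff]
    exact hmin Q hQ

end Newsvendor

end

/-! ### Program logic for the real RAM -/

noncomputable section

namespace RealRAM

/-- The state after writing `v` to the index register `r`. -/
def State.setN (s : State) (r v : ℕ) : State := ⟨Function.update s.nat r v, s.real⟩

/-- The state after writing `v` to entry `j` of array `k`. -/
def State.setR (s : State) (k j : ℕ) (v : ℝ) : State :=
  ⟨s.nat, Function.update s.real k (Function.update (s.real k) j v)⟩

@[simp]
theorem State.setN_nat (s : State) (r v r' : ℕ) :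
    (s.setN r v).nat r' = if r' = r then v else s.nat r' := by
  simp [setN, Function.update_apply]

@[simp]
theorem State.setN_real (s : State) (r v : ℕ) : (s.setN r v).real = s.real := rfl

@[simp]
theorem State.setR_nat (s : State) (k j : ℕ) (v : ℝ) : (s.setR k j v).nat = s.nat := rfl

@[simp]
theorem State.setR_real (s : State) (k j : ℕ) (v : ℝ) (k' j' : ℕ) :
    (s.setR k j v).real k' j' = if k' = k ∧ j' = j then v else s.real k' j' := by
  by_cases h : k' = k
  · subst h; simp [setR, Function.update_apply]
  · simp [setR, h]

theorem State.setR_real_ne (s : State) {k j : ℕ} {v : ℝ} {k' : ℕ} (h : k' ≠ k) :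
    (s.setR k j v).real k' = s.real k' := by
  simp [setR, h]

/-- The states `s` and `s'` agree outside the registers in `R` and the arrays in `A`. -/
structure Frame (R A : Finset ℕ) (s s' : State) : Prop where
  nat : ∀ r, r ∉ R → s'.nat r = s.nat r
  real : ∀ k, k ∉ A → s'.real k = s.real k

namespace Frame

variable {R A R' A' : Finset ℕ} {s s' s'' : State}

theorem refl (s : State) : Frame R A s s := ⟨fun _ _ => rfl, fun _ _ => rfl⟩

theorem trans (h : Frame R A s s') (h' : Frame R A s' s'') : Frame R A s s'' :=
  ⟨fun r hr => (h'.nat r hr).trans (h.nat r hr), fun k hk => (h'.real k hk).trans (h.real k hk)⟩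

theorem mono (h : Frame R A s s') (hR : R ⊆ R') (hA : A ⊆ A') : Frame R' A' s s' :=
  ⟨fun r hr => h.nat r fun h' => hr (hR h'), fun k hk => h.real k fun h' => hk (hA h')⟩

theorem setN (h : Frame R A s s') {r : ℕ} (hr : r ∈ R) (v : ℕ) : Frame R A s (s'.setN r v) :=
  ⟨fun r' hr' => by
    rw [State.setN_nat, if_neg (by rintro rfl; exact hr' hr), h.nat r' hr'], h.real⟩

theorem setR (h : Frame R A s s') {k : ℕ} (hk : k ∈ A) (j : ℕ) (v : ℝ) :
    Frame R A s (s'.setR k j v) :=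
  ⟨h.nat, fun k' hk' => by
    rw [State.setR_real_ne s' (by rintro rfl; exact hk' hk), h.real k' hk']⟩

end Frame

/-- An upper bound for the running time of a program in which no loop makes more than `N`
passes at a time. -/
def Program.bound (N : ℕ) : Program → ℕ
  | .skip => 1
  | .setNat _ e => e.cost + 1
  | .setReal _ j e => j.cost + e.cost + 1
  | .seq P P' => P.bound N + P'.bound N
  | .branch b P P' => b.cost + (P.bound N + P'.bound N)
  | .loop b P => N * (b.cost + P.bound N) + b.cost

theorem Program.exists_polynomial_bound (P : Program) :
    ∃ p : Polynomial ℕ, ∀ N, P.bound N = p.eval N := by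
  induction P with
  | skip => exact ⟨1, fun N => by simp [bound]⟩
  | setNat r e => exact ⟨Polynomial.C (e.cost + 1), fun N => by rw [Polynomial.eval_C]; rfl⟩
  | setReal k j e =>
    exact ⟨Polynomial.C (j.cost + e.cost + 1), fun N => by rw [Polynomial.eval_C]; rfl⟩
  | seq P P' h h' =>
    obtain ⟨p, hp⟩ := h
    obtain ⟨p', hp'⟩ := h'
    exact ⟨p + p', fun N => by rw [Polynomial.eval_add, ← hp, ← hp']; rfl⟩
  | branch b P P' h h' =>
    obtain ⟨p, hp⟩ := h
    obtain ⟨p', hp'⟩ := h'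
    exact ⟨Polynomial.C b.cost + (p + p'), fun N => by
      rw [Polynomial.eval_add, Polynomial.eval_add, Polynomial.eval_C, ← hp, ← hp']; rfl⟩
  | loop b P h =>
    obtain ⟨p, hp⟩ := h
    exact ⟨Polynomial.X * (Polynomial.C b.cost + p) + Polynomial.C b.cost, fun N => by
      simp only [Polynomial.eval_add, Polynomial.eval_mul, Polynomial.eval_X, Polynomial.eval_C,
        ← hp]
      rfl⟩

/-- Started in `s`, the program `P` halts within `P.bound N` operations in a state satisfying
`post`. -/
def Wp (N : ℕ) (P : Program) (s : State) (post : State → Prop) : Prop :=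
  ∃ (s' : State) (t : ℕ), Runs P s s' t ∧ t ≤ P.bound N ∧ post s'

section Wp

variable {N : ℕ} {P P' : Program} {s : State} {post : State → Prop}

theorem Wp.mono {post' : State → Prop} (h : Wp N P s post) (hp : ∀ s', post s' → post' s') :
    Wp N P s post' := by
  obtain ⟨s', t, h1, h2, h3⟩ := h
  exact ⟨s', t, h1, h2, hp s' h3⟩

theorem Wp.skip (h : post s) : Wp N .skip s post := ⟨s, 1, .skip s, le_rfl, h⟩

theorem Wp.setNat {r : ℕ} {e : NExpr} (h : post (s.setN r (e.eval s))) :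
    Wp N (.setNat r e) s post := ⟨_, _, .setNat s r e, le_rfl, h⟩

theorem Wp.setReal {k : ℕ} {j : NExpr} {e : RExpr} (h : post (s.setR k (j.eval s) (e.eval s))) :
    Wp N (.setReal k j e) s post := ⟨_, _, .setReal s k j e, le_rfl, h⟩

theorem Wp.seq (h : Wp N P s fun s' => Wp N P' s' post) : Wp N (.seq P P') s post := by
  obtain ⟨s', t, h1, h2, s'', t', h3, h4, h5⟩ := h
  exact ⟨s'', t + t', .seq h1 h3, Nat.add_le_add h2 h4, h5⟩

theorem Wp.branch {b : Test} (h : b.Holds s → Wp N P s post) (h' : ¬ b.Holds s → Wp N P' s post) :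
    Wp N (.branch b P P') s post := by
  by_cases hb : b.Holds s
  · obtain ⟨s', t, h1, h2, h3⟩ := h hb
    refine ⟨s', _, .branchTrue hb h1, ?_, h3⟩
    simp only [Program.bound]; omega
  · obtain ⟨s', t, h1, h2, h3⟩ := h' hb
    refine ⟨s', _, .branchFalse hb h1, ?_, h3⟩
    simp only [Program.bound]; omega

/-- The invariant is indexed by the number of completed passes. Since the test can hold only while
this number is below `M`, at most `M ≤ N` passes are charged. -/
theorem Wp.loop {b : Test} {M : ℕ} (hM : M ≤ N) (I : ℕ → State → Prop) (h0 : I 0 s)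
    (hstep : ∀ k s, I k s → b.Holds s → k < M ∧ Wp N P s (I (k + 1)))
    (hdone : ∀ k s, I k s → ¬ b.Holds s → post s) : Wp N (.loop b P) s post := by
  have key : ∀ m k s, M = k + m → I k s → ∃ s' t, Runs (.loop b P) s s' t ∧
      t ≤ m * (b.cost + P.bound N) + b.cost ∧ post s' := by
    intro m
    induction m with
    | zero =>
      intro k s hk hI
      have hb : ¬ b.Holds s := fun hb => by have := (hstep k s hI hb).1; omega
      exact ⟨s, _, .loopDone hb, by omega, hdone k s hI hb⟩
    | succ m ih =>
      intro k s hk hI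
      by_cases hb : b.Holds s
      · obtain ⟨-, s', t, h1, h2, h3⟩ := hstep k s hI hb
        obtain ⟨s'', t', h4, h5, h6⟩ := ih (k + 1) s' (by omega) h3
        refine ⟨s'', _, .loopStep hb h1 h4, ?_, h6⟩
        rw [Nat.succ_mul]; omega
      · exact ⟨s, _, .loopDone hb, by omega, hdone k s hI hb⟩
  obtain ⟨s', t, h1, h2, h3⟩ := key M 0 s (by omega) h0
  refine ⟨s', t, h1, h2.trans ?_, h3⟩
  exact Nat.add_le_add_right (Nat.mul_le_mul_right _ hM) _

/-- `for r = 0, …, bd - 1 do P`. -/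
def forLoop (r : ℕ) (bd : NExpr) (P : Program) : Program :=
  .seq (.setNat r (.const 0))
    (.loop (.neg (.natLE bd (.reg r))) (.seq P (.setNat r (.add (.reg r) (.const 1)))))

/-- The bound `bd` is evaluated again before each pass, so the invariant must fix its value as well
as the counter. -/
theorem Wp.forLoop {r M : ℕ} {bd : NExpr} (hM : M ≤ N) (I : ℕ → State → Prop)
    (h0 : I 0 (s.setN r 0)) (hI : ∀ k s, I k s → s.nat r = k ∧ bd.eval s = M)
    (hstep : ∀ k s, k < M → I k s →
      Wp N P s fun s' => s'.nat r = k ∧ I (k + 1) (s'.setN r (k + 1)))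
    (hpost : ∀ s, I M s → post s) : Wp N (forLoop r bd P) s post := by
  refine Wp.seq (Wp.setNat (Wp.loop hM (fun k s => I k s ∧ k ≤ M) ⟨h0, Nat.zero_le _⟩ ?_ ?_))
  · rintro k s ⟨hk, -⟩ hb
    obtain ⟨e1, e2⟩ := hI k s hk
    have hlt : k < M := by
      simpa [Test.Holds, NExpr.eval, e1, e2] using hb
    refine ⟨hlt, Wp.seq ((hstep k s hlt hk).mono ?_)⟩
    rintro s' ⟨h1, h2⟩
    refine Wp.setNat ⟨?_, hlt⟩
    simpa [NExpr.eval, h1] using h2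
  · rintro k s ⟨hk, hle⟩ hb
    obtain ⟨e1, e2⟩ := hI k s hk
    have : M ≤ k := by simpa [Test.Holds, NExpr.eval, e1, e2] using hb
    obtain rfl : k = M := by omega
    exact hpost s hk

theorem Wp.haltsWith {p : Polynomial ℕ} {Q : (ℕ → ℝ) → Prop} (hp : ∀ N, P.bound N = p.eval N)
    (h : Wp N P s fun s' => Q (s'.real 2)) : HaltsWith P s (p.eval N) Q := by
  obtain ⟨s', t, h1, h2, h3⟩ := h
  exact ⟨s', t, h1, (hp N) ▸ h2, h3⟩

end Wp

section Expressions

instance : Add RExpr := ⟨.add⟩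
instance : Sub RExpr := ⟨.sub⟩
instance : Mul RExpr := ⟨.mul⟩
instance : Div RExpr := ⟨.div⟩

/-- Entry `j` of array `k`. -/
def rd (k j : ℕ) : RExpr := .read k (.const j)

/-- The entry of array `k` whose index is in register `r`. -/
def rdr (k r : ℕ) : RExpr := .read k (.reg r)

/-- With `|t| = √(t²)`, maxima and minima are expressions and need no branching. -/
def maxE (a b : RExpr) : RExpr := (a + b + .sqrt ((a - b) * (a - b))) / .const 2

def minE (a b : RExpr) : RExpr := (a + b - .sqrt ((a - b) * (a - b))) / .const 2

variable (s : State) (a b : RExpr)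

@[simp] theorem eval_add : (a + b).eval s = a.eval s + b.eval s := rfl
@[simp] theorem eval_sub : (a - b).eval s = a.eval s - b.eval s := rfl
@[simp] theorem eval_mul : (a * b).eval s = a.eval s * b.eval s := rfl
@[simp] theorem eval_div : (a / b).eval s = a.eval s / b.eval s := rfl
@[simp] theorem eval_sqrt : (RExpr.sqrt a).eval s = √(a.eval s) := rfl
@[simp] theorem eval_const (q : ℚ) : (RExpr.const q).eval s = q := rfl
@[simp] theorem eval_rd (k j : ℕ) : (rd k j).eval s = s.real k j := rfl
@[simp] theorem eval_rdr (k r : ℕ) : (rdr k r).eval s = s.real k (s.nat r) := rfl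
@[simp] theorem eval_nconst (m : ℕ) : (NExpr.const m).eval s = m := rfl
@[simp] theorem eval_reg (r : ℕ) : (NExpr.reg r).eval s = s.nat r := rfl
@[simp] theorem eval_nadd (c d : NExpr) : (NExpr.add c d).eval s = c.eval s + d.eval s := rfl
@[simp] theorem holds_natLE (c d : NExpr) : (Test.natLE c d).Holds s ↔ c.eval s ≤ d.eval s :=
  Iff.rfl
@[simp] theorem holds_realLE : (Test.realLE a b).Holds s ↔ a.eval s ≤ b.eval s := Iff.rfl
@[simp] theorem holds_neg (p : Test) : (Test.neg p).Holds s ↔ ¬ p.Holds s := Iff.rfl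

@[simp]
theorem eval_maxE : (maxE a b).eval s = max (a.eval s) (b.eval s) := by
  simp only [maxE, eval_div, eval_add, eval_sqrt, eval_mul, eval_sub, eval_const,
    Real.sqrt_mul_self_eq_abs]
  push_cast
  rcases le_total (a.eval s) (b.eval s) with h | h
  · rw [abs_of_nonpos (by linarith), max_eq_right h]; ring
  · rw [abs_of_nonneg (by linarith), max_eq_left h]; ring

@[simp]
theorem eval_minE : (minE a b).eval s = min (a.eval s) (b.eval s) := by
  simp only [minE, eval_div, eval_add, eval_sqrt, eval_mul, eval_sub, eval_const,
    Real.sqrt_mul_self_eq_abs]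
  push_cast
  rcases le_total (a.eval s) (b.eval s) with h | h
  · rw [abs_of_nonpos (by linarith), min_eq_left h]; ring
  · rw [abs_of_nonneg (by linarith), min_eq_right h]; ring

end Expressions

end RealRAM

end

/-! ### Evaluating the objective and comparing candidates -/

noncomputable section

namespace Newsvendor

open RealRAM

variable {n : ℕ}

/-- The data `D`, the argument `ξ` and the argument `Q` are in their places. -/
structure Ctx (D : Newsvendor n) (ξ Q : ℝ) (s : State) : Prop where
  n : s.nat 0 = n
  x : s.real 0 = D.xs
  c₁ : s.real 1 0 = D.c₁
  c₂ : s.real 1 1 = D.c₂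
  δ : s.real 1 2 = D.δ
  μ : s.real 1 3 = D.μ
  σ : s.real 1 4 = D.σ
  ξ : s.real 20 0 = ξ
  Q : s.real 30 0 = Q

variable {D : Newsvendor n} {ξ Q : ℝ} {s s' : State}

theorem Ctx.frame (h : Ctx D ξ Q s) {R A : Finset ℕ} (hf : Frame R A s s') (h0 : 0 ∉ R)
    (ha : 0 ∉ A) (hb : 1 ∉ A) (hc : 20 ∉ A) (hd : 30 ∉ A) : Ctx D ξ Q s' where
  n := by rw [hf.nat 0 h0, h.n]
  x := by rw [hf.real 0 ha, h.x]
  c₁ := by rw [hf.real 1 hb, h.c₁]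
  c₂ := by rw [hf.real 1 hb, h.c₂]
  δ := by rw [hf.real 1 hb, h.δ]
  μ := by rw [hf.real 1 hb, h.μ]
  σ := by rw [hf.real 1 hb, h.σ]
  ξ := by rw [hf.real 20 hc, h.ξ]
  Q := by rw [hf.real 30 hd, h.Q]

/-- The expression for `σ² + μ²`. -/
def smE : RExpr := rd 1 4 * rd 1 4 + rd 1 3 * rd 1 3

theorem Ctx.eval_smE (h : Ctx D ξ Q s) : smE.eval s = D.sm := by
  simp [smE, sm, h.σ, h.μ]; ring

/-- The expression for `phi` at `b`. -/
def phiE (b : RExpr) : RExpr :=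
  let u := maxE (b + rd 1 0 / .const 2) (.const 0)
  let v := maxE (b - rd 1 1 / .const 2) (.const 0)
  maxE (u * u / rd 20 0 - rd 1 0 * rd 30 0) (rd 1 1 * rd 30 0 + v * v / rd 20 0)

theorem Ctx.eval_phiE (h : Ctx D ξ Q s) (b : RExpr) :
    (phiE b).eval s = phi D.c₁ D.c₂ Q ξ (b.eval s) := by
  simp [phiE, phi, h.c₁, h.c₂, h.ξ, h.Q]
  ring_nf

/-- Evaluates the objective at the point stored in array `4`. -/
def evalObj : Program :=
  .seq (.setReal 3 (.const 0) (.const 0)) <|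
  .seq (.setReal 3 (.const 1) (.const 0)) <|
  .seq (forLoop 1 (.reg 0) <|
    .seq (.setReal 3 (.const 0) (rd 3 0 + (phiE (rd 4 0 * rdr 0 1 - rd 4 1 / .const 2)
      - rd 4 0 * (rdr 0 1 * rdr 0 1))))
    -- The sample size is counted again as a real number: an index cannot be used in real
    -- arithmetic.
    (.setReal 3 (.const 1) (rd 3 1 + .const 1))) <|
  .setReal 3 (.const 0) (rd 4 0 * rd 1 2 + rd 4 1 * rd 1 3 + (rd 20 0 - rd 4 0) * smE
    + rd 3 0 / rd 3 1)

theorem obj_eq_sum_range (D : Newsvendor n) (ξ Q l₁ l₂ : ℝ) :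
    D.obj ξ Q l₁ l₂ = l₁ * D.δ + l₂ * D.μ + (ξ - l₁) * D.sm
      + (∑ i ∈ Finset.range n, (phi D.c₁ D.c₂ Q ξ (l₁ * D.xs i - l₂ / 2)
        - l₁ * (D.xs i * D.xs i))) / n := by
  rw [obj, Finset.sum_range, mul_comm (n : ℝ)⁻¹, ← div_eq_mul_inv]
  congr 2
  refine Finset.sum_congr rfl fun i _ => ?_
  rw [xs_fin]; ring

theorem wp_evalObj {N : ℕ} (hN : 3 * n + 4 ≤ N) (h : Ctx D ξ Q s) :
    Wp N evalObj s fun s' => Frame {1} {3} s s' ∧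
      s'.real 3 0 = D.obj ξ Q (s.real 4 0) (s.real 4 1) := by
  refine .seq (.setReal (.seq (.setReal (.seq ?_))))
  refine .forLoop (M := n) (by omega) (fun k s' => Frame {1} {3} s s' ∧ s'.nat 1 = k ∧
    s'.real 3 0 = ∑ i ∈ Finset.range k, (phi D.c₁ D.c₂ Q ξ (s.real 4 0 * D.xs i - s.real 4 1 / 2)
        - s.real 4 0 * (D.xs i * D.xs i)) ∧ s'.real 3 1 = k) ?_ ?_ ?_ ?_
  · refine ⟨((((Frame.refl s).setR (by simp) _ _).setR (by simp) _ _).setN (by simp) _), ?_⟩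
    simp
  · rintro k s' ⟨hf, hk, -, -⟩
    have hc := h.frame hf (by simp) (by simp) (by simp) (by simp) (by simp)
    exact ⟨hk, hc.n⟩
  · rintro k s' hk ⟨hf, hk', h1, h2⟩
    have hc := h.frame hf (by simp) (by simp) (by simp) (by simp) (by simp)
    refine .seq (.setReal (.setReal ⟨by simpa using hk', ?_, ?_, ?_, ?_⟩))
    · exact (((hf.setR (by simp) _ _).setR (by simp) _ _).setN (by simp) _)
    · simp
    · have h4 := hf.real 4 (by simp)
      simp [hc.eval_phiE, Finset.sum_range_succ, h1, h4, hk', hc.x]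
      ring
    · simp [h2]
  · rintro s' ⟨hf, hk', h1, h2⟩
    have hc := h.frame hf (by simp) (by simp) (by simp) (by simp) (by simp)
    refine .setReal ⟨hf.setR (by simp) _ _, ?_⟩
    have h4 := hf.real 4 (by simp)
    rw [obj_eq_sum_range]
    simp [hc.eval_smE, h1, h2, h4, hc.δ, hc.μ, hc.ξ]

/-- Array `2` holds the value and the coordinates of a feasible point that is at least as good as
all points in `S`. -/
structure Best (D : Newsvendor n) (ξ Q : ℝ) (S : Set (ℝ × ℝ)) (s : State) : Prop where
  nonneg : 0 ≤ s.real 2 1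
  val : s.real 2 0 = D.obj ξ Q (s.real 2 1) (s.real 2 2)
  le : ∀ w ∈ S, s.real 2 0 ≤ D.obj ξ Q w.1 w.2

theorem Best.congr {S : Set (ℝ × ℝ)} (h : Best D ξ Q S s) (he : s'.real 2 = s.real 2) :
    Best D ξ Q S s' :=
  ⟨by rw [he]; exact h.nonneg, by rw [he]; exact h.val, by rw [he]; exact h.le⟩

/-- Compares the point stored in array `4` with the best point found so far. -/
def tryPoint : Program :=
  .seq evalObj <|
  .branch (.realLE (rd 3 0) (rd 2 0))
    (.seq (.setReal 2 (.const 0) (rd 3 0)) <|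
      .seq (.setReal 2 (.const 1) (rd 4 0)) <| .setReal 2 (.const 2) (rd 4 1))
    .skip

theorem wp_tryPoint {N : ℕ} (hN : 3 * n + 4 ≤ N) (h : Ctx D ξ Q s) {S : Set (ℝ × ℝ)}
    (hb : Best D ξ Q S s) (h0 : 0 ≤ s.real 4 0) :
    Wp N tryPoint s fun s' => Frame {1} {2, 3} s s' ∧
      Best D ξ Q (insert (s.real 4 0, s.real 4 1) S) s' := by
  refine .seq ((wp_evalObj hN h).mono ?_)
  rintro s₁ ⟨hf, hv⟩
  have h2 := hf.real 2 (by simp)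
  have h4 := hf.real 4 (by simp)
  have hf' : Frame {1} {2, 3} s s₁ := hf.mono (by simp) (by simp)
  have hb₁ := hb.congr h2
  refine .branch (fun hle => .seq (.setReal (.seq (.setReal (.setReal ⟨?_, ?_⟩)))))
    (fun hle => .skip ⟨hf', ?_⟩)
  · exact ((hf'.setR (by simp) _ _).setR (by simp) _ _).setR (by simp) _ _
  · rw [holds_realLE, eval_rd, eval_rd, hv] at hle
    refine ⟨by simpa [h4] using h0, by simp [hv, h4], ?_⟩
    intro w hw
    simp only [eval_rd, eval_nconst, State.setR_real, hv]
    rcases hw with rfl | hw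
    · simp
    · simpa using hle.trans (hb₁.le w hw)
  · rw [holds_realLE, eval_rd, eval_rd, hv] at hle
    refine ⟨hb₁.nonneg, hb₁.val, ?_⟩
    rintro w (rfl | hw)
    · exact (not_le.1 hle).le
    · exact hb₁.le w hw

/-- The first `m` entries of the arrays `6`, `7` and `8` hold the coefficients of `ρ`. -/
def RowsOK (ρ : ℕ → Aff) (m : ℕ) (s : State) : Prop :=
  ∀ e, e < m → s.real 6 e = (ρ e).a ∧ s.real 7 e = (ρ e).b ∧ s.real 8 e = (ρ e).c

theorem RowsOK.frame {ρ : ℕ → Aff} {m : ℕ} (h : RowsOK ρ m s) {R A : Finset ℕ}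
    (hf : Frame R A s s') (h6 : 6 ∉ A) (h7 : 7 ∉ A) (h8 : 8 ∉ A) : RowsOK ρ m s' := by
  intro e he
  rw [hf.real 6 h6, hf.real 7 h7, hf.real 8 h8]
  exact h e he

/-- The index expression for `3 n + 4`. -/
def cntE : NExpr := .add (.add (.add (.reg 0) (.reg 0)) (.reg 0)) (.const 4)

theorem Ctx.eval_cntE (h : Ctx D ξ Q s) : cntE.eval s = 3 * n + 4 := by
  simp [cntE, h.n]; omega

/-- Tries the intersection of the two lines with indices in registers `3` and `2`. -/
def tryPair : Program :=
  let d := rdr 6 3 * rdr 7 2 - rdr 6 2 * rdr 7 3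
  .seq (.setReal 4 (.const 0)
    (maxE ((rdr 7 3 * rdr 8 2 - rdr 7 2 * rdr 8 3) / d) (.const 0))) <|
  .seq (.setReal 4 (.const 1) ((rdr 8 3 * rdr 6 2 - rdr 8 2 * rdr 6 3) / d)) tryPoint

theorem wp_tryPair {N : ℕ} (hN : 3 * n + 4 ≤ N) (h : Ctx D ξ Q s) {S : Set (ℝ × ℝ)}
    (hb : Best D ξ Q S s) {ρ : ℕ → Aff} {m : ℕ} (hρ : RowsOK ρ m s) (h3 : s.nat 3 < m)
    (h2 : s.nat 2 < m) :
    Wp N tryPair s fun s' => Frame {1} {2, 3, 4} s s' ∧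
      Best D ξ Q (insert (meet (ρ (s.nat 3)) (ρ (s.nat 2))) S) s' := by
  obtain ⟨a1, b1, c1⟩ := hρ _ h3
  obtain ⟨a2, b2, c2⟩ := hρ _ h2
  refine .seq (.setReal (.seq (.setReal ?_)))
  set s₁ := State.setR _ _ _ _ with hs₁
  have hf : Frame {1} {2, 3, 4} s s₁ :=
    ((Frame.refl s).setR (by simp) _ _).setR (by simp) _ _
  have hc := h.frame hf (by simp) (by simp) (by simp) (by simp) (by simp)
  have e0 : s₁.real 4 0 = (meet (ρ (s.nat 3)) (ρ (s.nat 2))).1 := by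
    simp [hs₁, meet, a1, b1, c1, a2, b2, c2]
  have e1 : s₁.real 4 1 = (meet (ρ (s.nat 3)) (ρ (s.nat 2))).2 := by
    simp [hs₁, meet, a1, b1, c1, a2, b2, c2]
  have hb₁ : Best D ξ Q S s₁ := hb.congr (by
    rw [hs₁, State.setR_real_ne _ (by simp), State.setR_real_ne _ (by simp)])
  refine (wp_tryPoint hN hc hb₁ (by rw [e0]; exact le_max_right _ _)).mono ?_
  rintro s₂ ⟨hf₂, hb₂⟩
  rw [e0, e1] at hb₂
  exact ⟨hf.trans (hf₂.mono (by simp) (by decide)), hb₂⟩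

/-- The rule shared by all nested search loops: pass `k` adds the points `T k` to those already
beaten. `K` collects the facts about memory that survive every pass and the change of the counter.
-/
theorem wp_forLoop_best {N r M : ℕ} {bd : NExpr} {P : Program} {R A : Finset ℕ}
    {T : ℕ → Set (ℝ × ℝ)} {S : Set (ℝ × ℝ)} {K : State → Prop} (hM : M ≤ N) (hr : r ∉ R)
    (hK : ∀ s' s'', K s' → Frame (insert r R) A s' s'' → K s'') (hbd : ∀ s', K s' → bd.eval s' = M)
    (hs : K s) (hb : Best D ξ Q S s)
    (hbody : ∀ (s' : State) (S' : Set (ℝ × ℝ)), s'.nat r < M → K s' → Best D ξ Q S' s' →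
      Wp N P s' fun s'' => Frame R A s' s'' ∧ Best D ξ Q (S' ∪ T (s'.nat r)) s'') :
    Wp N (forLoop r bd P) s fun s' => Frame (insert r R) A s s' ∧
      Best D ξ Q (S ∪ {w | ∃ k, k < M ∧ w ∈ T k}) s' := by
  refine .forLoop hM (fun k s' => Frame (insert r R) A s s' ∧ s'.nat r = k ∧
    Best D ξ Q (S ∪ {w | ∃ j, j < k ∧ w ∈ T j}) s') ?_ ?_ ?_ ?_
  · refine ⟨(Frame.refl s).setN (by simp) _, by simp, ?_⟩
    have : Best D ξ Q S (s.setN r 0) := hb.congr rfl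
    simpa using this
  · rintro k s' ⟨hf, hk, -⟩
    exact ⟨hk, hbd s' (hK _ _ hs hf)⟩
  · rintro k s' hk ⟨hf, hk', hb'⟩
    refine (hbody s' _ (by omega) (hK _ _ hs hf) hb').mono ?_
    rintro s'' ⟨hf', hb''⟩
    refine ⟨by rw [hf'.nat r hr, hk'], ?_, by simp, ?_⟩
    · exact (hf.trans (hf'.mono (Finset.subset_insert _ _) subset_rfl)).setN (by simp) _
    · have h1 : Best D ξ Q ((S ∪ {w | ∃ j, j < k ∧ w ∈ T j}) ∪ T (s'.nat r)) (s''.setN r (k + 1)) :=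
        hb''.congr rfl
      refine ⟨h1.nonneg, h1.val, fun w hw => h1.le w ?_⟩
      rw [hk']
      rcases hw with hw | ⟨j, hj, hw⟩
      · exact Or.inl (Or.inl hw)
      · rcases Nat.lt_succ_iff_lt_or_eq.1 hj with hj | rfl
        · exact Or.inl (Or.inr ⟨j, hj, hw⟩)
        · exact Or.inr hw
  · rintro s' ⟨hf, -, hb'⟩
    exact ⟨hf, hb'⟩

/-- Tries all intersections of two of the lines. -/
def tryPairs : Program := forLoop 3 cntE (forLoop 2 cntE tryPair)

theorem wp_tryPairs {N : ℕ} (hN : 3 * n + 4 ≤ N) (h : Ctx D ξ Q s) {S : Set (ℝ × ℝ)}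
    (hb : Best D ξ Q S s) {ρ : ℕ → Aff} (hρ : RowsOK ρ (3 * n + 4) s) :
    Wp N tryPairs s fun s' => Frame {3, 2, 1} {2, 3, 4} s s' ∧
      Best D ξ Q (S ∪ {w | ∃ e₁, e₁ < 3 * n + 4 ∧
        ∃ e₂, e₂ < 3 * n + 4 ∧ w = meet (ρ e₁) (ρ e₂)}) s' := by
  refine wp_forLoop_best (T := fun e₁ => {w | ∃ e₂, e₂ < 3 * n + 4 ∧ w = meet (ρ e₁) (ρ e₂)})
    (K := fun s' => Ctx D ξ Q s' ∧ RowsOK ρ (3 * n + 4) s') hN (by simp) ?_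
    (fun s' hs' => hs'.1.eval_cntE) ⟨h, hρ⟩ hb ?_
  · rintro s' s'' ⟨h1, h2⟩ hf
    exact ⟨h1.frame hf (by simp) (by simp) (by simp) (by simp) (by simp),
      h2.frame hf (by simp) (by simp) (by simp)⟩
  · rintro s₁ S₁ h3 ⟨hc₁, hρ₁⟩ hb₁
    refine (wp_forLoop_best (T := fun e₂ => {w | w = meet (ρ (s₁.nat 3)) (ρ e₂)})
      (K := fun s' => Ctx D ξ Q s' ∧ RowsOK ρ (3 * n + 4) s' ∧ s'.nat 3 = s₁.nat 3)
      (R := {1}) (A := {2, 3, 4}) hN (by simp) ?_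
      (fun s' hs' => hs'.1.eval_cntE) ⟨hc₁, hρ₁, rfl⟩ hb₁ ?_)
    · rintro s' s'' ⟨h1, h2, h3⟩ hf
      exact ⟨h1.frame hf (by simp) (by simp) (by simp) (by simp) (by simp),
        h2.frame hf (by simp) (by simp) (by simp), by rw [hf.nat 3 (by simp), h3]⟩
    · rintro s₂ S₂ h2 ⟨hc₂, hρ₂, h3'⟩ hb₂
      refine (wp_tryPair hN hc₂ hb₂ hρ₂ (by omega) h2).mono ?_
      rintro s₃ ⟨hf, hb₃⟩
      refine ⟨hf, hb₃.nonneg, hb₃.val, ?_⟩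
      rintro w (hw | hw)
      · exact hb₃.le w (Or.inr hw)
      · refine hb₃.le w (Or.inl ?_)
        rw [h3']; exact hw

end Newsvendor

end

/-! ### The program for the exact minimum at fixed `ξ` and `Q` -/

noncomputable section

namespace Newsvendor

open RealRAM

variable {n : ℕ} {D : Newsvendor n} {ξ Q : ℝ} {s s' : State}

/-- Stores the type of the piece attached to observation `i` (register `4`) in array `11`. -/
def setPiece : Program :=
  .branch (.realLE (rdr 0 4) (rd 5 0))
    (.branch (.realLE (rdr 0 4) (rd 5 1))
      (.seq (.setReal 11 (.const 0) (.const 0)) (.setReal 11 (.const 1) (.const 0)))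
      (.seq (.setReal 11 (.const 0) (.const 1))
        (.setReal 11 (.const 1) (.const 0 - rd 1 1 / .const 2))))
    (.seq (.setReal 11 (.const 0) (.const 1)) (.setReal 11 (.const 1) (rd 1 0 / .const 2)))

theorem wp_setPiece {N : ℕ} (h : Ctx D ξ Q s) :
    Wp N setPiece s fun s' => Frame ∅ {11} s s' ∧
      s'.real 11 0 = wt (s.real 5 0) (s.real 5 1) (D.xs (s.nat 4)) ∧
      s'.real 11 1 = D.shift (s.real 5 0) (s.real 5 1) (D.xs (s.nat 4)) := by
  have fr : ∀ u v : ℝ, Frame ∅ {11} s ((s.setR 11 0 u).setR 11 1 v) := fun u v =>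
    ((Frame.refl s).setR (by simp) _ _).setR (by simp) _ _
  refine .branch (fun h1 => .branch (fun h2 => .seq (.setReal (.setReal ⟨fr _ _, ?_⟩)))
    (fun h2 => .seq (.setReal (.setReal ⟨fr _ _, ?_⟩))))
    (fun h1 => .seq (.setReal (.setReal ⟨fr _ _, ?_⟩)))
  · simp [h.x] at h1 h2
    simp [wt, shift, h1, h2]
  · simp [h.x] at h1 h2
    simp [wt, shift, h1, h2, h.c₂]
  · simp [h.x] at h1
    simp [wt, shift, h1, h.c₁]

/-- Computes the second order data of the cell described by the thresholds in array `5`. -/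
def setQuad : Program :=
  .seq (.setReal 9 (.const 0) (.const 0)) <|
  .seq (.setReal 9 (.const 1) (.const 0)) <|
  .seq (.setReal 9 (.const 2) (.const 0)) <|
  .seq (.setReal 9 (.const 3) (.const 0)) <|
  .seq (.setReal 9 (.const 4) (.const 0)) <|
  forLoop 4 (.reg 0) <|
    .seq setPiece <|
    .seq (.setReal 9 (.const 0)
      (rd 9 0 + .const 2 * rd 11 0 * (rdr 0 4 * rdr 0 4) / rd 20 0)) <|
    .seq (.setReal 9 (.const 1) (rd 9 1 - rd 11 0 * rdr 0 4 / rd 20 0)) <|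
    .seq (.setReal 9 (.const 2) (rd 9 2 + rd 11 0 / (.const 2 * rd 20 0))) <|
    .seq (.setReal 9 (.const 3) (rd 9 3 + (rd 1 2 - smE - rdr 0 4 * rdr 0 4
      + .const 2 * rd 11 0 * rd 11 1 * rdr 0 4 / rd 20 0))) <|
    .setReal 9 (.const 4) (rd 9 4 + (rd 1 3 - rd 11 0 * rd 11 1 / rd 20 0))

/-- Array `9` holds the second order data `q`. -/
structure QuadOK (q : Quad) (s : State) : Prop where
  p₁₁ : s.real 9 0 = q.p₁₁
  p₁₂ : s.real 9 1 = q.p₁₂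
  p₂₂ : s.real 9 2 = q.p₂₂
  r₁ : s.real 9 3 = q.r₁
  r₂ : s.real 9 4 = q.r₂

theorem QuadOK.congr {q : Quad} (h : QuadOK q s) (he : s'.real 9 = s.real 9) : QuadOK q s' := by
  constructor <;> rw [he]
  exacts [h.p₁₁, h.p₁₂, h.p₂₂, h.r₁, h.r₂]

/-- The contribution of the first `k` observations to `quad`. -/
def quadTo (D : Newsvendor n) (ξ t₁ t₂ : ℝ) (k : ℕ) : Quad where
  p₁₁ := ∑ i ∈ Finset.range k, 2 * wt t₁ t₂ (D.xs i) * D.xs i ^ 2 / ξ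
  p₁₂ := ∑ i ∈ Finset.range k, -(wt t₁ t₂ (D.xs i) * D.xs i / ξ)
  p₂₂ := ∑ i ∈ Finset.range k, wt t₁ t₂ (D.xs i) / (2 * ξ)
  r₁ := ∑ i ∈ Finset.range k, (D.δ - D.sm - D.xs i ^ 2
    + 2 * wt t₁ t₂ (D.xs i) * D.shift t₁ t₂ (D.xs i) * D.xs i / ξ)
  r₂ := ∑ i ∈ Finset.range k, (D.μ - wt t₁ t₂ (D.xs i) * D.shift t₁ t₂ (D.xs i) / ξ)

theorem wp_setQuad {N : ℕ} (hN : 3 * n + 4 ≤ N) (h : Ctx D ξ Q s) :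
    Wp N setQuad s fun s' => Frame {4} {9, 11} s s' ∧
      QuadOK (D.quad ξ (s.real 5 0) (s.real 5 1)) s' := by
  refine .seq (.setReal (.seq (.setReal (.seq (.setReal (.seq (.setReal (.seq (.setReal ?_)))))))))
  refine .forLoop (M := n) (by omega) (fun k s' => Frame {4} {9, 11} s s' ∧ s'.nat 4 = k ∧
    QuadOK (D.quadTo ξ (s.real 5 0) (s.real 5 1) k) s') ?_ ?_ ?_ ?_
  · refine ⟨((((((Frame.refl s).setR (by simp) _ _).setR (by simp) _ _).setR (by simp) _ _).setR
      (by simp) _ _).setR (by simp) _ _).setN (by simp) _, by simp, ?_⟩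
    constructor <;> simp [quadTo]
  · rintro k s' ⟨hf, hk, -⟩
    have hc := h.frame hf (by simp) (by simp) (by simp) (by simp) (by simp)
    exact ⟨hk, hc.n⟩
  · rintro k s' hk ⟨hf, hk', hq⟩
    have hc := h.frame hf (by simp) (by simp) (by simp) (by simp) (by simp)
    refine .seq ((wp_setPiece hc).mono ?_)
    rintro s₁ ⟨hf₁, hw, he⟩
    have h5 := hf.real 5 (by simp)
    have h4 : s₁.nat 4 = k := by rw [hf₁.nat 4 (by simp), hk']
    rw [h5, hk'] at hw he
    have hc₁ := hc.frame hf₁ (by simp) (by simp) (by simp) (by simp) (by simp)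
    have hq₁ := hq.congr (hf₁.real 9 (by simp))
    refine .seq (.setReal (.seq (.setReal (.seq (.setReal (.seq (.setReal (.setReal
      ⟨by simpa using h4, ?_, by simp, ?_⟩))))))))
    · exact ((((((hf.trans (hf₁.mono (by simp) (by simp))).setR (by simp) _ _).setR (by simp) _ _).setR (by simp) _ _).setR
        (by simp) _ _).setR (by simp) _ _).setN (by simp) _
    · constructor <;>
        simp [quadTo, Finset.sum_range_succ, hq₁.p₁₁, hq₁.p₁₂, hq₁.p₂₂, hq₁.r₁, hq₁.r₂, h4, hc₁.x,
          hw, he, hc₁.ξ, hc₁.δ, hc₁.μ, hc₁.σ, smE, sm] <;> ring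
  · rintro s' ⟨hf, -, hq⟩
    exact ⟨hf, hq⟩

/-- Stores the coefficients of an affine function as entry `j` of the list of rows. -/
def putRow (j : NExpr) (a b c : RExpr) : Program :=
  .seq (.setReal 6 j a) (.seq (.setReal 7 j b) (.setReal 8 j c))

/-- The index and the coefficients are evaluated in turn, after earlier writes. Hence `hj` is
required in all states reachable by changing only the row arrays. -/
theorem wp_putRow {N m : ℕ} {ρ : ℕ → Aff} {j : NExpr} {a b c : RExpr} (hρ : RowsOK ρ m s)
    (hj : ∀ s', Frame {4} {6, 7, 8} s s' → s'.nat = s.nat → j.eval s' = m ∧ a.eval s' = (ρ m).a ∧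
      b.eval s' = (ρ m).b ∧ c.eval s' = (ρ m).c) :
    Wp N (putRow j a b c) s fun s' => Frame {4} {6, 7, 8} s s' ∧ s'.nat = s.nat ∧
      RowsOK ρ (m + 1) s' := by
  have f0 : Frame {4} {6, 7, 8} s s := Frame.refl s
  have f1 := fun v => f0.setR (k := 6) (by simp) m v
  have f2 := fun v w => (f1 v).setR (k := 7) (by simp) m w
  obtain ⟨j0, a0, -, -⟩ := hj s f0 rfl
  obtain ⟨j1, -, b1, -⟩ := hj _ (f1 (ρ m).a) rfl
  obtain ⟨j2, -, -, c2⟩ := hj _ (f2 (ρ m).a (ρ m).b) rfl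
  refine .seq (.setReal (.seq (.setReal (.setReal ?_))))
  rw [j0, a0, j1, b1, j2, c2]
  refine ⟨(f2 _ _).setR (by simp) _ _, rfl, fun e he => ?_⟩
  by_cases hem : e = m
  · subst hem; simp
  · have := hρ e (by omega)
    simpa [hem] using this

/-- The index expression for `3 i + 4 + m`. -/
def idxE (m : ℕ) : NExpr := .add (.add (.add (.reg 4) (.reg 4)) (.reg 4)) (.const (m + 4))

/-- Builds the list of the affine functions whose intersections are tried. -/
def setRows : Program :=
  .seq (putRow (.const 0) (rd 9 0) (rd 9 1) (rd 9 3)) <|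
  .seq (putRow (.const 1) (rd 9 1) (rd 9 2) (rd 9 4)) <|
  .seq (putRow (.const 2) (.const 1) (.const 0) (.const 0)) <|
  .seq (putRow (.const 3) (.const 0 - rd 9 1) (.const 0 - rd 9 2) (.const 0 - rd 9 4)) <|
  forLoop 4 (.reg 0) <|
    .seq (putRow (idxE 0) (rdr 0 4) (.const (-1 / 2)) (.const 0 - rd 10 0)) <|
    .seq (putRow (idxE 1) (rdr 0 4) (.const (-1 / 2)) (.const 0 - rd 1 1 / .const 2)) <|
    putRow (idxE 2) (.const (-1 / 2) * rd 9 0 - rdr 0 4 * rd 9 1)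
      (.const (-1 / 2) * rd 9 1 - rdr 0 4 * rd 9 2) (.const (-1 / 2) * rd 9 3 - rdr 0 4 * rd 9 4)

theorem wp_setRows {N : ℕ} (hN : 3 * n + 4 ≤ N) (h : Ctx D ξ Q s) {t₁ t₂ : ℝ}
    (hq : QuadOK (D.quad ξ t₁ t₂) s) (hβ : s.real 10 0 = brk D.c₁ D.c₂ Q ξ) :
    Wp N setRows s fun s' => Frame {4} {6, 7, 8} s s' ∧
      RowsOK (D.rows ξ Q t₁ t₂) (3 * n + 4) s' := by
  have frq : ∀ {s'}, Frame {4} {6, 7, 8} s s' → QuadOK (D.quad ξ t₁ t₂) s' := fun hf =>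
    hq.congr (hf.real 9 (by simp))
  refine .seq ((wp_putRow (ρ := D.rows ξ Q t₁ t₂) (m := 0) (fun e he => by omega) ?_).mono ?_)
  · intro s' hf _
    have := frq hf
    simp [rows, Quad.grad₁, this.p₁₁, this.p₁₂, this.r₁]
  rintro s₁ ⟨f₁, -, r₁⟩
  refine .seq ((wp_putRow r₁ ?_).mono ?_)
  · intro s' hf _
    have := frq (f₁.trans hf)
    simp [rows, Quad.grad₂, this.p₁₂, this.p₂₂, this.r₂]
  rintro s₂ ⟨f₂, -, r₂⟩
  replace f₂ := f₁.trans f₂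
  refine .seq ((wp_putRow r₂ ?_).mono ?_)
  · intro s' hf _
    simp [rows]
  rintro s₃ ⟨f₃, -, r₃⟩
  replace f₃ := f₂.trans f₃
  refine .seq ((wp_putRow r₃ ?_).mono ?_)
  · intro s' hf _
    have := frq (f₃.trans hf)
    simp [rows, Quad.along, this.p₁₂, this.p₂₂, this.r₂]
  rintro s₄ ⟨f₄, -, r₄⟩
  replace f₄ := f₃.trans f₄
  refine .forLoop (M := n) (by omega) (fun k s' => Frame {4} {6, 7, 8} s s' ∧ s'.nat 4 = k ∧
    RowsOK (D.rows ξ Q t₁ t₂) (3 * k + 4) s') ?_ ?_ ?_ ?_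
  · exact ⟨f₄.setN (by simp) _, by simp, fun e he => r₄ e he⟩
  · rintro k s' ⟨hf, hk, -⟩
    have hc := h.frame hf (by simp) (by simp) (by simp) (by simp) (by simp)
    exact ⟨hk, hc.n⟩
  · rintro k s' hk ⟨hf, hk', hr⟩
    have idx : ∀ (m : ℕ) (s'' : State), s''.nat 4 = k → (idxE m).eval s'' = 3 * k + m + 4 := by
      intro m s'' h4
      simp [idxE, h4]; omega
    have row0 : D.rows ξ Q t₁ t₂ (3 * k + 4) = ⟨D.xs k, -1 / 2, -brk D.c₁ D.c₂ Q ξ⟩ := by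
      rw [rows, if_pos (by omega), show 3 * k / 3 = k by omega]
    have row1 : D.rows ξ Q t₁ t₂ (3 * k + 4 + 1) = ⟨D.xs k, -1 / 2, -(D.c₂ / 2)⟩ := by
      rw [show 3 * k + 4 + 1 = 3 * k + 1 + 4 by omega, rows, if_neg (by omega),
        if_pos (by omega), show (3 * k + 1) / 3 = k by omega]
    have row2 : D.rows ξ Q t₁ t₂ (3 * k + 4 + 1 + 1)
        = (D.quad ξ t₁ t₂).along ⟨D.xs k, -1 / 2, 0⟩ := by
      rw [show 3 * k + 4 + 1 + 1 = 3 * k + 2 + 4 by omega, rows, if_neg (by omega),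
        if_neg (by omega), show (3 * k + 2) / 3 = k by omega]
    refine .seq ((wp_putRow hr ?_).mono ?_)
    · intro s'' hf' hn
      have hf'' := hf.trans hf'
      have hc := h.frame hf'' (by simp) (by simp) (by simp) (by simp) (by simp)
      have h10 := hf''.real 10 (by simp)
      have h4 : s''.nat 4 = k := by rw [hn, hk']
      simp [row0, idx _ _ h4, h4, hc.x, h10, hβ]
    rintro s₅ ⟨f₅, n₅, r₅⟩
    replace f₅ := hf.trans f₅
    rw [← n₅] at hk'
    refine .seq ((wp_putRow r₅ ?_).mono ?_)
    · intro s'' hf' hn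
      have hf'' := f₅.trans hf'
      have hc := h.frame hf'' (by simp) (by simp) (by simp) (by simp) (by simp)
      have h4 : s''.nat 4 = k := by rw [hn, hk']
      simp [row1, idx _ _ h4, h4, hc.x, hc.c₂]
    rintro s₆ ⟨f₆, n₆, r₆⟩
    replace f₆ := f₅.trans f₆
    rw [← n₆] at hk'
    refine (wp_putRow r₆ ?_).mono ?_
    · intro s'' hf' hn
      have hf'' := f₆.trans hf'
      have hc := h.frame hf'' (by simp) (by simp) (by simp) (by simp) (by simp)
      have h4 : s''.nat 4 = k := by rw [hn, hk']
      have := frq hf''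
      simp [row2, idx _ _ h4, h4, hc.x, this.p₁₁, this.p₁₂, this.p₂₂, this.r₁, this.r₂, Quad.along]
    rintro s₇ ⟨f₇, n₇, r₇⟩
    rw [← n₇] at hk'
    refine ⟨hk', (f₆.trans f₇).setN (by simp) _, by simp, ?_⟩
    rw [show 3 * (k + 1) + 4 = 3 * k + 4 + 1 + 1 + 1 by omega]
    exact fun e he => r₇ e he
  · rintro s' ⟨hf, -, hr⟩
    exact ⟨hf, hr⟩

/-- Stores the threshold whose index is in register `r` as entry `j` of array `5`. -/
def setThr (j r : ℕ) : Program :=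
  .branch (.natLE (.reg 0) (.reg r)) (.setReal 5 (.const j) (.const (-1)))
    (.setReal 5 (.const j) (rdr 0 r))

theorem wp_setThr {N j r : ℕ} (h : Ctx D ξ Q s) :
    Wp N (setThr j r) s fun s' => s' = s.setR 5 j (D.thr (s.nat r)) := by
  refine .branch (fun h1 => .setReal ?_) (fun h1 => .setReal ?_)
  · simp [h.n] at h1
    simp [thr, h1]
  · simp [h.n] at h1
    simp [thr, not_le.2 h1, h.x]

/-- Tries all candidates belonging to the cell with indices in registers `6` and `5`. -/
def tryCell : Program :=
  .seq (setThr 0 6) <| .seq (setThr 1 5) <| .seq setQuad <| .seq setRows tryPairs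

theorem wp_tryCell {N : ℕ} (hN : 3 * n + 4 ≤ N) (h : Ctx D ξ Q s) {S : Set (ℝ × ℝ)}
    (hb : Best D ξ Q S s) (hβ : s.real 10 0 = brk D.c₁ D.c₂ Q ξ) :
    Wp N tryCell s fun s' => Frame {1, 2, 3, 4} {2, 3, 4, 5, 6, 7, 8, 9, 11} s s' ∧
      Best D ξ Q (S ∪ {w | ∃ e₁, e₁ < 3 * n + 4 ∧ ∃ e₂, e₂ < 3 * n + 4 ∧
        w = D.cand ξ Q (s.nat 6) (s.nat 5) e₁ e₂}) s' := by
  refine .seq ((wp_setThr h).mono ?_)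
  rintro s₁ rfl
  set s₁ := s.setR 5 0 (D.thr (s.nat 6)) with hs₁
  have f₁ : Frame {1, 2, 3, 4} {2, 3, 4, 5, 6, 7, 8, 9, 11} s s₁ := (Frame.refl s).setR (by simp) _ _
  refine .seq ((wp_setThr (h.frame f₁ (by simp) (by simp) (by simp) (by simp) (by simp))).mono ?_)
  rintro s₂ rfl
  set s₂ := s₁.setR 5 1 (D.thr (s₁.nat 5)) with hs₂
  have f₂ := f₁.setR (k := 5) (by simp) 1 (D.thr (s₁.nat 5))
  rw [← hs₂] at f₂
  have h5 : s₂.real 5 0 = D.thr (s.nat 6) := by simp [hs₂, hs₁]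
  have h5' : s₂.real 5 1 = D.thr (s.nat 5) := by simp [hs₂, hs₁]
  have hb₂ : Best D ξ Q S s₂ := hb.congr (by
    rw [hs₂, hs₁, State.setR_real_ne _ (by simp), State.setR_real_ne _ (by simp)])
  refine .seq ((wp_setQuad hN (h.frame f₂ (by simp) (by simp) (by simp) (by simp) (by simp))).mono ?_)
  rintro s₃ ⟨g₃, q₃⟩
  rw [h5, h5'] at q₃
  have f₃ := f₂.trans (g₃.mono (by simp) (by decide))
  have hb₃ := hb₂.congr (g₃.real 2 (by simp))
  refine .seq ((wp_setRows hN (h.frame f₃ (by simp) (by simp) (by simp) (by simp) (by simp)) q₃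
    (by rw [f₃.real 10 (by simp), hβ])).mono ?_)
  rintro s₄ ⟨g₄, r₄⟩
  have f₄ := f₃.trans (g₄.mono (by simp) (by decide))
  have hb₄ := hb₃.congr (g₄.real 2 (by simp))
  refine (wp_tryPairs hN (h.frame f₄ (by simp) (by simp) (by simp) (by simp) (by simp))
    hb₄ r₄).mono ?_
  rintro s₅ ⟨g₅, b₅⟩
  exact ⟨f₄.trans (g₅.mono (by decide) (by decide)), b₅⟩

/-- The expression for the breakpoint `brk`. -/
def brkE : RExpr :=
  let S := rd 1 0 + rd 1 1
  let u := rd 30 0 * rd 20 0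
  .sqrt (S * minE u (S / .const 4)) - rd 1 0 / .const 2 + maxE (u - S / .const 4) (.const 0)

theorem Ctx.eval_brkE (h : Ctx D ξ Q s) : brkE.eval s = brk D.c₁ D.c₂ Q ξ := by
  simp [brkE, brk, h.c₁, h.c₂, h.ξ, h.Q]
  ring

/-- Minimizes the objective for fixed `ξ` and `Q`; the output is the minimum, a minimizer
`(λ₁, λ₂)` and `ξ`. -/
def minimize : Program :=
  .seq (.setReal 10 (.const 0) brkE) <|
  .seq (.setReal 4 (.const 0) (.const 0)) <|
  .seq (.setReal 4 (.const 1) (.const 0)) <|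
  .seq evalObj <|
  .seq (.setReal 2 (.const 0) (rd 3 0)) <|
  .seq (.setReal 2 (.const 1) (.const 0)) <|
  .seq (.setReal 2 (.const 2) (.const 0)) <|
  .seq (forLoop 6 (.add (.reg 0) (.const 1)) (forLoop 5 (.add (.reg 0) (.const 1)) tryCell)) <|
  .setReal 2 (.const 3) (rd 20 0)

/-- The output `o` consists of `f(ξ, Q)`, a minimizer and `ξ`. -/
structure IsSolution (D : Newsvendor n) (Q ξ : ℝ) (o : ℕ → ℝ) : Prop where
  val : o 0 = D.fr ξ Q
  nonneg : 0 ≤ o 1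
  obj : D.obj ξ Q (o 1) (o 2) = D.fr ξ Q
  arg : o 3 = ξ

theorem wp_minimize {N : ℕ} (hN : 3 * n + 4 ≤ N) (hD : D.Admissible) (hξ : 0 < ξ) (hQ : 0 ≤ Q)
    (h : Ctx D ξ Q s) :
    Wp N minimize s fun s' => Frame (Finset.Icc 1 9) (Finset.Icc 2 19) s s' ∧
      IsSolution D Q ξ (s'.real 2) := by
  refine .seq (.setReal (.seq (.setReal (.seq (.setReal (.seq ?_))))))
  set s₁ := State.setR _ _ _ _ with hs₁
  have f₁ : Frame (Finset.Icc 1 9) (Finset.Icc 2 19) s s₁ :=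
    (((Frame.refl s).setR (by simp) _ _).setR (by simp) _ _).setR (by simp) _ _
  have h10 : s₁.real 10 0 = brk D.c₁ D.c₂ Q ξ := by simp [hs₁, h.eval_brkE]
  have e0 : s₁.real 4 0 = 0 := by simp [hs₁]
  have e1 : s₁.real 4 1 = 0 := by simp [hs₁]
  clear_value s₁
  have c₁ := h.frame f₁ (by simp) (by simp) (by simp) (by simp) (by simp)
  refine (wp_evalObj hN c₁).mono ?_
  rintro s₂ ⟨g₂, v₂⟩
  have f₂ := f₁.trans (g₂.mono (by decide) (by decide))
  rw [e0, e1] at v₂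
  -- The record is initialized with the feasible point `(0, 0)` and its value, so that it is valid
  -- before any candidate has been tried.
  refine .seq (.setReal (.seq (.setReal (.seq (.setReal (.seq ?_))))))
  set s₃ := State.setR _ _ _ _ with hs₃
  have f₃ : Frame (Finset.Icc 1 9) (Finset.Icc 2 19) s s₃ :=
    ((f₂.setR (by simp) _ _).setR (by simp) _ _).setR (by simp) _ _
  have b₃ : Best D ξ Q ∅ s₃ := by
    refine ⟨by simp [hs₃], by simp [hs₃, v₂], fun w hw => absurd hw (by simp)⟩
  have b10 : s₃.real 10 0 = brk D.c₁ D.c₂ Q ξ := by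
    simp [hs₃, g₂.real 10 (by simp), h10]
  clear_value s₃
  have c₃ := h.frame f₃ (by simp) (by simp) (by simp) (by simp) (by simp)
  refine (wp_forLoop_best (R := {5, 1, 2, 3, 4}) (A := {2, 3, 4, 5, 6, 7, 8, 9, 11}) (M := n + 1)
    (T := fun j₁ => {w | ∃ j₂, j₂ < n + 1 ∧ ∃ e₁, e₁ < 3 * n + 4 ∧ ∃ e₂, e₂ < 3 * n + 4 ∧
      w = D.cand ξ Q j₁ j₂ e₁ e₂})
    (K := fun s' => Ctx D ξ Q s' ∧ s'.real 10 0 = brk D.c₁ D.c₂ Q ξ) (by omega) (by simp) ?_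
    (fun s' hs' => by simp [hs'.1.n]) ⟨c₃, b10⟩ b₃ ?_).mono ?_
  · rintro s' s'' ⟨h1, h2⟩ hf
    exact ⟨h1.frame hf (by simp) (by simp) (by simp) (by simp) (by simp),
      by rw [hf.real 10 (by simp), h2]⟩
  · rintro s₄ S₄ h6 ⟨hc₄, hβ₄⟩ hb₄
    refine wp_forLoop_best (R := {1, 2, 3, 4}) (M := n + 1)
      (T := fun j₂ => {w | ∃ e₁, e₁ < 3 * n + 4 ∧ ∃ e₂, e₂ < 3 * n + 4 ∧
        w = D.cand ξ Q (s₄.nat 6) j₂ e₁ e₂})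
      (K := fun s' => Ctx D ξ Q s' ∧ s'.real 10 0 = brk D.c₁ D.c₂ Q ξ ∧ s'.nat 6 = s₄.nat 6)
      (by omega) (by simp) ?_ (fun s' hs' => by simp [hs'.1.n]) ⟨hc₄, hβ₄, rfl⟩ hb₄ ?_
    · rintro s' s'' ⟨h1, h2, h3⟩ hf
      exact ⟨h1.frame hf (by simp) (by simp) (by simp) (by simp) (by simp),
        by rw [hf.real 10 (by simp), h2], by rw [hf.nat 6 (by simp), h3]⟩
    · rintro s₅ S₅ h5 ⟨hc₅, hβ₅, h6'⟩ hb₅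
      rw [← h6']
      exact wp_tryCell hN hc₅ hb₅ hβ₅
  · rintro s₆ ⟨g₆, b₆⟩
    have f₆ := f₃.trans (g₆.mono (by decide) (by decide))
    have c₆ := h.frame f₆ (by simp) (by simp) (by simp) (by simp) (by simp)
    -- The record beats every candidate, and some candidate beats any given feasible point.
    have hmin : ∀ l₁ l₂, 0 ≤ l₁ → D.obj ξ Q (s₆.real 2 1) (s₆.real 2 2) ≤ D.obj ξ Q l₁ l₂ := by
      intro l₁ l₂ hl
      obtain ⟨j₁, j₂, e₁, e₂, hj₁, hj₂, he₁, he₂, hle⟩ := exists_cand hD.regular hξ hQ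
        (fun l₁ l₂ hl => obj_nonneg hD hξ hl Q l₂) hl l₂
      rw [← b₆.val]
      exact (b₆.le _ (Or.inr ⟨j₁, by omega, j₂, by omega, e₁, he₁, e₂, he₂, rfl⟩)).trans hle
    have hfr : D.obj ξ Q (s₆.real 2 1) (s₆.real 2 2) = D.fr ξ Q := by
      rw [fr, f_eq_of_isMin hD.regular hξ b₆.nonneg hmin, EReal.toReal_coe]
    refine .setReal ⟨f₆.setR (by simp) _ _, ?_⟩
    constructor
    · simp [b₆.val, hfr]
    · simpa using b₆.nonneg
    · simpa using hfr
    · simp [c₆.ξ]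

end Newsvendor

end

/-! ### Trisection with an approximate oracle -/

noncomputable section

namespace RealRAM

/-- If a convex function does not increase by more than `η` from `q` to `p`, then beyond `q`, up to
the distance from `p` to `q`, it does not fall below its value at `q` by more than `η`. -/
theorem _root_.ConvexOn.le_add_of_le_add {φ : ℝ → ℝ} {S : Set ℝ} (hφ : ConvexOn ℝ S φ)
    {p q r θ η : ℝ} (hp : p ∈ S) (hr : r ∈ S) (hη : 0 ≤ η) (hθ : 1 / 2 ≤ θ) (hθ' : θ ≤ 1)
    (hq : q = (1 - θ) * p + θ * r) (h : φ p ≤ φ q + η) : φ q ≤ φ r + η := by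
  have h1 := hφ.2 hp hr (by linarith : 0 ≤ 1 - θ) (by linarith : 0 ≤ θ) (by ring)
  simp only [smul_eq_mul] at h1
  rw [← hq] at h1
  have h2 := mul_le_mul_of_nonneg_left h (by linarith : 0 ≤ 1 - θ)
  have h3 : θ * φ q ≤ θ * (φ r + η) := by nlinarith
  exact le_of_mul_le_mul_left h3 (by linarith)

/-- Copies the first five entries of array `2` to the entries `10`, …, `14` of array `w`. -/
def copyOut (w : ℕ) : Program :=
  .seq (.setReal w (.const 10) (rd 2 0)) <|
  .seq (.setReal w (.const 11) (rd 2 1)) <|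
  .seq (.setReal w (.const 12) (rd 2 2)) <|
  .seq (.setReal w (.const 13) (rd 2 3)) <|
  .setReal w (.const 14) (rd 2 4)

/-- Copies the entries `10`, …, `14` of array `w` to the first five entries of array `2`. -/
def copyBack (w : ℕ) : Program :=
  .seq (.setReal 2 (.const 0) (rd w 10)) <|
  .seq (.setReal 2 (.const 1) (rd w 11)) <|
  .seq (.setReal 2 (.const 2) (rd w 12)) <|
  .seq (.setReal 2 (.const 3) (rd w 13)) <|
  .setReal 2 (.const 4) (rd w 14)

/-- Calls the oracle `O` with the argument `e`. -/
def call (w : ℕ) (O : Program) (e : RExpr) : Program := .seq (.setReal w (.const 0) e) O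

/-- Calls the oracle and keeps the result if it is the best one so far. -/
def probe (w : ℕ) (O : Program) (e : RExpr) : Program :=
  .seq (call w O e) (.branch (.realLE (rd 2 0) (rd w 10)) (copyOut w) .skip)

/-- Minimizes the function computed by the oracle `O` by trisection of the interval whose
endpoints are in entries `1` and `2` of array `w`, until its length is at most entry `3`. -/
def search (w : ℕ) (O : Program) : Program :=
  .seq (call w O (rd w 1)) <|
  .seq (copyOut w) <|
  .seq (.loop (.neg (.realLE (rd w 2 - rd w 1) (rd w 3))) <|
    .seq (.setReal w (.const 4) (rd w 1 + (rd w 2 - rd w 1) / .const 3)) <|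
    .seq (.setReal w (.const 5) (rd w 2 - (rd w 2 - rd w 1) / .const 3)) <|
    .seq (probe w O (rd w 4)) <|
    .seq (.setReal w (.const 6) (rd 2 0)) <|
    .seq (probe w O (rd w 5)) <|
    .branch (.realLE (rd w 6) (rd 2 0)) (.setReal w (.const 2) (rd w 5))
      (.setReal w (.const 1) (rd w 4))) <|
  .seq (probe w O (rd w 1)) (copyBack w)

section Search

variable {N w : ℕ} {O : Program} {R A : Finset ℕ} {s : State} {lo hi η : ℝ} {φ : ℝ → ℝ}
  {Res : ℝ → (ℕ → ℝ) → Prop}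

theorem wp_copyOut (hw : 2 ≠ w) :
    Wp N (copyOut w) s fun s' => Frame ∅ {w} s s' ∧ (∀ j, j ≤ 4 → s'.real w (10 + j) = s.real 2 j) ∧
      ∀ j, j < 10 → s'.real w j = s.real w j := by
  refine .seq (.setReal (.seq (.setReal (.seq (.setReal (.seq (.setReal (.setReal
    ⟨?_, ?_, ?_⟩))))))))
  · exact (((((Frame.refl s).setR (by simp) _ _).setR (by simp) _ _).setR (by simp) _ _).setR
      (by simp) _ _).setR (by simp) _ _
  · intro j hj
    interval_cases j <;> simp [hw]
  · intro j hj
    have h0 : j ≠ 10 := by omega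
    have h1 : j ≠ 11 := by omega
    have h2 : j ≠ 12 := by omega
    have h3 : j ≠ 13 := by omega
    have h4 : j ≠ 14 := by omega
    simp [h0, h1, h2, h3, h4]

theorem wp_copyBack (hw : 2 ≠ w) :
    Wp N (copyBack w) s fun s' => Frame ∅ {2} s s' ∧
      ∀ j, j ≤ 4 → s'.real 2 j = s.real w (10 + j) := by
  refine .seq (.setReal (.seq (.setReal (.seq (.setReal (.seq (.setReal (.setReal
    ⟨?_, ?_⟩))))))))
  · exact (((((Frame.refl s).setR (by simp) _ _).setR (by simp) _ _).setR (by simp) _ _).setR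
      (by simp) _ _).setR (by simp) _ _
  · intro j hj
    interval_cases j <;> simp [hw.symm]

/-- In every state that agrees with `s` outside its working memory, the oracle `O` computes for
each argument in `[lo, hi]` a result whose first entry approximates `φ` from above up to `η`. -/
structure IsOracle (N w : ℕ) (O : Program) (R A : Finset ℕ) (s : State) (lo hi η : ℝ) (φ : ℝ → ℝ)
    (Res : ℝ → (ℕ → ℝ) → Prop) : Prop where
  w_ne : 2 ≠ w
  w_notMem : w ∉ A
  two_mem : 2 ∈ A
  run : ∀ t s', lo ≤ t → t ≤ hi → Frame R (insert w A) s s' → s'.real w 0 = t →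
    Wp N O s' fun s'' => Frame R A s' s'' ∧ Res t (s''.real 2)
  ge : ∀ t o, lo ≤ t → t ≤ hi → Res t o → φ t ≤ o 0
  le : ∀ t o, lo ≤ t → t ≤ hi → Res t o → o 0 ≤ φ t + η
  congr : ∀ t o o', (∀ j, j ≤ 4 → o' j = o j) → Res t o → Res t o'

theorem wp_call (h : IsOracle N w O R A s lo hi η φ Res) {e : RExpr} {s₁ : State} {t : ℝ}
    (hf : Frame R (insert w A) s s₁)
    (he : e.eval s₁ = t) (ht : lo ≤ t) (ht' : t ≤ hi) :
    Wp N (call w O e) s₁ fun s₂ => Frame R (insert w A) s s₂ ∧ Res t (s₂.real 2) ∧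
      ∀ j, j ≠ 0 → s₂.real w j = s₁.real w j := by
  refine .seq (.setReal ((h.run t _ ht ht' (hf.setR (by simp) _ _) (by simp [he])).mono ?_))
  rintro s₂ ⟨hf₂, hr⟩
  refine ⟨(hf.setR (by simp) _ _).trans (hf₂.mono subset_rfl (Finset.subset_insert _ _)), hr, ?_⟩
  intro j hj
  rw [hf₂.real w h.w_notMem]
  simp [hj]

theorem wp_probe (h : IsOracle N w O R A s lo hi η φ Res) {e : RExpr} {s₁ : State} {t : ℝ}
    (hf : Frame R (insert w A) s s₁)
    (he : e.eval s₁ = t) (ht : lo ≤ t) (ht' : t ≤ hi)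
    (hb : ∃ t, lo ≤ t ∧ t ≤ hi ∧ Res t fun j => s₁.real w (10 + j)) :
    Wp N (probe w O e) s₁ fun s₂ => Frame R (insert w A) s s₂ ∧
      (∃ t, lo ≤ t ∧ t ≤ hi ∧ Res t fun j => s₂.real w (10 + j)) ∧
      (∀ j, j ≠ 0 → j < 10 → s₂.real w j = s₁.real w j) ∧ s₂.real w 10 ≤ s₁.real w 10 ∧
      s₂.real w 10 ≤ s₂.real 2 0 ∧ φ t ≤ s₂.real 2 0 ∧ s₂.real 2 0 ≤ φ t + η := by
  refine .seq ((wp_call h hf he ht ht').mono ?_)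
  rintro s₂ ⟨hf₂, hr, hj⟩
  have b1 := h.ge t _ ht ht' hr
  have b2 := h.le t _ ht ht' hr
  refine .branch (fun hle => (wp_copyOut h.w_ne).mono ?_) (fun hle => .skip ?_)
  · rintro s₃ ⟨hf₃, h1, h2⟩
    have e2 : s₃.real 2 = s₂.real 2 := hf₃.real 2 (by simp [h.w_ne])
    have e10 : s₃.real w 10 = s₂.real 2 0 := h1 0 (by omega)
    simp only [holds_realLE, eval_rd] at hle
    rw [hj 10 (by omega)] at hle
    refine ⟨hf₂.trans (hf₃.mono (by simp) (by simp)), ⟨t, ht, ht', h.congr t _ _ h1 hr⟩, ?_, ?_, ?_,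
      ?_, ?_⟩
    · intro j h0 h10
      rw [h2 j h10, hj j h0]
    · rw [e10]; exact hle
    · rw [e10, e2]
    · rw [e2]; exact b1
    · rw [e2]; exact b2
  · simp only [holds_realLE, eval_rd, not_le] at hle
    refine ⟨hf₂, ?_, fun j h0 _ => hj j h0, (hj 10 (by omega)).le, hle.le, b1, b2⟩
    obtain ⟨t', h1, h2, h3⟩ := hb
    exact ⟨t', h1, h2, h.congr _ _ _ (fun j _ => hj _ (by omega)) h3⟩

/-- If the left probe is not larger than the right one, then `φ` rises from left to right up to `η`,
so by convexity nothing in the right third is below the right probe by more than `2 η`; the other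
case is symmetric. The final probe is at the left endpoint of an interval of length at most `tol`,
which is why a one-sided Lipschitz bound suffices. Errors do not accumulate over the passes, because
each discarded point is compared with the best value directly. -/
theorem wp_search (h : IsOracle N w O R A s lo hi η φ Res) {M : ℕ} {tol Λ : ℝ}
    (hM : M ≤ N) (hle : lo ≤ hi) (hη : 0 ≤ η) (hΛ : 0 ≤ Λ)
    (hlo : s.real w 1 = lo) (hhi : s.real w 2 = hi) (htol : s.real w 3 = tol)
    (hMtol : (hi - lo) * (2 / 3) ^ M ≤ tol) (hφ : ConvexOn ℝ (Set.Icc lo hi) φ)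
    (hLip : ∀ t z, lo ≤ t → t ≤ z → z ≤ hi → φ t ≤ φ z + Λ * (z - t)) :
    Wp N (search w O) s fun s' => Frame R (insert w A) s s' ∧
      (∃ t, lo ≤ t ∧ t ≤ hi ∧ Res t (s'.real 2)) ∧
      ∀ z, lo ≤ z → z ≤ hi → s'.real 2 0 ≤ φ z + 2 * η + Λ * tol := by
  refine .seq ((wp_call h (t := lo) (Frame.refl s) (by simpa using hlo) le_rfl hle).mono ?_)
  rintro s₁ ⟨f₁, r₁, j₁⟩
  refine .seq ((wp_copyOut h.w_ne).mono ?_)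
  rintro s₂ ⟨g₂, c₂, j₂⟩
  have f₂ := f₁.trans (g₂.mono (by simp) (by simp))
  -- Invariant: each point of the original interval is still in the current one or is matched by the
  -- record up to `2 η`; the width shrinks by the factor `2/3` per pass.
  refine .seq (.loop hM (fun k s' => Frame R (insert w A) s s' ∧
    (lo ≤ s'.real w 1 ∧ s'.real w 1 ≤ s'.real w 2 ∧ s'.real w 2 ≤ hi ∧ s'.real w 3 = tol ∧
      s'.real w 2 - s'.real w 1 = (hi - lo) * (2 / 3) ^ k) ∧
    (∃ t, lo ≤ t ∧ t ≤ hi ∧ Res t fun j => s'.real w (10 + j)) ∧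
    ∀ z, lo ≤ z → z ≤ hi → (s'.real w 1 ≤ z ∧ z ≤ s'.real w 2) ∨ s'.real w 10 ≤ φ z + 2 * η)
    ?_ ?_ ?_)
  · have e1 : s₂.real w 1 = lo := by rw [j₂ 1 (by omega), j₁ 1 (by omega), hlo]
    have e2 : s₂.real w 2 = hi := by rw [j₂ 2 (by omega), j₁ 2 (by omega), hhi]
    have e3 : s₂.real w 3 = tol := by rw [j₂ 3 (by omega), j₁ 3 (by omega), htol]
    refine ⟨f₂, ⟨e1.ge, by rw [e1, e2]; exact hle, e2.le, e3, by rw [e1, e2]; simp⟩,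
      ⟨lo, le_rfl, hle, h.congr _ _ _ c₂ r₁⟩, fun z hz hz' => Or.inl ?_⟩
    rw [e1, e2]
    exact ⟨hz, hz'⟩
  · rintro k s₃ ⟨f₃, ⟨ha, hab, hb, ht, hwid⟩, hbest, hz⟩ hcond
    simp only [holds_neg, holds_realLE, eval_sub, eval_rd, not_le, ht] at hcond
    have hk : k < M := by
      by_contra hk
      have h1 : ((2 : ℝ) / 3) ^ k ≤ (2 / 3) ^ M :=
        pow_le_pow_of_le_one (by norm_num) (by norm_num) (not_lt.1 hk)
      have := mul_le_mul_of_nonneg_left h1 (sub_nonneg.2 hle)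
      linarith
    refine ⟨hk, .seq (.setReal (.seq (.setReal ?_)))⟩
    set a := s₃.real w 1 with ha'
    set b := s₃.real w 2 with hb'
    set s₄ := State.setR _ _ _ _ with hs₄
    have f₄ : Frame R (insert w A) s s₄ := (f₃.setR (by simp) _ _).setR (by simp) _ _
    have e4 : s₄.real w 4 = a + (b - a) / 3 := by simp [hs₄, ← ha', ← hb']
    have e5 : s₄.real w 5 = b - (b - a) / 3 := by simp [hs₄, ← ha', ← hb']
    have k₄ : ∀ j, j ≠ 4 → j ≠ 5 → s₄.real w j = s₃.real w j := by
      intro j h4 h5; simp [hs₄, h4, h5]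
    clear_value s₄
    have best₄ : ∃ t, lo ≤ t ∧ t ≤ hi ∧ Res t fun j => s₄.real w (10 + j) := by
      obtain ⟨t, h1, h2, h3⟩ := hbest
      exact ⟨t, h1, h2, h.congr _ _ _ (fun j _ => k₄ _ (by omega) (by omega)) h3⟩
    refine .seq ((wp_probe h (t := a + (b - a) / 3) f₄ (by simpa using e4) (by linarith)
      (by linarith) best₄).mono ?_)
    rintro s₅ ⟨f₅, best₅, k₅, d₅, -, u₅, v₅⟩
    refine .seq (.setReal ?_)
    set s₆ := State.setR _ _ _ _ with hs₆
    have f₆ : Frame R (insert w A) s s₆ := f₅.setR (by simp) _ _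
    have e6 : s₆.real w 6 = s₅.real 2 0 := by simp [hs₆]
    have k₆ : ∀ j, j ≠ 6 → s₆.real w j = s₅.real w j := by
      intro j h6; simp [hs₆, h6]
    clear_value s₆
    have best₆ : ∃ t, lo ≤ t ∧ t ≤ hi ∧ Res t fun j => s₆.real w (10 + j) := by
      obtain ⟨t, h1, h2, h3⟩ := best₅
      exact ⟨t, h1, h2, h.congr _ _ _ (fun j _ => k₆ _ (by omega)) h3⟩
    refine .seq ((wp_probe h (t := b - (b - a) / 3) f₆
      (by simpa [k₆ 5 (by omega), k₅ 5 (by omega) (by omega)] using e5) (by linarith)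
      (by linarith) best₆).mono ?_)
    rintro s₇ ⟨f₇, best₇, k₇, d₇, w₇, u₇, v₇⟩
    have k1 : s₇.real w 1 = a := by
      rw [k₇ 1 (by omega) (by omega), k₆ 1 (by omega), k₅ 1 (by omega) (by omega),
        k₄ 1 (by omega) (by omega)]
    have k2 : s₇.real w 2 = b := by
      rw [k₇ 2 (by omega) (by omega), k₆ 2 (by omega), k₅ 2 (by omega) (by omega),
        k₄ 2 (by omega) (by omega)]
    have k3 : s₇.real w 3 = tol := by
      rw [k₇ 3 (by omega) (by omega), k₆ 3 (by omega), k₅ 3 (by omega) (by omega),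
        k₄ 3 (by omega) (by omega), ht]
    have k4 : s₇.real w 4 = a + (b - a) / 3 := by
      rw [k₇ 4 (by omega) (by omega), k₆ 4 (by omega), k₅ 4 (by omega) (by omega), e4]
    have k5 : s₇.real w 5 = b - (b - a) / 3 := by
      rw [k₇ 5 (by omega) (by omega), k₆ 5 (by omega), k₅ 5 (by omega) (by omega), e5]
    have k6 : s₇.real w 6 = s₅.real 2 0 := by
      rw [k₇ 6 (by omega) (by omega), e6]
    have d10 : s₇.real w 10 ≤ s₃.real w 10 := by
      rw [← k₄ 10 (by omega) (by omega)]
      exact d₇.trans ((k₆ 10 (by omega)).le.trans d₅)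
    have d10' : s₇.real w 10 ≤ s₅.real w 10 := d₇.trans (k₆ 10 (by omega)).le
    have pow_k : (hi - lo) * ((2 : ℝ) / 3) ^ (k + 1) = (b - a) * (2 / 3) := by
      rw [pow_succ, ← mul_assoc, ← hwid]
    -- Both orientations at once. The discarded third is no longer than the middle one, so the
    -- convex weight `(q - p) / (r - p)` is at least `1/2`, as `le_add_of_le_add` requires.
    have tri : ∀ p q r : ℝ, lo ≤ p → p ≤ hi → lo ≤ r → r ≤ hi →
        (p < q ∧ q < r ∧ r - q ≤ q - p ∨ r < q ∧ q < p ∧ q - r ≤ p - q) →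
        φ p ≤ φ q + η → φ q ≤ φ r + η := by
      intro p q r hp hp' hr hr' hpq hle'
      have hne : r - p ≠ 0 := by rcases hpq with hpq | hpq <;> intro h0 <;> linarith
      refine hφ.le_add_of_le_add (θ := (q - p) / (r - p)) ⟨hp, hp'⟩ ⟨hr, hr'⟩ hη ?_ ?_ ?_ hle'
      · rcases hpq with ⟨h1, h2, h3⟩ | ⟨h1, h2, h3⟩
        · rw [le_div_iff₀ (by linarith)]; linarith
        · rw [le_div_iff_of_neg (by linarith)]; linarith
      · rcases hpq with ⟨h1, h2, h3⟩ | ⟨h1, h2, h3⟩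
        · rw [div_le_one (by linarith)]; linarith
        · rw [div_le_one_of_neg (by linarith)]; linarith
      · field_simp; ring
    refine .branch (fun hc => .setReal ⟨f₇.setR (by simp) _ _, ?_, ?_, ?_⟩)
      (fun hc => .setReal ⟨f₇.setR (by simp) _ _, ?_, ?_, ?_⟩)
    · simp [k1, k3, k5, pow_k]
      refine ⟨ha, ?_, ?_, ?_⟩ <;> linarith
    · obtain ⟨t, h1, h2, h3⟩ := best₇
      refine ⟨t, h1, h2, h.congr _ _ _ (fun j _ => ?_) h3⟩
      have : 10 + j ≠ 2 := by omega
      simp [this]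
    · intro z hz1 hz2
      simp only [holds_realLE, eval_rd, k6] at hc
      simp only [eval_nconst, eval_rd, State.setR_real, k1, k5]
      norm_num
      rcases hz z hz1 hz2 with ⟨h1, h2⟩ | h1
      · rcases le_or_gt z (b - (b - a) / 3) with h3 | h3
        · exact Or.inl ⟨h1, h3⟩
        · right
          have := tri (a + (b - a) / 3) (b - (b - a) / 3) z (by linarith) (by linarith) hz1 hz2
            (Or.inl ⟨by linarith, h3, by linarith⟩) (by linarith)
          linarith
      · exact Or.inr (d10.trans h1)
    · simp [k2, k3, k4, pow_k]
      refine ⟨?_, ?_, hb, ?_⟩ <;> linarith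
    · obtain ⟨t, h1, h2, h3⟩ := best₇
      refine ⟨t, h1, h2, h.congr _ _ _ (fun j _ => ?_) h3⟩
      have : 10 + j ≠ 1 := by omega
      simp [this]
    · intro z hz1 hz2
      simp only [holds_realLE, eval_rd, k6, not_le] at hc
      simp only [eval_nconst, eval_rd, State.setR_real, k2, k4]
      norm_num
      rcases hz z hz1 hz2 with ⟨h1, h2⟩ | h1
      · rcases le_or_gt (a + (b - a) / 3) z with h3 | h3
        · exact Or.inl ⟨h3, h2⟩
        · right
          have := tri (b - (b - a) / 3) (a + (b - a) / 3) z (by linarith) (by linarith) hz1 hz2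
            (Or.inr ⟨h3, by linarith, by linarith⟩) (by linarith)
          linarith
      · exact Or.inr (d10.trans h1)
  · rintro k s₃ ⟨f₃, ⟨ha, hab, hb, ht, hwid⟩, hbest, hz⟩ hcond
    simp only [holds_neg, holds_realLE, eval_sub, eval_rd, not_not, ht] at hcond
    refine .seq ((wp_probe h (t := s₃.real w 1) f₃ (by simp) ha (by linarith) hbest).mono ?_)
    rintro s₄ ⟨f₄, best₄, -, d₄, w₄, u₄, v₄⟩
    refine (wp_copyBack h.w_ne).mono ?_
    rintro s₅ ⟨g₅, c₅⟩
    have e0 : s₅.real 2 0 = s₄.real w 10 := c₅ 0 (by omega)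
    refine ⟨f₄.trans (g₅.mono (by simp) ?_), ?_, ?_⟩
    · intro x hx
      rw [Finset.mem_singleton] at hx
      rw [hx]
      exact Finset.mem_insert_of_mem h.two_mem
    · obtain ⟨t, h1, h2, h3⟩ := best₄
      exact ⟨t, h1, h2, h.congr _ _ _ c₅ h3⟩
    · intro z hz1 hz2
      rw [e0]
      have htol0 : 0 ≤ Λ * tol := mul_nonneg hΛ (by linarith)
      rcases hz z hz1 hz2 with ⟨h1, h2⟩ | h1
      · have h3 := hLip _ z ha h1 hz2
        have h4 := mul_le_mul_of_nonneg_left (by linarith : z - s₃.real w 1 ≤ tol) hΛ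
        linarith
      · linarith

end Search

end RealRAM

end

/-! ### Search ranges, accuracy and the three programs -/

noncomputable section

namespace Newsvendor

open RealRAM

variable {n : ℕ} {D : Newsvendor n} {ξ Q ε : ℝ} {s s' : State}

/-- The data `D` are in their places. -/
structure DataOK (D : Newsvendor n) (s : State) : Prop where
  n : s.nat 0 = n
  x : s.real 0 = D.xs
  c₁ : s.real 1 0 = D.c₁
  c₂ : s.real 1 1 = D.c₂
  δ : s.real 1 2 = D.δ
  μ : s.real 1 3 = D.μ
  σ : s.real 1 4 = D.σ

theorem DataOK.frame (h : DataOK D s) {R A : Finset ℕ} (hf : Frame R A s s') (h0 : 0 ∉ R)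
    (ha : 0 ∉ A) (hb : 1 ∉ A) : DataOK D s' where
  n := by rw [hf.nat 0 h0, h.n]
  x := by rw [hf.real 0 ha, h.x]
  c₁ := by rw [hf.real 1 hb, h.c₁]
  c₂ := by rw [hf.real 1 hb, h.c₂]
  δ := by rw [hf.real 1 hb, h.δ]
  μ := by rw [hf.real 1 hb, h.μ]
  σ := by rw [hf.real 1 hb, h.σ]

theorem DataOK.ctx (h : DataOK D s) (hξ : s.real 20 0 = ξ) (hQ : s.real 30 0 = Q) :
    Ctx D ξ Q s :=
  ⟨h.n, h.x, h.c₁, h.c₂, h.δ, h.μ, h.σ, hξ, hQ⟩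

theorem DataOK.eval_smE (h : DataOK D s) : smE.eval s = D.sm := by
  simp [smE, sm, h.σ, h.μ]; ring

theorem dataOK_input (D : Newsvendor n) (l : List ℝ) : DataOK D (input D.x (D.params ++ l)) := by
  constructor <;> simp [input, params]
  rfl

theorem sm_add_one_le {D : Newsvendor n} (hD : D.Admissible) {Z : ℝ} (h : 1 + D.μ + D.σ ≤ Z) :
    D.sm + 1 ≤ Z ^ 2 := by
  have := hD.μ_nonneg
  have := hD.σ_nonneg
  have h1 := pow_le_pow_left₀ (by positivity) h 2
  have h2 := mul_nonneg hD.μ_nonneg hD.σ_nonneg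
  rw [sm]
  nlinarith

/-- Two passes at least halve the interval, as `4/9 ≤ 1/2`. -/
theorem two_thirds_pow_le (m : ℕ) : ((2 : ℝ) / 3) ^ (2 * m) ≤ ((2 : ℝ) ^ m)⁻¹ := by
  rw [pow_mul, ← inv_pow]
  exact pow_le_pow_left₀ (by norm_num) (by norm_num) m

/-- The lower end of the range of `ξ` that has to be searched for accuracy `ε`. -/
def lower (D : Newsvendor n) (ε : ℝ) : ℝ := ε / (2 * (D.sm + 1))

/-- The upper end of the range of `ξ` that has to be searched for accuracy `ε`. -/
def upper (D : Newsvendor n) (ε : ℝ) : ℝ := D.lower ε + (D.c₁ + D.c₂) ^ 2 / (2 * ε)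

/-- A Lipschitz constant of `f(·, Q)` to the left on `[A, ∞)`. -/
def slope (D : Newsvendor n) (Q A : ℝ) : ℝ := D.sm + 2 * D.c₂ * Q / A + D.c₁ ^ 2 / A ^ 2

theorem lower_pos (hε : 0 < ε) : 0 < D.lower ε := by
  have := D.sm_nonneg
  unfold lower; positivity

theorem lower_le_upper (hε : 0 < ε) : D.lower ε ≤ D.upper ε := by
  have : 0 ≤ (D.c₁ + D.c₂) ^ 2 / (2 * ε) := by positivity
  unfold upper; linarith

theorem slope_nonneg (hD : D.Admissible) {A : ℝ} (hQ : 0 ≤ Q) (hA : 0 < A) : 0 ≤ D.slope Q A := by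
  have := D.sm_nonneg
  have := hD.c₂_pos
  unfold slope; positivity

/-- The range `[lower, upper]` contains nearly optimal `ξ`. -/
theorem exists_mem_range (hD : D.Admissible) (hε : 0 < ε) (hQ : 0 ≤ Q) (hξ : 0 < ξ) :
    ∃ z, D.lower ε ≤ z ∧ z ≤ D.upper ε ∧ D.fr z Q ≤ D.fr ξ Q + ε / 2 := by
  have hsm := D.sm_nonneg
  have hA := lower_pos (D := D) hε
  have hAB := lower_le_upper (D := D) hε
  rcases le_total ξ (D.lower ε) with h | h
  · refine ⟨_, le_rfl, hAB, ?_⟩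
    have h1 := fr_le_add hD hξ h hQ
    have h2 : D.lower ε * (2 * (D.sm + 1)) = ε := by rw [lower]; field_simp
    nlinarith [mul_nonneg hξ.le hsm]
  · rcases le_total ξ (D.upper ε) with h' | h'
    · exact ⟨ξ, h, h', by linarith⟩
    · refine ⟨_, hAB, le_rfl, ?_⟩
      have hB : 0 < D.upper ε := hA.trans_le hAB
      have h1 := fr_le_add_div hD hB h' hQ
      -- The second summand of `upper` is chosen for this: `B ≥ (c₁ + c₂)² / (2 ε)` makes the
      -- truncation loss at most `ε / 2`.
      have h2 : max D.c₁ D.c₂ ^ 2 / (4 * D.upper ε) ≤ ε / 2 := by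
        rw [div_le_iff₀ (by positivity)]
        have h3 : max D.c₁ D.c₂ ≤ D.c₁ + D.c₂ :=
          max_le (by linarith [hD.c₂_pos]) (by linarith [hD.c₁_pos])
        have h4 := pow_le_pow_left₀ (le_max_of_le_left hD.c₁_pos.le) h3 2
        have h5 : (D.c₁ + D.c₂) ^ 2 / (2 * ε) * (2 * ε) = (D.c₁ + D.c₂) ^ 2 := by field_simp
        have h6 : D.upper ε * (2 * ε) = D.lower ε * (2 * ε) + (D.c₁ + D.c₂) ^ 2 := by
          rw [upper, add_mul, h5]
        have := mul_pos hA hε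
        linarith
      linarith

/-- With `Z = 2 ^ m` bounding the data, the range is at most `Z⁴ ε / 2`, the slope plus one is at
most `Z¹²`, and `32 m` passes shrink by at least `Z¹⁶`. -/
theorem range_div_le (hD : D.Admissible) (hε : 0 < ε) (hQ : 0 ≤ Q) {m : ℕ}
    (hm : 1 ≤ m) (hc : D.c₁ + D.c₂ ≤ 2 ^ m) (hs : 1 + D.μ + D.σ ≤ 2 ^ m) (hQm : Q ≤ 2 ^ m)
    (hεm : 1 / ε ≤ 2 ^ m) :
    (D.upper ε - D.lower ε) * (2 / 3) ^ (32 * m)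
      ≤ ε / 2 / (D.slope Q (D.lower ε) + 1) := by
  set Z : ℝ := 2 ^ m with hZ
  have hZ2 : 2 ≤ Z := by
    rw [hZ]
    calc (2 : ℝ) = 2 ^ 1 := by norm_num
      _ ≤ 2 ^ m := pow_le_pow_right₀ (by norm_num) hm
  have hsm := D.sm_nonneg
  have hc1 := hD.c₁_pos
  have hc2 := hD.c₂_pos
  have hsm' := sm_add_one_le hD hs
  have hA := lower_pos (D := D) hε
  have hsl := slope_nonneg hD hQ hA
  have hy0 : 0 < 1 / ε := by positivity
  set y := 1 / ε with hy
  have e1 : D.slope Q (D.lower ε) + 1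
      = (D.sm + 1) + 4 * (D.c₂ * Q * (D.sm + 1) * y) + 4 * (D.c₁ ^ 2 * (D.sm + 1) ^ 2 * y ^ 2) := by
    rw [slope, lower, hy]; field_simp; ring
  have b1 : D.c₂ * Q * (D.sm + 1) * y ≤ Z * Z * Z ^ 2 * Z := by gcongr; linarith
  have b2 : D.c₁ ^ 2 * (D.sm + 1) ^ 2 * y ^ 2 ≤ Z ^ 2 * (Z ^ 2) ^ 2 * Z ^ 2 := by gcongr; linarith
  have p1 : Z ^ 2 ≤ Z ^ 8 := pow_le_pow_right₀ (by linarith) (by norm_num)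
  have p2 : Z ^ 5 ≤ Z ^ 8 := pow_le_pow_right₀ (by linarith) (by norm_num)
  have p3 : (2 : ℝ) ^ 4 ≤ Z ^ 4 := pow_le_pow_left₀ (by norm_num) hZ2 4
  have e2 : D.slope Q (D.lower ε) + 1 ≤ Z ^ 12 := by
    have h8 : 0 ≤ Z ^ 8 := by positivity
    have := mul_le_mul_of_nonneg_left p3 h8
    rw [e1]
    have q1 : Z * Z * Z ^ 2 * Z = Z ^ 5 := by ring
    have q2 : Z ^ 2 * (Z ^ 2) ^ 2 * Z ^ 2 = Z ^ 8 := by ring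
    have q3 : Z ^ 8 * Z ^ 4 = Z ^ 12 := by ring
    rw [q1] at b1
    rw [q2] at b2
    rw [q3] at this
    linarith
  have e3 : D.upper ε - D.lower ε = (D.c₁ + D.c₂) ^ 2 * y ^ 2 * (ε / 2) := by
    rw [upper, hy]; field_simp; ring
  have e4 : ((2 : ℝ) / 3) ^ (32 * m) ≤ (Z ^ 16)⁻¹ := by
    have := two_thirds_pow_le (16 * m)
    rwa [show 2 * (16 * m) = 32 * m by ring,
      show (2 : ℝ) ^ (16 * m) = Z ^ 16 by rw [hZ, ← pow_mul, mul_comm]] at this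
  rw [le_div_iff₀ (by linarith), e3]
  have b3 : (D.c₁ + D.c₂) ^ 2 * y ^ 2 ≤ Z ^ 2 * Z ^ 2 := by gcongr
  have hZ0 : Z ≠ 0 := by linarith
  calc (D.c₁ + D.c₂) ^ 2 * y ^ 2 * (ε / 2) * (2 / 3) ^ (32 * m) * (D.slope Q (D.lower ε) + 1)
      ≤ Z ^ 2 * Z ^ 2 * (ε / 2) * (Z ^ 16)⁻¹ * Z ^ 12 := by gcongr
    _ = ε / 2 := by field_simp

/-- Approximates `h(Q)` for `Q` in array `30` and accuracy `ε` in array `40`; the output is the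
value, `(λ₁, λ₂)`, `ξ` and `Q`. -/
def minimizeXi : Program :=
  .seq (.setReal 20 (.const 1) (rd 40 0 / (.const 2 * (smE + .const 1)))) <|
  .seq (.setReal 20 (.const 2) (rd 20 1
    + (rd 1 0 + rd 1 1) * (rd 1 0 + rd 1 1) / (.const 2 * rd 40 0))) <|
  .seq (.setReal 20 (.const 3) (rd 40 0 / .const 2 / (smE + .const 2 * rd 1 1 * rd 30 0 / rd 20 1
    + rd 1 0 * rd 1 0 / (rd 20 1 * rd 20 1) + .const 1))) <|
  .seq (search 20 minimize) <|
  .setReal 2 (.const 4) (rd 30 0)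

/-- The output `o` describes a point with parameter `Q` that is optimal for this `Q` up to `ε`. -/
def IsApprox (D : Newsvendor n) (ε Q : ℝ) (o : ℕ → ℝ) : Prop :=
  ∃ ξ, 0 < ξ ∧ IsSolution D Q ξ o ∧ o 4 = Q ∧ o 0 ≤ D.hr Q + ε

theorem IsSolution.congr {o o' : ℕ → ℝ} (h : IsSolution D Q ξ o) (he : ∀ j, j ≤ 4 → o' j = o j) :
    IsSolution D Q ξ o' :=
  ⟨by rw [he 0 (by omega), h.val], by rw [he 1 (by omega)]; exact h.nonneg,
    by rw [he 1 (by omega), he 2 (by omega), h.obj], by rw [he 3 (by omega), h.arg]⟩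

theorem isOracle_minimize {N : ℕ} (hN : 3 * n + 4 ≤ N) (hD : D.Admissible) (hQ : 0 ≤ Q)
    {lo hi : ℝ} (hlo : 0 < lo) (h : DataOK D s) (h30 : s.real 30 0 = Q) :
    IsOracle N 20 minimize (Finset.Icc 1 9) (Finset.Icc 2 19) s lo hi 0 (fun ξ => D.fr ξ Q)
      (IsSolution D Q) where
  w_ne := by norm_num
  w_notMem := by simp
  two_mem := by simp
  run t s' ht _ hf h0 :=
    wp_minimize hN hD (hlo.trans_le ht) hQ
      ((h.frame hf (by simp) (by simp) (by simp)).ctx h0 (by rw [hf.real 30 (by simp), h30]))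
  ge t o _ _ ho := ho.val.ge
  le t o _ _ ho := by rw [ho.val, add_zero]
  congr t o o' he ho := ho.congr he

/-- The oracle is exact here. Half of `ε` pays for restricting `ξ` to `[lower, upper]`, the other
half for the slope times the final width. -/
theorem wp_minimizeXi {N m : ℕ} (hN : 3 * n + 4 ≤ N) (hmN : 32 * m ≤ N) (hD : D.Admissible)
    (hQ : 0 ≤ Q) (hε : 0 < ε) (hm : 1 ≤ m) (hc : D.c₁ + D.c₂ ≤ 2 ^ m)
    (hs : 1 + D.μ + D.σ ≤ 2 ^ m) (hQm : Q ≤ 2 ^ m) (hεm : 1 / ε ≤ 2 ^ m) (h : DataOK D s)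
    (h30 : s.real 30 0 = Q) (h40 : s.real 40 0 = ε) :
    Wp N minimizeXi s fun s' => Frame (Finset.Icc 1 9) (Finset.Icc 2 20) s s' ∧
      IsApprox D ε Q (s'.real 2) := by
  have hA := lower_pos (D := D) hε
  have hins : insert 20 (Finset.Icc 2 19) = Finset.Icc 2 20 := by decide
  refine .seq (.setReal (.seq (.setReal (.seq (.setReal (.seq ?_))))))
  set s₁ := State.setR _ _ _ _ with hs₁
  have f₁ : Frame (Finset.Icc 1 9) (Finset.Icc 2 20) s s₁ :=
    (((Frame.refl s).setR (by simp) _ _).setR (by simp) _ _).setR (by simp) _ _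
  have e1 : s₁.real 20 1 = D.lower ε := by
    simp [hs₁, h.eval_smE, h40, lower]
  have e2 : s₁.real 20 2 = D.upper ε := by
    simp [hs₁, h.eval_smE, h40, lower, upper, h.c₁, h.c₂]; ring
  have e3 : s₁.real 20 3 = ε / 2 / (D.slope Q (D.lower ε) + 1) := by
    simp [hs₁, smE, h40, lower, slope, sm, h.c₁, h.c₂, h.σ, h.μ, h30, pow_two]
  clear_value s₁
  have d₁ := h.frame f₁ (by simp) (by simp) (by simp)
  have hsl := slope_nonneg hD hQ hA
  refine (wp_search (isOracle_minimize hN hD hQ hA d₁ (by rw [f₁.real 30 (by simp), h30])) hmN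
    (lower_le_upper hε) le_rfl hsl e1 e2 e3
    (range_div_le hD hε hQ hm hc hs hQm hεm) ?_ ?_).mono ?_
  · refine ⟨convex_Icc _ _, fun t ht z hz a b ha hb hab => ?_⟩
    have ht0 : 0 < t := hA.trans_le ht.1
    have hz0 : 0 < z := hA.trans_le hz.1
    have hpos : 0 < a * t + b * z :=
      hA.trans_le ((convex_Icc (D.lower ε) (D.upper ε)) ht hz ha hb hab).1
    have := fr_convex hD ht0 hz0 hQ hQ ha hb hab hpos
    rw [← add_mul, hab, one_mul] at this
    simpa using this
  · intro t z ht htz _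
    exact fr_le_of_lt hD hA ht htz hQ
  · rintro s₂ ⟨f₂, ⟨ξ, hξ1, hξ2, hsol⟩, hbest⟩
    rw [hins] at f₂
    have f₂' := f₁.trans f₂
    refine .setReal ⟨f₂'.setR (by simp) _ _, ξ, hA.trans_le hξ1, ?_, ?_, ?_⟩
    · exact ⟨by simpa using hsol.val, by simpa using hsol.nonneg, by simpa using hsol.obj,
        by simpa using hsol.arg⟩
    · simp [f₂'.real 30 (by simp), h30]
    · have key : s₂.real 2 0 - ε ≤ D.hr Q := le_hr hD hQ fun ξ' hξ' => by
        obtain ⟨z, hz1, hz2, hz⟩ := exists_mem_range hD hε hQ hξ'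
        have h1 := hbest z hz1 hz2
        have h2 : D.slope Q (D.lower ε) * (ε / 2 / (D.slope Q (D.lower ε) + 1)) ≤ ε / 2 := by
          rw [mul_div_assoc', div_le_iff₀ (by linarith)]
          nlinarith
        linarith
      simp
      linarith

/-- Approximates the minimum of `h`; the accuracy is entry `5` of array `1`. -/
def minimizeQ : Program :=
  .seq (.setReal 40 (.const 0) (rd 1 5 / .const 4)) <|
  .seq (.setReal 30 (.const 1) (.const 0)) <|
  .seq (.setReal 30 (.const 2) ((rd 1 0 + rd 1 1) * (smE + .const 1) / rd 1 5)) <|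
  .seq (.setReal 30 (.const 3) (rd 1 5 / (.const 4 * (rd 1 0 + rd 1 1)))) <|
  search 30 minimizeXi

theorem IsApprox.congr {o o' : ℕ → ℝ} (h : IsApprox D ε Q o) (he : ∀ j, j ≤ 4 → o' j = o j) :
    IsApprox D ε Q o' := by
  obtain ⟨ξ, hξ, h1, h2, h3⟩ := h
  exact ⟨ξ, hξ, h1.congr he, by rw [he 4 (by omega), h2], by rw [he 0 (by omega)]; exact h3⟩

/-- Error budget: the oracle accuracy `ε / 4` counts twice in the search, the Lipschitz term takes
another `ε / 4`, and cutting off `Q > T` the last. The inner search has arguments up to `T ≤ Z⁴` and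
accuracy `ε / 4`, so it runs with `4 m` in place of `m`; hence the `128 m` passes. -/
theorem wp_minimizeQ {N m : ℕ} (hN : 3 * n + 4 ≤ N) (hmN : 128 * m ≤ N) (hD : D.Admissible)
    (hε : 0 < ε) (hm : 1 ≤ m) (hc : D.c₁ + D.c₂ ≤ 2 ^ m) (hs : 1 + D.μ + D.σ ≤ 2 ^ m)
    (hεm : 1 / ε ≤ 2 ^ m) (h : DataOK D s) (h5 : s.real 1 5 = ε) :
    Wp N minimizeQ s fun s' => ∃ Q, 0 ≤ Q ∧ IsApprox D (ε / 4) Q (s'.real 2) ∧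
      ∀ Q', 0 ≤ Q' → s'.real 2 0 ≤ D.hr Q' + ε := by
  have hc1 := hD.c₁_pos
  have hc2 := hD.c₂_pos
  have hsm := D.sm_nonneg
  set Z : ℝ := 2 ^ m with hZ
  have hZ2 : 2 ≤ Z := by
    rw [hZ]
    calc (2 : ℝ) = 2 ^ 1 := by norm_num
      _ ≤ 2 ^ m := pow_le_pow_right₀ (by norm_num) hm
  have hZ4 : (2 : ℝ) ^ (4 * m) = Z ^ 4 := by rw [mul_comm, pow_mul]
  have hsm' := sm_add_one_le hD hs
  set T := (D.c₁ + D.c₂) * (D.sm + 1) / ε with hT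
  have hT0 : 0 < T := by positivity
  have hTZ : T ≤ Z ^ 4 := by
    calc T = (D.c₁ + D.c₂) * (D.sm + 1) * (1 / ε) := by rw [hT]; ring
      _ ≤ Z * Z ^ 2 * Z := by gcongr
      _ = Z ^ 4 := by ring
  have hZle : Z ≤ Z ^ 4 := le_self_pow₀ (by linarith) (by norm_num)
  have hε4 : 1 / (ε / 4) ≤ Z ^ 4 := by
    calc 1 / (ε / 4) = 4 * (1 / ε) := by field_simp
      _ ≤ 4 * Z := by gcongr
      _ ≤ Z ^ 3 * Z := by
        have := pow_le_pow_left₀ (by norm_num) hZ2 3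
        gcongr; linarith
      _ = Z ^ 4 := by ring
  refine .seq (.setReal (.seq (.setReal (.seq (.setReal (.seq (.setReal ?_)))))))
  set s₁ := State.setR _ _ _ _ with hs₁
  have f₁ : Frame ∅ {30, 40} s s₁ :=
    ((((Frame.refl s).setR (by simp) _ _).setR (by simp) _ _).setR (by simp) _ _).setR (by simp) _ _
  have e0 : s₁.real 40 0 = ε / 4 := by simp [hs₁, h5]
  have e1 : s₁.real 30 1 = 0 := by simp [hs₁]
  have e2 : s₁.real 30 2 = T := by
    simp [hs₁, smE, hT, sm, h.c₁, h.c₂, h.σ, h.μ, h5, pow_two]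
  have e3 : s₁.real 30 3 = ε / (4 * (D.c₁ + D.c₂)) := by simp [hs₁, h.c₁, h.c₂, h5]
  clear_value s₁
  have d₁ := h.frame f₁ (by simp) (by simp) (by simp)
  have oracle : IsOracle N 30 minimizeXi (Finset.Icc 1 9) (Finset.Icc 2 20) s₁ 0 T (ε / 4) D.hr
      (IsApprox D (ε / 4)) :=
    { w_ne := by norm_num
      w_notMem := by simp
      two_mem := by simp
      run := fun t s' ht ht' hf h0 => by
        refine wp_minimizeXi (m := 4 * m) hN (by omega) hD ht (by linarith) (by omega) ?_ ?_ ?_ ?_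
          (d₁.frame hf (by simp) (by simp) (by simp)) h0 (by rw [hf.real 40 (by simp), e0])
        · rw [hZ4]; linarith
        · rw [hZ4]; linarith
        · rw [hZ4]; linarith
        · rw [hZ4]; exact hε4
      ge := by
        rintro t o ht ht' ⟨ξ, hξ, hsol, -, -⟩
        rw [hsol.val]
        exact hr_le hD hξ ht
      le := by
        rintro t o ht ht' ⟨ξ, hξ, -, -, hle⟩
        exact hle
      congr := fun t o o' he ho => ho.congr he }
  have hMtol : (T - 0) * (2 / 3) ^ (32 * m) ≤ ε / (4 * (D.c₁ + D.c₂)) := by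
    have e4 : ((2 : ℝ) / 3) ^ (32 * m) ≤ (Z ^ 16)⁻¹ := by
      have := two_thirds_pow_le (16 * m)
      rwa [show 2 * (16 * m) = 32 * m by ring,
        show (2 : ℝ) ^ (16 * m) = Z ^ 16 by rw [hZ, ← pow_mul, mul_comm]] at this
    rw [le_div_iff₀ (by positivity), sub_zero]
    have hZ0 : Z ≠ 0 := by linarith
    have p1 : (1 : ℝ) ≤ Z ^ 8 := one_le_pow₀ (by linarith)
    have p3 : (4 : ℝ) ≤ Z ^ 2 := by nlinarith
    have hεZ : 1 ≤ ε * Z := by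
      rw [div_le_iff₀ hε] at hεm; linarith
    calc T * (2 / 3) ^ (32 * m) * (4 * (D.c₁ + D.c₂))
        ≤ Z ^ 4 * (Z ^ 16)⁻¹ * (Z ^ 2 * Z) := by gcongr
      -- The inserted factor is at least `1` because `1 / ε ≤ Z`; it makes all powers of `Z` cancel
      -- and leaves `ε`.
      _ ≤ Z ^ 4 * (Z ^ 16)⁻¹ * (Z ^ 2 * Z) * (ε * Z * Z ^ 8) := by
        refine le_mul_of_one_le_right (by positivity) ?_
        nlinarith
      _ = ε := by field_simp
  refine (wp_search oracle (M := 32 * m) (Λ := max D.c₁ D.c₂) (by omega) hT0.le (by linarith)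
    (le_max_of_le_left hc1.le) e1 e2 e3 hMtol
    ((hr_convexOn hD).subset Set.Icc_subset_Ici_self (convex_Icc _ _)) ?_).mono ?_
  · intro t z ht htz _
    have := hr_lipschitz hD ht (ht.trans htz)
    rwa [abs_sub_comm, abs_of_nonneg (by linarith)] at this
  · rintro s₂ ⟨-, ⟨Q, hQ, -, hap⟩, hbest⟩
    refine ⟨Q, hQ, hap, fun Q' hQ' => ?_⟩
    have hΛ : max D.c₁ D.c₂ * (ε / (4 * (D.c₁ + D.c₂))) ≤ ε / 4 := by
      have h3 : max D.c₁ D.c₂ ≤ D.c₁ + D.c₂ := max_le (by linarith) (by linarith)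
      rw [mul_div_assoc', div_le_iff₀ (by positivity)]
      nlinarith
    rcases le_total Q' T with h' | h'
    · have := hbest Q' hQ' h'
      linarith
    -- Beyond `T`, `h` is at least `c₂ (Q' - μ)`, while `h(T)` exceeds `c₂ (T - μ)` by at most `ε /
    -- 4`; so `T` itself is good enough.
    · have h1 := hbest T hT0.le le_rfl
      have h2 := hr_upper hD hT0
      have h3 := le_hr_lower hD hQ'
      have h4 := mul_le_mul_of_nonneg_left h' hc2.le
      have h5 : (D.c₁ + D.c₂) * D.sm / (4 * T) ≤ ε / 4 := by
        rw [div_le_iff₀ (by positivity)]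
        have : ε / 4 * (4 * T) = (D.c₁ + D.c₂) * (D.sm + 1) := by rw [hT]; field_simp
        rw [this]
        nlinarith
      linarith

theorem le_two_pow_ceil_logb {X : ℝ} (hX : 0 < X) : X ≤ 2 ^ ⌈Real.logb 2 X⌉₊ := by
  calc X = (2 : ℝ) ^ Real.logb 2 X := (Real.rpow_logb (by norm_num) (by norm_num) hX).symm
    _ ≤ (2 : ℝ) ^ ((⌈Real.logb 2 X⌉₊ : ℕ) : ℝ) :=
      Real.rpow_le_rpow_of_exponent_le (by norm_num) (Nat.le_ceil _)
    _ = 2 ^ ⌈Real.logb 2 X⌉₊ := Real.rpow_natCast _ _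

theorem size_spec (hD : D.Admissible) (hQ : 0 ≤ Q) (hε : 0 < ε) :
    n ≤ D.size Q ε ∧ 1 ≤ D.size Q ε ∧ D.c₁ + D.c₂ ≤ 2 ^ D.size Q ε ∧
      1 + D.μ + D.σ ≤ 2 ^ D.size Q ε ∧ Q ≤ 2 ^ D.size Q ε ∧ 1 / ε ≤ 2 ^ D.size Q ε := by
  have hc1 := hD.c₁_pos
  have hc2 := hD.c₂_pos
  have hμ := hD.μ_nonneg
  have hσ := hD.σ_nonneg
  have hδ := abs_nonneg D.δ
  have hx : 0 ≤ ∑ i, |D.x i| := Finset.sum_nonneg fun i _ => abs_nonneg _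
  have hy : 0 < 1 / ε := by positivity
  have hX := le_two_pow_ceil_logb (X := 2 + D.c₁ + D.c₂ + |D.δ| + |D.μ| + |D.σ|
    + (∑ i, |D.x i|) + |Q|) (by positivity)
  have hY := le_two_pow_ceil_logb (X := 2 + 1 / ε) (by positivity)
  set a := ⌈Real.logb 2 (2 + D.c₁ + D.c₂ + |D.δ| + |D.μ| + |D.σ| + (∑ i, |D.x i|) + |Q|)⌉₊
  set b := ⌈Real.logb 2 (2 + 1 / ε)⌉₊
  have hsz : D.size Q ε = n + a + b := rfl
  have ha : (2 : ℝ) ^ a ≤ 2 ^ (n + a + b) := pow_le_pow_right₀ (by norm_num) (by omega)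
  have hb : (2 : ℝ) ^ b ≤ 2 ^ (n + a + b) := pow_le_pow_right₀ (by norm_num) (by omega)
  rw [abs_of_nonneg hμ, abs_of_nonneg hσ, abs_of_nonneg hQ] at hX
  have hn := hD.n_pos
  rw [hsz]
  refine ⟨by omega, by omega, ?_, ?_, ?_, ?_⟩ <;> linarith

/-- `minimize` with input and output in the prescribed places. -/
def minimizeProgram : Program :=
  .seq (.setReal 20 (.const 0) (rd 1 5)) <|
  .seq (.setReal 30 (.const 0) (rd 1 6)) <|
  .seq minimize <|
  .seq (.setReal 3 (.const 0) (rd 2 0)) <|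
  .seq (.setReal 2 (.const 0) (rd 2 1)) <|
  .seq (.setReal 2 (.const 1) (rd 2 2)) <|
  .setReal 2 (.const 2) (rd 3 0)

/-- `minimizeXi` with input and output in the prescribed places. -/
def minimizeXiProgram : Program :=
  .seq (.setReal 30 (.const 0) (rd 1 5)) <|
  .seq (.setReal 40 (.const 0) (rd 1 6)) <|
  .seq minimizeXi <|
  .seq (.setReal 2 (.const 1) (rd 2 0)) <|
  .setReal 2 (.const 0) (rd 2 3)

/-- `minimizeQ` with output in the prescribed places. -/
def minimizeQProgram : Program :=
  .seq minimizeQ <|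
  .seq (.setReal 3 (.const 0) (rd 2 0)) <|
  .seq (.setReal 2 (.const 0) (rd 2 4)) <|
  .seq (.setReal 2 (.const 4) (rd 3 0)) <|
  -- Recovers `λ₃ = ξ - λ₁`.
  .setReal 2 (.const 3) (rd 2 3 - rd 2 1)

theorem wp_minimizeProgram (hD : D.Admissible) (hξ : 0 < ξ) (hQ : 0 ≤ Q) :
    Wp (3 * n + 4) minimizeProgram (input D.x (D.params ++ [ξ, Q])) fun s' => 0 ≤ s'.real 2 0 ∧
      D.F (s'.real 2 0) (s'.real 2 1) (ξ - s'.real 2 0) Q = D.f ξ Q ∧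
      ((s'.real 2 2 : ℝ) : EReal) = D.f ξ Q := by
  have h := dataOK_input D [ξ, Q]
  have hξ' : (input D.x (D.params ++ [ξ, Q])).real 1 5 = ξ := by simp [input, params]
  have hQ' : (input D.x (D.params ++ [ξ, Q])).real 1 6 = Q := by simp [input, params]
  set s := input D.x (D.params ++ [ξ, Q])
  refine .seq (.setReal (.seq (.setReal (.seq ?_))))
  set s₁ := State.setR _ _ _ _ with hs₁
  have f₁ : Frame ∅ {20, 30} s s₁ := ((Frame.refl s).setR (by simp) _ _).setR (by simp) _ _
  refine (wp_minimize le_rfl hD hξ hQ ((h.frame f₁ (by simp) (by simp) (by simp)).ctx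
    (by simp [hs₁, hξ']) (by simp [hs₁, hQ']))).mono ?_
  rintro s₂ ⟨-, hsol⟩
  refine .seq (.setReal (.seq (.setReal (.seq (.setReal (.setReal ?_))))))
  simp only [F_eq hD.regular hξ, f_eq hD hξ hQ, EReal.coe_eq_coe_iff]
  simpa using ⟨hsol.nonneg, hsol.obj, hsol.val⟩

theorem wp_minimizeXiProgram {N : ℕ} (hD : D.Admissible) (hQ : 0 ≤ Q) (hε : 0 < ε)
    (hN : 128 * D.size Q ε + 4 ≤ N) :
    Wp N minimizeXiProgram (input D.x (D.params ++ [Q, ε])) fun s' => 0 < s'.real 2 0 ∧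
      ((s'.real 2 1 : ℝ) : EReal) = D.f (s'.real 2 0) Q ∧
      ((s'.real 2 1 : ℝ) : EReal) ≤ D.h Q + (ε : EReal) := by
  obtain ⟨z1, z2, z3, z4, z5, z6⟩ := size_spec hD hQ hε
  have h := dataOK_input D [Q, ε]
  have hQ' : (input D.x (D.params ++ [Q, ε])).real 1 5 = Q := by simp [input, params]
  have hε' : (input D.x (D.params ++ [Q, ε])).real 1 6 = ε := by simp [input, params]
  set s := input D.x (D.params ++ [Q, ε])
  refine .seq (.setReal (.seq (.setReal (.seq ?_))))
  set s₁ := State.setR _ _ _ _ with hs₁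
  have f₁ : Frame ∅ {30, 40} s s₁ := ((Frame.refl s).setR (by simp) _ _).setR (by simp) _ _
  refine (wp_minimizeXi (m := D.size Q ε) (by omega) (by omega) hD hQ hε z2 z3 z4 z5 z6
    (h.frame f₁ (by simp) (by simp) (by simp)) (by simp [hs₁, hQ']) (by simp [hs₁, hε'])).mono ?_
  rintro s₂ ⟨-, ξ, hξ, hsol, -, hle⟩
  refine .seq (.setReal (.setReal ?_))
  simp [hsol.arg, f_eq hD hξ hQ, h_eq hD hQ, hsol.val, hξ, ← EReal.coe_add]
  rw [← hsol.val]
  exact hle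

theorem wp_minimizeQProgram {N : ℕ} (hD : D.Admissible) (hε : 0 < ε) (hN : 128 * D.size 0 ε + 4 ≤ N) :
    Wp N minimizeQProgram (input D.x (D.params ++ [ε])) fun s' => 0 ≤ s'.real 2 0 ∧ 0 ≤ s'.real 2 1 ∧
      0 < s'.real 2 1 + s'.real 2 3 ∧
      ((s'.real 2 4 : ℝ) : EReal)
        = D.F (s'.real 2 1) (s'.real 2 2) (s'.real 2 3) (s'.real 2 0) ∧
      ((s'.real 2 4 : ℝ) : EReal) ≤ D.dualValue + (ε : EReal) := by
  obtain ⟨z1, z2, z3, z4, -, z6⟩ := size_spec hD le_rfl hε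
  have h := dataOK_input D [ε]
  have hε' : (input D.x (D.params ++ [ε])).real 1 5 = ε := by simp [input, params]
  set s := input D.x (D.params ++ [ε])
  refine .seq ((wp_minimizeQ (m := D.size 0 ε) (by omega) (by omega) hD hε z2 z3 z4 z6 h
    hε').mono ?_)
  rintro s₂ ⟨Q, hQ, ⟨ξ, hξ, hsol, h4, -⟩, hbest⟩
  obtain ⟨Qs, hQs, hmin⟩ := exists_hr_min hD
  refine .seq (.setReal (.seq (.setReal (.seq (.setReal (.setReal ?_))))))
  have hv : s₂.real 2 0 ≤ D.hr Qs + ε := hbest Qs hQs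
  rw [dualValue_eq hD hQs hmin, ← EReal.coe_add]
  simp [h4, hQ, hsol.nonneg, hsol.arg, hξ, F_eq hD.regular hξ, hsol.obj]
  exact ⟨by rw [hsol.val], by exact_mod_cast hv⟩

end Newsvendor

end

theorem proposition2p2 :
    -- the function `h` is real-valued, convex and `max c₁ c₂`-Lipschitz on `[0, ∞)`, it attains
    -- its minimum there, and this minimum is the optimal value of (D)
    (∀ (n : ℕ) (D : Newsvendor n), D.Admissible →
      ∃ hr : ℝ → ℝ, (∀ Q : ℝ, 0 ≤ Q → D.h Q = ((hr Q : ℝ) : EReal)) ∧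
        ConvexOn ℝ (Set.Ici (0 : ℝ)) hr ∧
        LipschitzOnWith (Real.toNNReal (max D.c₁ D.c₂)) hr (Set.Ici (0 : ℝ)) ∧
        ∃ Qs : ℝ, 0 ≤ Qs ∧ (∀ Q : ℝ, 0 ≤ Q → hr Qs ≤ hr Q) ∧
          D.dualValue = ((hr Qs : ℝ) : EReal)) ∧
    -- first layer: `f(ξ, Q)` and a minimizer `(λ₁, λ₂)`, exactly, in time polynomial in `n`
    (∃ (P : RealRAM.Program) (p : Polynomial ℕ),
      ∀ (n : ℕ) (D : Newsvendor n), D.Admissible → ∀ ξ Q : ℝ, 0 < ξ → 0 ≤ Q →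
        RealRAM.HaltsWith P (RealRAM.input D.x (D.params ++ [ξ, Q])) (p.eval n)
          (fun out => 0 ≤ out 0 ∧
            D.F (out 0) (out 1) (ξ - out 0) Q = D.f ξ Q ∧
            ((out 2 : ℝ) : EReal) = D.f ξ Q)) ∧
    -- second layer: `h(Q)` to accuracy `ε`, in polynomial time
    (∃ (P : RealRAM.Program) (p : Polynomial ℕ),
      ∀ (n : ℕ) (D : Newsvendor n), D.Admissible → ∀ Q ε : ℝ, 0 ≤ Q → 0 < ε →
        RealRAM.HaltsWith P (RealRAM.input D.x (D.params ++ [Q, ε])) (p.eval (D.size Q ε))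
          (fun out => 0 < out 0 ∧
            ((out 1 : ℝ) : EReal) = D.f (out 0) Q ∧
            ((out 1 : ℝ) : EReal) ≤ D.h Q + (ε : EReal))) ∧
    -- third layer: a feasible `ε`-optimal `(Q, λ)` of (D) and its value, in polynomial time
    (∃ (P : RealRAM.Program) (p : Polynomial ℕ),
      ∀ (n : ℕ) (D : Newsvendor n), D.Admissible → ∀ ε : ℝ, 0 < ε →
        RealRAM.HaltsWith P (RealRAM.input D.x (D.params ++ [ε])) (p.eval (D.size 0 ε))
          (fun out => 0 ≤ out 0 ∧ 0 ≤ out 1 ∧ 0 < out 1 + out 3 ∧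
            ((out 4 : ℝ) : EReal) = D.F (out 1) (out 2) (out 3) (out 0) ∧
            ((out 4 : ℝ) : EReal) ≤ D.dualValue + (ε : EReal))) := by
  -- The operation count is a polynomial in the pass bound `N`; substituting `N = a m + b` gives a
  -- polynomial in the size that depends on the program only.
  have hcomp : ∀ (P : RealRAM.Program) (a b : ℕ), ∃ p : Polynomial ℕ, ∀ (m : ℕ) (s : RealRAM.State)
      (post : (ℕ → ℝ) → Prop), RealRAM.Wp (a * m + b) P s (fun s' => post (s'.real 2)) →
      RealRAM.HaltsWith P s (p.eval m) post := by
    intro P a b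
    obtain ⟨p, hp⟩ := P.exists_polynomial_bound
    refine ⟨p.comp (Polynomial.C a * Polynomial.X + Polynomial.C b), fun m s post h => ?_⟩
    have := h.haltsWith hp
    simpa [Polynomial.eval_comp] using this
  refine ⟨fun n D hD => ?_, ?_, ?_, ?_⟩
  · obtain ⟨Qs, hQs, hmin⟩ := Newsvendor.exists_hr_min hD
    exact ⟨D.hr, fun Q hQ => Newsvendor.h_eq hD hQ, Newsvendor.hr_convexOn hD,
      Newsvendor.hr_lipschitzOn hD, Qs, hQs, hmin, Newsvendor.dualValue_eq hD hQs hmin⟩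
  · obtain ⟨p, hp⟩ := hcomp Newsvendor.minimizeProgram 3 4
    exact ⟨_, p, fun n D hD ξ Q hξ hQ => hp n _ _ (Newsvendor.wp_minimizeProgram hD hξ hQ)⟩
  · obtain ⟨p, hp⟩ := hcomp Newsvendor.minimizeXiProgram 128 4
    exact ⟨_, p, fun n D hD Q ε hQ hε => hp _ _ _ (Newsvendor.wp_minimizeXiProgram hD hQ hε le_rfl)⟩
  · obtain ⟨p, hp⟩ := hcomp Newsvendor.minimizeQProgram 128 4
    exact ⟨_, p, fun n D hD ε hε => hp _ _ _ (Newsvendor.wp_minimizeQProgram hD hε le_rfl)⟩
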